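/- Let $E$ and $B$ be smooth finite-dimensional real manifolds, $E$ Hausdorff, and let $p:E\to B$ be a smooth submersion (for instance $J^k(\pi)\to B$ for a vector bundle $\pi$ over $B$). Let $\mathcal D_V=\ker dp$ be the vertical distribution, let $g$ be a pseudo-Riemannian metric on $E$ whose restriction to $\mathcal D_V$ is positive definite, and let $\mathcal D_H$ be the $g$-orthogonal complement of $\mathcal D_V$, so that $TE=\mathcal D_H\oplus\mathcal D_V$. This splitting induces a bigrading $\Omega^n(E)=\bigoplus_{a+b=n}\Omega^{a,b}$ of the differential forms ($a$ the horizontal and $b$ the vertical degree). Let $d^g_V$ be the component $\Omega^{a,b}\to\Omega^{a,b+1}$ of the exterior derivative; on functions, $(d^g_Vf)(X)=df(X_V)$, where $X_V$ is the vertical part of $X$. Let $\Omega_\bullet(E)$ be the algebra of smooth multivector fields on $E$ under $\wedge$. For vector fields $X_1,\dots,X_n$ put $i_{X_1\wedge\dots\wedge X_n}\alpha=X_1\lrcorner(\cdots(X_n\lrcorner\,\alpha))$, where $\lrcorner$ is insertion in the first argument, put $i_f\alpha=f\alpha$ for functions, and extend $X\mapsto i_X$ additively to all of $\Omega_\bullet(E)$.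 Let $[F,G]=F\circ G-(-1)^{|F||G|}G\circ F$ be the graded commutator of graded endomorphisms of $\Omega^\bullet(E)$. For a form $\theta$ of degree one let $\bar i(\theta)$ be the conjugate insertion operator on multivector fields, $\bar i(\theta)(X_1\wedge\dots\wedge X_n)=\sum_i(-1)^{i-1}\theta(X_i)\,X_1\wedge\dots\widehat{X_i}\dots\wedge X_n$. The map $X\mapsto i_X$ is injective, and: (a) For all $X,Y\in\Omega_\bullet(E)$ the derived bracket $[[i_X,d^g_V],i_Y]$ is again of the form $i_Z$ with $Z\in\Omega_\bullet(E)$. Hence there is a unique bracket on $\Omega_\bullet(E)$, the vertical Schouten–Nijenhuis bracket, with $$i_{[\![X,Y]\!]}=[[i_X,d^g_V],i_Y]\qquad\text{for all }X,Y.$$ (b) For $f\in C^\infty(E)$ and $X\in\Omega_\bullet(E)$, $$[\![f,X]\!]=-\bar i(d^g_Vf)X,$$ and if $X$ is homogeneous of degree $k$, then $[\![X,f]\!]=(-1)^{k+1}\,\bar i(d^g_Vf)X$. (c) For vector fields $X_1,\dots,X_p$ and $Y_1,\dots,Y_q$ with $p,q\ge1$, $$[\![X_1\wedge\dots\wedge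 X_p,\,Y_1\wedge\dots\wedge Y_q]\!]=\sum_{i,j}(-1)^{i+j}[\![X_i,Y_j]\!]\wedge X_1\wedge\dots\widehat{X_i}\dots\wedge X_p\wedge Y_1\wedge\dots\widehat{Y_j}\dots\wedge Y_q .$$ -/

import Mathlib

open scoped Manifold ContDiff Topology
open Bundle

namespace VerticalSchouten
set_option linter.unusedSectionVars false

noncomputable section

/-! ### Linear algebra on one vector space -/

section Linear

variable {V : Type*} [AddCommGroup V] [Module ℝ V]

/-- The graded space of alternating forms on `V`.  For finite-dimensional `V` the components of
degree larger than `dim V` vanish, so that the product is the direct sum. -/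
abbrev AltForms (V : Type*) [AddCommGroup V] [Module ℝ V] : Type _ := ∀ n : ℕ, V [⋀^Fin n]→ₗ[ℝ] ℝ

/-- Insertion of a vector in the first slot, lowering degrees by one. -/
def insertVec : V →ₗ[ℝ] Module.End ℝ (AltForms V) where
  toFun v :=
    { toFun := fun α n => (α (n + 1)).curryLeft v
      map_add' := fun α β => by ext n w; simp
      map_smul' := fun c α => by ext n w; simp }
  map_add' v w := by ext α n u; simp
  map_smul' c v := by ext α n u; simp

theorem insertVec_mul_self (v : V) : insertVec v * insertVec v = 0 := by
  ext α n u
  simp [insertVec]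

/-- The algebra homomorphism `X ↦ i_X` with `i_{v₁ ∧ ⋯ ∧ vₖ} α = v₁ ⌟ (⋯ (vₖ ⌟ α))`. -/
def insertAt : ExteriorAlgebra ℝ V →ₐ[ℝ] Module.End ℝ (AltForms V) :=
  ExteriorAlgebra.lift ℝ ⟨insertVec, insertVec_mul_self⟩

/-- The arguments `v` with `P` applied in the slots in `S` and `1 - P` in the other slots. -/
def splitArgs (P : V →ₗ[ℝ] V) {n : ℕ} (S : Finset (Fin n)) (v : Fin n → V) : Fin n → V :=
  fun i => if i ∈ S then P (v i) else v i - P (v i)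

theorem splitArgs_update (P : V →ₗ[ℝ] V) {n : ℕ} (S : Finset (Fin n)) (v : Fin n → V)
    (i : Fin n) (z : V) : splitArgs P S (Function.update v i z) =
      Function.update (splitArgs P S v) i (if i ∈ S then P z else z - P z) := by
  ext j
  by_cases hj : j = i
  · subst hj; simp [splitArgs]
  · simp [splitArgs, hj]

/-- The component of `α` of vertical degree `q` (and horizontal degree `n - q`), where `P` is the
projection onto the vertical subspace along the horizontal one: the sum, over all sets `S` of `q`
slots, of `α` with the vertical parts of its arguments in the slots in `S` and the horizontal parts
in the other slots. -/
def vertPart (P : V →ₗ[ℝ] V) (q : ℕ) {n : ℕ} :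
    (V [⋀^Fin n]→ₗ[ℝ] ℝ) →ₗ[ℝ] (V [⋀^Fin n]→ₗ[ℝ] ℝ) where
  toFun α :=
    { toFun := fun v => ∑ S ∈ (Finset.univ : Finset (Fin n)).powersetCard q, α (splitArgs P S v)
      map_update_add' := by
        intro inst v i x y
        obtain rfl : inst = instDecidableEqFin n := Subsingleton.elim _ _
        rw [← Finset.sum_add_distrib]
        refine Finset.sum_congr rfl fun S _ => ?_
        rw [splitArgs_update, splitArgs_update, splitArgs_update, ← α.map_update_add]
        congr 2
        split_ifs
        · simp
        · simp only [map_add]; abel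
      map_update_smul' := by
        intro inst v i c x
        obtain rfl : inst = instDecidableEqFin n := Subsingleton.elim _ _
        rw [Finset.smul_sum]
        refine Finset.sum_congr rfl fun S _ => ?_
        rw [splitArgs_update, splitArgs_update, ← α.map_update_smul]
        congr 2
        split_ifs <;> simp [smul_sub]
      map_eq_zero_of_eq' := by
        intro v i j hij hne
        have hswap : ∀ k, v (Equiv.swap i j k) = v k := by
          intro k
          by_cases h1 : k = i
          · subst h1; simp [hij]
          by_cases h2 : k = j
          · subst h2; simp [hij]
          rw [Equiv.swap_apply_of_ne_of_ne h1 h2]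
        have hsum : (∑ S ∈ (Finset.univ : Finset (Fin n)).powersetCard q, α (splitArgs P S v)) =
            ∑ S ∈ (Finset.univ : Finset (Fin n)).powersetCard q, -α (splitArgs P S v) := by
          refine Finset.sum_bij' (fun S _ => S.map (Equiv.swap i j).toEmbedding)
            (fun S _ => S.map (Equiv.swap i j).toEmbedding) ?_ ?_ ?_ ?_ ?_
          · intro S hS; simpa [Finset.mem_powersetCard] using hS
          · intro S hS; simpa [Finset.mem_powersetCard] using hS
          · intro S hS; ext k; simp [Finset.mem_map_equiv]
          · intro S hS; ext k; simp [Finset.mem_map_equiv]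
          · intro S hS
            rw [← α.map_swap _ hne]
            congr 1
            ext k
            simp [splitArgs, hswap]
        rw [Finset.sum_neg_distrib] at hsum
        linarith }
  map_add' α β := by ext v; simp [Finset.sum_add_distrib]
  map_smul' c α := by ext v; simp [Finset.mul_sum]

theorem vertPart_apply (P : V →ₗ[ℝ] V) (q : ℕ) {n : ℕ} (α : V [⋀^Fin n]→ₗ[ℝ] ℝ) (v : Fin n → V) :
    vertPart P q α v =
      ∑ S ∈ (Finset.univ : Finset (Fin n)).powersetCard q, α (splitArgs P S v) := rfl

/-- A form is the sum of its components of the various bidegrees. -/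
theorem sum_vertPart (P : V →ₗ[ℝ] V) {n : ℕ} (α : V [⋀^Fin n]→ₗ[ℝ] ℝ) :
    ∑ q ∈ Finset.range (n + 1), vertPart P q α = α := by
  ext v
  have h := α.toMultilinearMap.map_add_univ (fun i => P (v i)) (fun i => v i - P (v i))
  have e : ((fun i => P (v i)) + fun i => v i - P (v i)) = v := by ext i; simp
  rw [e] at h
  have h2 := Finset.sum_powerset (Finset.univ : Finset (Fin n)) (fun S => α (splitArgs P S v))
  rw [Finset.powerset_univ, Finset.card_univ, Fintype.card_fin] at h2
  have hs : ∀ s : Finset ℕ,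
      (∑ q ∈ s, vertPart P q α) v = ∑ q ∈ s, ∑ S ∈ (Finset.univ : Finset (Fin n)).powersetCard q,
        α (splitArgs P S v) := by
    intro s
    induction s using Finset.induction_on with
    | empty => simp
    | insert q s hq ih => rw [Finset.sum_insert hq, Finset.sum_insert hq, ← ih]; rfl
  rw [hs]
  rw [← h2]
  refine Eq.trans (Finset.sum_congr rfl fun S _ => ?_) h.symm
  change α _ = α _
  congr 1

end Linear

section Smooth
variable {F : Type*} [NormedAddCommGroup F] [NormedSpace ℝ F] [FiniteDimensional ℝ F]

theorem altMap_expand {V : Type*} [AddCommGroup V] [Module ℝ V] {ι : Type*} [Fintype ι]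
    (b : Module.Basis ι ℝ V) {n : ℕ}
    (f : V [⋀^Fin n]→ₗ[ℝ] ℝ) (v : Fin n → V) :
    f v = ∑ r : Fin n → ι, (∏ i, b.repr (v i) (r i)) * f (fun i => b (r i)) := by
  classical
  have h := f.toMultilinearMap.map_sum (fun i k => b.repr (v i) k • b k)
  simp only [Module.Basis.sum_repr] at h
  refine Eq.trans h (Finset.sum_congr rfl fun r _ => ?_)
  exact f.toMultilinearMap.map_smul_univ (fun i => b.repr (v i) (r i)) (fun i => b (r i))

/-- An alternating map on a finite-dimensional normed space, as a continuous alternating map. -/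
def toContAlt {n : ℕ} (f : F [⋀^Fin n]→ₗ[ℝ] ℝ) : F [⋀^Fin n]→L[ℝ] ℝ :=
  { f with
    cont := by
      let b := Module.finBasis ℝ F
      change Continuous fun v => f v
      rw [show (fun v => f v) = _ from funext (altMap_expand b f)]
      refine continuous_finsetSum _ fun r _ => Continuous.mul ?_ continuous_const
      refine continuous_finsetProd _ fun i _ => ?_
      exact (LinearMap.continuous_of_finiteDimensional (b.coord (r i))).comp (continuous_apply i) }

@[simp] theorem toContAlt_apply {n : ℕ} (f : F [⋀^Fin n]→ₗ[ℝ] ℝ) (v : Fin n → F) :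
    toContAlt f v = f v := rfl

theorem contDiffOn_contAlt {A : Type*} [NormedAddCommGroup A] [NormedSpace ℝ A] {s : Set A} {n : ℕ}
    {f : A → F [⋀^Fin n]→L[ℝ] ℝ} (hf : ∀ v : Fin n → F, ContDiffOn ℝ ∞ (fun y => f y v) s) :
    ContDiffOn ℝ ∞ f s := by
  let b := Module.finBasis ℝ F
  let L : (F [⋀^Fin n]→L[ℝ] ℝ) →ₗ[ℝ] ((Fin n → Fin (Module.finrank ℝ F)) → ℝ) :=
    { toFun := fun α r => α (fun i => b (r i))
      map_add' := fun α β => rfl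
      map_smul' := fun c α => rfl }
  have hL : LinearMap.ker L = ⊥ := by
    rw [LinearMap.ker_eq_bot]
    intro α β h
    ext v
    have h1 := altMap_expand b α.toAlternatingMap v
    have h2 := altMap_expand b β.toAlternatingMap v
    refine h1.trans (Eq.trans (Finset.sum_congr rfl fun r _ => ?_) h2.symm)
    congr 1
    exact congrFun h r
  obtain ⟨K, hK⟩ := L.exists_leftInverse_of_injective hL
  have hfK : f = fun y => (LinearMap.toContinuousLinearMap K) (fun r => f y (fun i => b (r i))) := by
    ext1 y
    exact (LinearMap.congr_fun hK (f y)).symm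
  rw [hfK]
  exact (LinearMap.toContinuousLinearMap K).contDiff.comp_contDiffOn
    (contDiffOn_pi.2 fun r => hf _)
end Smooth

section Coord
variable {F : Type*} [NormedAddCommGroup F] [NormedSpace ℝ F] [FiniteDimensional ℝ F]
  {G : Type*} [NormedAddCommGroup G] [NormedSpace ℝ G] [FiniteDimensional ℝ G]

/-- The transpose of `A`. -/
def transposeCLM : (F →L[ℝ] G) →L[ℝ] ((G →L[ℝ] ℝ) →L[ℝ] (F →L[ℝ] ℝ)) :=
  (ContinuousLinearMap.compL ℝ F G ℝ).flip

/-- The map `B⁻¹ Aᵀ`. -/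
def sharpOp (A : F →L[ℝ] G) (B : F →L[ℝ] F →L[ℝ] ℝ) : (G →L[ℝ] ℝ) →L[ℝ] F :=
  B.inverse.comp (transposeCLM A)

/-- The `B`-orthogonal projection onto the orthogonal complement of `ker A`. -/
def horOp (A : F →L[ℝ] G) (B : F →L[ℝ] F →L[ℝ] ℝ) : F →L[ℝ] F :=
  (sharpOp A B).comp ((A.comp (sharpOp A B)).inverse.comp A)

theorem isInvertible_of_injective {V W : Type*} [NormedAddCommGroup V] [NormedSpace ℝ V]
    [FiniteDimensional ℝ V] [NormedAddCommGroup W] [NormedSpace ℝ W] [FiniteDimensional ℝ W]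
    (f : V →L[ℝ] W) (hd : Module.finrank ℝ V = Module.finrank ℝ W) (h : Function.Injective f) :
    f.IsInvertible := by
  let e := (LinearEquiv.ofInjectiveOfFinrankEq f.toLinearMap h hd).toContinuousLinearEquiv
  exact ⟨e, by ext v; rfl⟩

theorem finrank_dualCLM (V : Type*) [NormedAddCommGroup V] [NormedSpace ℝ V]
    [FiniteDimensional ℝ V] : Module.finrank ℝ (V →L[ℝ] ℝ) = Module.finrank ℝ V := by
  rw [← LinearEquiv.finrank_eq (LinearMap.toContinuousLinearMap (𝕜 := ℝ) (E := V) (F' := ℝ))]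
  exact Subspace.dual_finrank_eq

variable {A : F →L[ℝ] G} {B : F →L[ℝ] F →L[ℝ] ℝ}

theorem B_invertible (hn : ∀ v, (∀ w, B v w = 0) → v = 0) : B.IsInvertible := by
  refine isInvertible_of_injective B (finrank_dualCLM F).symm ?_
  rw [← ContinuousLinearMap.coe_coe, ← LinearMap.ker_eq_bot, LinearMap.ker_eq_bot']
  intro v hv
  exact hn v fun w => by simpa using congrArg (fun f => f w) hv

theorem sharpOp_spec (hn : ∀ v, (∀ w, B v w = 0) → v = 0) (η : G →L[ℝ] ℝ) (k : F) :
    B (sharpOp A B η) k = η (A k) := by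
  obtain ⟨e, he⟩ := B_invertible hn
  subst he
  simp [sharpOp, transposeCLM]

theorem M_invertible (hn : ∀ v, (∀ w, B v w = 0) → v = 0) (hA : Function.Surjective A)
    (hp : ∀ v, A v = 0 → v ≠ 0 → 0 < B v v) : (A.comp (sharpOp A B)).IsInvertible := by
  refine isInvertible_of_injective _ (finrank_dualCLM G) ?_
  rw [← ContinuousLinearMap.coe_coe, ← LinearMap.ker_eq_bot, LinearMap.ker_eq_bot']
  intro η hη
  have h0 : A (sharpOp A B η) = 0 := hη
  have h1 : sharpOp A B η = 0 := by
    by_contra hne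
    have := hp _ h0 hne
    rw [sharpOp_spec hn, h0, map_zero] at this
    exact lt_irrefl _ this
  ext y
  obtain ⟨k, rfl⟩ := hA y
  rw [← sharpOp_spec hn, h1]; simp

theorem A_horOp (hn : ∀ v, (∀ w, B v w = 0) → v = 0) (hA : Function.Surjective A)
    (hp : ∀ v, A v = 0 → v ≠ 0 → 0 < B v v) (v : F) : A (horOp A B v) = A v := by
  obtain ⟨e, he⟩ := M_invertible hn hA hp
  have : A (horOp A B v) = (A.comp (sharpOp A B)) ((A.comp (sharpOp A B)).inverse (A v)) := rfl
  rw [this, ← he]; simp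

theorem B_horOp (hn : ∀ v, (∀ w, B v w = 0) → v = 0) (v k : F) (hk : A k = 0) :
    B (horOp A B v) k = 0 := by
  have : horOp A B v = sharpOp A B ((A.comp (sharpOp A B)).inverse (A v)) := rfl
  rw [this, sharpOp_spec hn, hk, map_zero]

variable {E : Type*} [TopologicalSpace E] [ChartedSpace F E] 

theorem contMDiffAt_clm {V X : Type*} [NormedAddCommGroup V] [NormedSpace ℝ V]
    [FiniteDimensional ℝ V] [NormedAddCommGroup X] [NormedSpace ℝ X]
    {f : E → V →L[ℝ] X} {x₀ : E}
    (hf : ∀ v, ContMDiffAt 𝓘(ℝ, F) 𝓘(ℝ, X) ∞ (fun x => f x v) x₀) :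
    ContMDiffAt 𝓘(ℝ, F) 𝓘(ℝ, V →L[ℝ] X) ∞ f x₀ := by
  let b := Module.finBasis ℝ V
  have : f = fun x => ∑ i, (ContinuousLinearMap.smulRightL ℝ V X
      (LinearMap.toContinuousLinearMap (b.coord i))) (f x (b i)) := by
    ext x v
    conv_lhs => rw [← b.sum_repr v, map_sum]
    rw [sum_apply]
    refine Finset.sum_congr rfl fun i _ => ?_
    simp
  rw [this]
  refine contMDiffAt_finsetSum fun i _ => ?_
  exact (ContinuousLinearMap.smulRightL ℝ V X
      (LinearMap.toContinuousLinearMap (b.coord i))).contMDiff.contMDiffAt.comp x₀ (hf (b i))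

theorem contMDiffAt_inverse {X Y : Type*} [NormedAddCommGroup X] [NormedSpace ℝ X] [CompleteSpace X]
    [NormedAddCommGroup Y] [NormedSpace ℝ Y] {f : E → X →L[ℝ] Y} {x₀ : E}
    (hf : ContMDiffAt 𝓘(ℝ, F) 𝓘(ℝ, X →L[ℝ] Y) ∞ f x₀) (hi : (f x₀).IsInvertible) :
    ContMDiffAt 𝓘(ℝ, F) 𝓘(ℝ, Y →L[ℝ] X) ∞ (fun x => (f x).inverse) x₀ :=
  (hi.contDiffAt_map_inverse (n := ∞)).contMDiffAt.comp x₀ hf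

set_option synthInstance.maxHeartbeats 200000 in
theorem contMDiffAt_horOp {a : E → F →L[ℝ] G} {β : E → F →L[ℝ] F →L[ℝ] ℝ} {x₀ : E}
    (ha : ContMDiffAt 𝓘(ℝ, F) 𝓘(ℝ, F →L[ℝ] G) ∞ a x₀)
    (hβ : ContMDiffAt 𝓘(ℝ, F) 𝓘(ℝ, F →L[ℝ] F →L[ℝ] ℝ) ∞ β x₀)
    (h1 : (β x₀).IsInvertible) (h2 : ((a x₀).comp (sharpOp (a x₀) (β x₀))).IsInvertible) :
    ContMDiffAt 𝓘(ℝ, F) 𝓘(ℝ, F →L[ℝ] F) ∞ (fun x => horOp (a x) (β x)) x₀ := by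
  have ht : ContMDiffAt 𝓘(ℝ, F) 𝓘(ℝ, (G →L[ℝ] ℝ) →L[ℝ] (F →L[ℝ] ℝ)) ∞
      (fun x => transposeCLM (a x)) x₀ := by
    refine contMDiffAt_clm fun η => ?_
    exact (contMDiffAt_const (c := η)).clm_comp ha
  have hS : ContMDiffAt 𝓘(ℝ, F) 𝓘(ℝ, (G →L[ℝ] ℝ) →L[ℝ] F) ∞
      (fun x => sharpOp (a x) (β x)) x₀ := (contMDiffAt_inverse hβ h1).clm_comp ht
  exact hS.clm_comp ((contMDiffAt_inverse (ha.clm_comp hS) h2).clm_comp ha)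

end Coord

section Manifold

variable (F : Type*) [NormedAddCommGroup F] [NormedSpace ℝ F] (E : Type*) [TopologicalSpace E] [ChartedSpace F E] [IsManifold 𝓘(ℝ, F) ∞ E]

/-- The smooth vector fields on `E`. -/
abbrev VectorField : Type _ := Cₛ^∞⟮𝓘(ℝ, F); F, (TangentSpace 𝓘(ℝ, F) : E → Type _)⟯

/-- Differential forms on `E`, of mixed degree and without smoothness. -/
abbrev RawForm : Type _ := ∀ x : E, AltForms (TangentSpace 𝓘(ℝ, F) x)

/-- The graded space `Ω(E)` of smooth differential forms: those whose values on smooth vector fields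
are smooth functions. -/
def Forms : Submodule ℝ (RawForm F E) where
  carrier := {α | ∀ (n : ℕ) (V : Fin n → VectorField F E),
    ContMDiff 𝓘(ℝ, F) 𝓘(ℝ, ℝ) ∞ (fun x => α x n (fun i => V i x))}
  add_mem' := fun h₁ h₂ _ _ => (h₁ _ _).add (h₂ _ _)
  zero_mem' := fun _ _ => contMDiff_const
  smul_mem' := fun c _ h n V =>
    (contMDiff_const (I := 𝓘(ℝ, F)) (I' := 𝓘(ℝ, ℝ)) (c := c)).smul (h n V)

variable {F E}

theorem mem_forms {α : RawForm F E} : α ∈ Forms F E ↔ ∀ (n : ℕ) (V : Fin n → VectorField F E),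
    ContMDiff 𝓘(ℝ, F) 𝓘(ℝ, ℝ) ∞ (fun x => α x n (fun i => V i x)) := Iff.rfl

/-- A coordinate vector field, cut off. -/
theorem exists_vectorField [FiniteDimensional ℝ F] [T2Space E] (x₀ : E) {x : E} (hx : x ∈ (chartAt F x₀).source) (v : F) :
    ∃ W : VectorField F E, ∀ᶠ y in 𝓝 x, W y = (trivializationAt F (TangentSpace 𝓘(ℝ, F)) x₀).symmL ℝ y v := by
  set e := trivializationAt F (TangentSpace 𝓘(ℝ, F) : E → Type _) x₀ with he
  have hsm : ContMDiffOn 𝓘(ℝ, F) (𝓘(ℝ, F).prod 𝓘(ℝ, F)) ∞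
      (fun y => TotalSpace.mk' F y (e.symmL ℝ y v)) e.baseSet := by
    rw [e.contMDiffOn_section_baseSet_iff]
    refine (contMDiffOn_const (c := v)).congr fun y hy => ?_
    rw [e.symmL_apply (R := ℝ) hy]
    simp [hy]
  have hxb : x ∈ e.baseSet := by simpa [he] using hx
  obtain ⟨f, -, hf⟩ := ((SmoothBumpFunction.nhds_basis_tsupport (I := 𝓘(ℝ, F)) x).mem_iff.1
    (e.open_baseSet.mem_nhds hxb))
  refine ⟨⟨fun y => (f y : ℝ) • e.symmL ℝ y v,
    ContMDiffOn.smul_section_of_tsupport (f.contMDiff.contMDiffOn) e.open_baseSet hf hsm⟩, ?_⟩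
  filter_upwards [f.eventuallyEq_one] with y hy
  change (f y : ℝ) • (e.symmL ℝ y v) = _
  rw [hy]; exact one_smul ℝ _

/-- The form `α` in the chart around `x₀`: its pullback under the inverse chart. -/
def chartForm [FiniteDimensional ℝ F] (α : RawForm F E) (x₀ : E) (n : ℕ) (y : F) :
    F [⋀^Fin n]→L[ℝ] ℝ :=
  toContAlt ((α ((extChartAt 𝓘(ℝ, F) x₀).symm y) n).compLinearMap
    (mfderiv 𝓘(ℝ, F) 𝓘(ℝ, F) (extChartAt 𝓘(ℝ, F) x₀).symm y :
      F →L[ℝ] TangentSpace 𝓘(ℝ, F) ((extChartAt 𝓘(ℝ, F) x₀).symm y)).toLinearMap)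

/-- The exterior derivative, computed at `x` in the chart around `x`. -/
def rawExtDeriv [FiniteDimensional ℝ F] (α : RawForm F E) : RawForm F E := fun x n =>
  match n with
  | 0 => 0
  | n + 1 => (extDeriv (chartForm α x n) (extChartAt 𝓘(ℝ, F) x x)).toAlternatingMap.compLinearMap
      (mfderiv 𝓘(ℝ, F) 𝓘(ℝ, F) (extChartAt 𝓘(ℝ, F) x) x :
        TangentSpace 𝓘(ℝ, F) x →L[ℝ] F).toLinearMap

theorem chartForm_apply [FiniteDimensional ℝ F] (α : RawForm F E) (x₀ : E) (n : ℕ) {p : E}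
    (hp : p ∈ (chartAt F x₀).source) (v : Fin n → F) :
    chartForm α x₀ n (extChartAt 𝓘(ℝ, F) x₀ p) v =
      α p n (fun i => (trivializationAt F (TangentSpace 𝓘(ℝ, F)) x₀).symmL ℝ p (v i)) := by
  have key : ∀ (q : E) (hq : q = p) (w : Fin n → F), α q n w = α p n w := by
    rintro q rfl w; rfl
  have hp' : p ∈ (extChartAt 𝓘(ℝ, F) x₀).source := by simpa using hp
  refine (key _ ((extChartAt 𝓘(ℝ, F) x₀).left_inv hp') _).trans ?_
  rw [TangentBundle.symmL_trivializationAt hp, modelWithCornersSelf_coe, Set.range_id,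
    mfderivWithin_univ]
  rfl

theorem chartForm_contDiffOn [FiniteDimensional ℝ F] [T2Space E] {α : RawForm F E} (hα : α ∈ Forms F E) (x₀ : E) (n : ℕ) :
    ContDiffOn ℝ ∞ (chartForm α x₀ n) (extChartAt 𝓘(ℝ, F) x₀).target := by
  refine contDiffOn_contAlt fun v y hy => ?_
  refine ContDiffAt.contDiffWithinAt ?_
  set p := (extChartAt 𝓘(ℝ, F) x₀).symm y with hp
  have hps : p ∈ (chartAt F x₀).source := by
    simpa [hp] using (extChartAt 𝓘(ℝ, F) x₀).map_target hy
  choose W hW using fun i => exists_vectorField x₀ hps (v i)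
  have h1 : ContMDiffAt 𝓘(ℝ, F) 𝓘(ℝ, ℝ) ∞
      ((fun x => α x n (fun i => W i x)) ∘ (extChartAt 𝓘(ℝ, F) x₀).symm) y :=
    ContMDiffAt.comp y (mem_forms.1 hα n W p) ((contMDiffOn_extChartAt_symm x₀).contMDiffAt
      ((isOpen_extChartAt_target x₀).mem_nhds hy))
  refine (contMDiffAt_iff_contDiffAt.1 h1).congr_of_eventuallyEq ?_
  have hc : ContinuousAt (extChartAt 𝓘(ℝ, F) x₀).symm y :=
    ((contMDiffOn_extChartAt_symm (n := ∞) x₀).continuousOn).continuousAt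
      ((isOpen_extChartAt_target x₀).mem_nhds hy)
  have h2 := hc.eventually (Filter.eventually_all.2 hW)
  filter_upwards [h2, (isOpen_extChartAt_target (I := 𝓘(ℝ, F)) x₀).mem_nhds hy] with z hz hzt
  have hzs : (extChartAt 𝓘(ℝ, F) x₀).symm z ∈ (chartAt F x₀).source := by
    simpa using (extChartAt 𝓘(ℝ, F) x₀).map_target hzt
  have h3 := chartForm_apply α x₀ n hzs v
  rw [(extChartAt 𝓘(ℝ, F) x₀).right_inv hzt] at h3
  rw [h3]
  simp only [Function.comp_apply, hz]

theorem rawExtDeriv_apply [FiniteDimensional ℝ F] [T2Space E] {α : RawForm F E}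
    (hα : α ∈ Forms F E) (x₀ : E) {x : E} (hx : x ∈ (chartAt F x₀).source) (n : ℕ)
    (v : Fin (n + 1) → TangentSpace 𝓘(ℝ, F) x) :
    rawExtDeriv α x (n + 1) v = extDeriv (chartForm α x₀ n) (extChartAt 𝓘(ℝ, F) x₀ x)
      (fun i => (trivializationAt F (TangentSpace 𝓘(ℝ, F)) x₀).continuousLinearMapAt ℝ x (v i)) := by
  set φ := extChartAt 𝓘(ℝ, F) x with hφ
  set φ₀ := extChartAt 𝓘(ℝ, F) x₀ with hφ₀
  have hxs : x ∈ φ.source := mem_extChartAt_source x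
  have hxs₀ : x ∈ φ₀.source := by simpa [hφ₀] using hx
  have hτ : ContDiffAt ℝ ∞ (φ₀ ∘ φ.symm) (φ x) := by
    have hmem : φ x ∈ (φ.symm.trans φ₀).source := by
      refine ⟨φ.map_source hxs, ?_⟩
      change φ.symm (φ x) ∈ φ₀.source
      rwa [φ.left_inv hxs]
    have := contDiffWithinAt_ext_coord_change (I := 𝓘(ℝ, F)) (n := ∞) x₀ x hmem
    rwa [modelWithCornersSelf_coe, Set.range_id, contDiffWithinAt_univ] at this
  have hfd : ∀ p ∈ φ.source ∩ φ₀.source,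
      fderiv ℝ (φ₀ ∘ φ.symm) (φ p) = tangentCoordChange 𝓘(ℝ, F) x x₀ p := by
    intro p hp
    rw [tangentCoordChange_def, modelWithCornersSelf_coe, Set.range_id, fderivWithin_univ]
  have hev : chartForm α x n =ᶠ[𝓝 (φ x)] fun y => (chartForm α x₀ n ((φ₀ ∘ φ.symm) y)).compContinuousLinearMap
      (fderiv ℝ (φ₀ ∘ φ.symm) y) := by
    have hc : ContinuousAt φ.symm (φ x) := continuousAt_extChartAt_symm x
    have h0 : φ₀.source ∈ 𝓝 (φ.symm (φ x)) := by
      rw [φ.left_inv hxs]; exact (isOpen_extChartAt_source x₀).mem_nhds hxs₀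
    filter_upwards [hc.preimage_mem_nhds h0, (isOpen_extChartAt_target (I := 𝓘(ℝ, F)) x).mem_nhds (φ.map_source hxs)] with y hy hyt
    set p := φ.symm y with hp
    have hps : p ∈ φ.source := φ.map_target hyt
    have hps₀ : p ∈ φ₀.source := hy
    have hyp : y = φ p := (φ.right_inv hyt).symm
    have hpc : p ∈ (chartAt F x).source := by simpa [hφ] using hps
    have hpc₀ : p ∈ (chartAt F x₀).source := by simpa [hφ₀] using hps₀
    ext w
    rw [hyp, chartForm_apply α x n hpc, ContinuousAlternatingMap.compContinuousLinearMap_apply,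
      hfd p ⟨hps, hps₀⟩]
    rw [show (φ₀ ∘ φ.symm) (φ p) = φ₀ p by simp [φ.left_inv hps], chartForm_apply α x₀ n hpc₀]
    congr 1
    ext i
    rw [TangentBundle.symmL_trivializationAt_eq_core hpc,
      TangentBundle.symmL_trivializationAt_eq_core hpc₀]
    exact (tangentCoordChange_comp ⟨⟨hps, hps₀⟩, mem_extChartAt_source p⟩).symm
  have hd : DifferentiableAt ℝ (chartForm α x₀ n) ((φ₀ ∘ φ.symm) (φ x)) := by
    rw [show (φ₀ ∘ φ.symm) (φ x) = φ₀ x by simp [φ.left_inv hxs]]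
    exact ((chartForm_contDiffOn hα x₀ n).contDiffAt ((isOpen_extChartAt_target x₀).mem_nhds
      (φ₀.map_source hxs₀))).differentiableAt (by simp)
  change (extDeriv (chartForm α x n) (φ x)) (fun i => mfderiv 𝓘(ℝ, F) 𝓘(ℝ, F) φ x (v i)) = _
  rw [hev.extDeriv_eq, extDeriv_pullback hd hτ (r := ∞) (by simpa using WithTop.coe_le_coe.2 (le_top (a := (2 : ℕ∞))))]
  change extDeriv (chartForm α x₀ n) ((φ₀ ∘ φ.symm) (φ x)) (fun i => fderiv ℝ (φ₀ ∘ φ.symm) (φ x)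
    (mfderiv 𝓘(ℝ, F) 𝓘(ℝ, F) φ x (v i))) = _
  rw [show (φ₀ ∘ φ.symm) (φ x) = φ₀ x by simp [φ.left_inv hxs], hfd x ⟨hxs, hxs₀⟩]
  congr 1
  ext i
  rw [hφ, mfderiv_extChartAt_self, TangentBundle.continuousLinearMapAt_trivializationAt_eq_core hx]
  rfl

theorem rawExtDeriv_mem [FiniteDimensional ℝ F] [T2Space E] {α : RawForm F E}
    (hα : α ∈ Forms F E) : rawExtDeriv α ∈ Forms F E := by
  rw [mem_forms]
  intro n V
  cases n with
  | zero => exact contMDiff_const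
  | succ n =>
    intro x₀
    set e := trivializationAt F (TangentSpace 𝓘(ℝ, F) : E → Type _) x₀ with he
    set φ₀ := extChartAt 𝓘(ℝ, F) x₀ with hφ₀
    have hb : x₀ ∈ φ₀.source := mem_extChartAt_source x₀
    have hV : ∀ i, ContMDiffAt 𝓘(ℝ, F) 𝓘(ℝ, F) ∞ (fun x => e.continuousLinearMapAt ℝ x (V i x)) x₀ := by
      intro i
      have := (contMDiffAt_section (IB := 𝓘(ℝ, F)) x₀).1 ((V i).contMDiff x₀)
      refine this.congr_of_eventuallyEq ?_
      filter_upwards [e.open_baseSet.mem_nhds (FiberBundle.mem_baseSet_trivializationAt' x₀)] with x hx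
      rw [e.continuousLinearMapAt_apply ℝ, e.coe_linearMapAt_of_mem hx]
    have hD : ContDiffOn ℝ ∞ (extDeriv (chartForm α x₀ n)) φ₀.target := by
      have h1 : ContDiffOn ℝ ∞ (fderiv ℝ (chartForm α x₀ n)) φ₀.target :=
        (chartForm_contDiffOn hα x₀ n).fderiv_of_isOpen (isOpen_extChartAt_target x₀) (by simp)
      exact (ContinuousAlternatingMap.alternatizeUncurryFinCLM ℝ F ℝ).contDiff.comp_contDiffOn h1
    have hD' : ContMDiffAt 𝓘(ℝ, F) 𝓘(ℝ, F [⋀^Fin (n + 1)]→L[ℝ] ℝ) ∞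
        (fun x => extDeriv (chartForm α x₀ n) (φ₀ x)) x₀ :=
      ((hD.contDiffAt ((isOpen_extChartAt_target x₀).mem_nhds
        (φ₀.map_source hb))).contMDiffAt).comp x₀
        (contMDiffAt_extChartAt (I := 𝓘(ℝ, F)) (n := ∞) (x := x₀))
    let b := Module.finBasis ℝ F
    have hfin : ContMDiffAt 𝓘(ℝ, F) 𝓘(ℝ, ℝ) ∞ (fun x => ∑ r : Fin (n + 1) → Fin (Module.finrank ℝ F),
        (∏ i, b.repr (e.continuousLinearMapAt ℝ x (V i x)) (r i)) *
          extDeriv (chartForm α x₀ n) (φ₀ x) (fun i => b (r i))) x₀ := by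
      refine contMDiffAt_finsetSum fun r _ => ContMDiffAt.mul ?_ ?_
      · refine contMDiffAt_finsetProd fun i _ => ?_
        exact (LinearMap.toContinuousLinearMap (b.coord (r i))).contMDiff.contMDiffAt.comp x₀ (hV i)
      · exact (ContinuousAlternatingMap.apply ℝ F ℝ (fun i => b (r i))).contMDiff.contMDiffAt.comp x₀ hD'
    refine hfin.congr_of_eventuallyEq ?_
    filter_upwards [(chartAt F x₀).open_source.mem_nhds (mem_chart_source F x₀)] with x hx
    rw [rawExtDeriv_apply hα x₀ hx]
    exact altMap_expand b (extDeriv (chartForm α x₀ n) (φ₀ x)).toAlternatingMap _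

variable [FiniteDimensional ℝ F] [T2Space E]

/-- The exterior derivative on `Ω(E)`. -/
def extD : Module.End ℝ (Forms F E) where
  toFun α := ⟨rawExtDeriv α.1, rawExtDeriv_mem α.2⟩
  map_add' := by
    rintro ⟨α, hα⟩ ⟨β, hβ⟩
    ext x n v
    cases n with
    | zero => simp [rawExtDeriv]
    | succ n =>
      have hd : ∀ γ ∈ Forms F E, DifferentiableAt ℝ (chartForm γ x n) (extChartAt 𝓘(ℝ, F) x x) :=
        fun γ hγ => ((chartForm_contDiffOn hγ x n).contDiffAt ((isOpen_extChartAt_target x).mem_nhds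
          (mem_extChartAt_target x))).differentiableAt (by simp)
      have h : chartForm (α + β) x n = chartForm α x n + chartForm β x n := by
        ext y w; rfl
      change extDeriv (chartForm (α + β) x n) _ _ = _
      rw [h, extDeriv_add (hd α hα) (hd β hβ)]
      rfl
  map_smul' := by
    rintro c ⟨α, hα⟩
    ext x n v
    cases n with
    | zero => simp [rawExtDeriv]
    | succ n =>
      have h : chartForm (c • α) x n = c • chartForm α x n := by
        ext y w; rfl
      change extDeriv (chartForm (c • α) x n) _ _ = _
      rw [h, extDeriv_smul]
      rfl

/-! ### Splittings of the tangent bundle and the vertical differential -/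

variable (F E) in
/-- A pair of complementary smooth distributions `D_V`, `D_H` with `TE = D_H ⊕ D_V`.  Smoothness
says that the vertical part of a smooth vector field is smooth. -/
structure Splitting where
  /-- The vertical distribution. -/
  vert : ∀ x : E, Submodule ℝ (TangentSpace 𝓘(ℝ, F) x)
  /-- The horizontal distribution. -/
  hor : ∀ x : E, Submodule ℝ (TangentSpace 𝓘(ℝ, F) x)
  isCompl : ∀ x, IsCompl (vert x) (hor x)
  smooth : ∀ V : VectorField F E, ContMDiff 𝓘(ℝ, F) (𝓘(ℝ, F).prod 𝓘(ℝ, F)) ∞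
    (fun x => TotalSpace.mk' F x (Submodule.projection (vert x) (hor x) (isCompl x) (V x)))

namespace Splitting

variable (S : Splitting F E)

/-- The projection of `T_x E` onto the vertical subspace along the horizontal one. -/
def proj (x : E) : TangentSpace 𝓘(ℝ, F) x →ₗ[ℝ] TangentSpace 𝓘(ℝ, F) x :=
  Submodule.projection (S.vert x) (S.hor x) (S.isCompl x)

/-- The vertical part of a vector field. -/
def vertField (V : VectorField F E) : VectorField F E := ⟨fun x => S.proj x (V x), S.smooth V⟩

/-- The projection of `Ω(E)` onto the forms of vertical degree `q`: its restriction to `Ωⁿ(E)` is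
the projection onto the forms of bidegree `(n - q, q)`. -/
def vertComp (q : ℕ) : Module.End ℝ (Forms F E) where
  toFun α := ⟨fun x n => vertPart (S.proj x) q (α.1 x n), by
    rw [mem_forms]
    intro n V
    change ContMDiff _ _ _ (fun x => ∑ T ∈ (Finset.univ : Finset (Fin n)).powersetCard q,
      α.1 x n (splitArgs (S.proj x) T (fun i => V i x)))
    refine contMDiff_finsetSum fun T _ => ?_
    have h := mem_forms.1 α.2 n (fun i => if i ∈ T then S.vertField (V i) else
      V i - S.vertField (V i))
    refine h.congr fun x => ?_
    congr 1
    ext i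
    by_cases hi : i ∈ T
    · simp only [splitArgs, hi, if_true]; rfl
    · simp only [splitArgs, hi, if_false]; rfl⟩
  map_add' α β := by ext x n v; simp
  map_smul' c α := by ext x n v; simp

/-- The vertical differential: the part of the exterior derivative that raises the vertical degree
by one and keeps the horizontal degree, `Ω^{p,q} → Ω^{p,q+1}`.  Vertical degrees are at most
`dim E`. -/
def vertD : Module.End ℝ (Forms F E) :=
  ∑ q ∈ Finset.range (Module.finrank ℝ F + 1), S.vertComp (q + 1) * extD * S.vertComp q

end Splitting

/-! ### Fibred manifolds with a pseudo-Riemannian metric -/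

variable (F E) in
/-- A smooth pseudo-Riemannian metric on `E`. -/
structure PseudoRiemannianMetric where
  /-- The bilinear form on the tangent space at `x`. -/
  val (x : E) : TangentSpace 𝓘(ℝ, F) x →L[ℝ] TangentSpace 𝓘(ℝ, F) x →L[ℝ] ℝ
  symm (x : E) (v w : TangentSpace 𝓘(ℝ, F) x) : val x v w = val x w v
  nondegenerate (x : E) (v : TangentSpace 𝓘(ℝ, F) x) (hv : ∀ w, val x v w = 0) : v = 0
  contMDiff : ContMDiff 𝓘(ℝ, F) (𝓘(ℝ, F).prod 𝓘(ℝ, F →L[ℝ] F →L[ℝ] ℝ)) ∞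
    (fun x => TotalSpace.mk' (F →L[ℝ] F →L[ℝ] ℝ) x (val x))

section Fibred

variable {G : Type*} [NormedAddCommGroup G] [NormedSpace ℝ G] [FiniteDimensional ℝ G]
  {B : Type*} [TopologicalSpace B] [ChartedSpace G B] [IsManifold 𝓘(ℝ, G) ∞ B]

/-- The vertical subspace at `x` of a map `p : E → B`, the kernel of the derivative. -/
def vertSpace (p : E → B) (x : E) : Submodule ℝ (TangentSpace 𝓘(ℝ, F) x) :=
  LinearMap.ker (mfderiv 𝓘(ℝ, F) 𝓘(ℝ, G) p x).toLinearMap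

/-- The orthogonal complement of the vertical subspace at `x`. -/
def horSpace (p : E → B) (g : PseudoRiemannianMetric F E) (x : E) :
    Submodule ℝ (TangentSpace 𝓘(ℝ, F) x) where
  carrier := {v | ∀ w ∈ vertSpace (F := F) (G := G) p x, g.val x v w = 0}
  add_mem' := fun h₁ h₂ w hw => by simp [h₁ w hw, h₂ w hw]
  zero_mem' := fun w _ => by simp
  smul_mem' := fun c v h w hw => by simp [h w hw]

theorem exists_horPart {p : E → B} (hp : ContMDiff 𝓘(ℝ, F) 𝓘(ℝ, G) ∞ p)
    (hsub : ∀ x, Function.Surjective (mfderiv 𝓘(ℝ, F) 𝓘(ℝ, G) p x))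
    (g : PseudoRiemannianMetric F E)
    (hg : ∀ x, ∀ v ∈ vertSpace (F := F) (G := G) p x, v ≠ 0 → 0 < g.val x v v) (x₀ : E) :
    ∃ H : E → F →L[ℝ] F, ContMDiffAt 𝓘(ℝ, F) 𝓘(ℝ, F →L[ℝ] F) ∞ H x₀ ∧
      ∀ᶠ x in 𝓝 x₀, ∀ v : TangentSpace 𝓘(ℝ, F) x,
        (trivializationAt F (TangentSpace 𝓘(ℝ, F)) x₀).symmL ℝ x (H x
          ((trivializationAt F (TangentSpace 𝓘(ℝ, F)) x₀).continuousLinearMapAt ℝ x v)) ∈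
            horSpace (G := G) p g x ∧
        v - (trivializationAt F (TangentSpace 𝓘(ℝ, F)) x₀).symmL ℝ x (H x
          ((trivializationAt F (TangentSpace 𝓘(ℝ, F)) x₀).continuousLinearMapAt ℝ x v)) ∈
            vertSpace (F := F) (G := G) p x := by
  set e := trivializationAt F (TangentSpace 𝓘(ℝ, F) : E → Type _) x₀ with he
  set e' := trivializationAt G (TangentSpace 𝓘(ℝ, G) : B → Type _) (p x₀) with he'
  let a : E → F →L[ℝ] G := fun x => (e'.continuousLinearMapAt ℝ (p x)).comp
    ((mfderiv 𝓘(ℝ, F) 𝓘(ℝ, G) p x).comp (e.symmL ℝ x))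
  let β : E → F →L[ℝ] F →L[ℝ] ℝ := fun x =>
    (ContinuousLinearMap.precomp ℝ (e.symmL ℝ x)).comp ((g.val x).comp (e.symmL ℝ x))
  have hx₀ : x₀ ∈ e.baseSet := FiberBundle.mem_baseSet_trivializationAt' x₀
  have hx₀' : p x₀ ∈ e'.baseSet := FiberBundle.mem_baseSet_trivializationAt' (p x₀)
  have ha : ContMDiffAt 𝓘(ℝ, F) 𝓘(ℝ, F →L[ℝ] G) ∞ a x₀ := by
    have := ContMDiffAt.mfderiv_const (hp x₀) (m := ∞) (by simp)
    exact this
  have hsec : ∀ v : F, ContMDiffAt 𝓘(ℝ, F) (𝓘(ℝ, F).prod 𝓘(ℝ, F)) ∞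
      (fun y => TotalSpace.mk' F y (e.symmL ℝ y v)) x₀ := by
    intro v
    rw [e.contMDiffAt_section_iff hx₀]
    refine (contMDiffAt_const (c := v)).congr_of_eventuallyEq ?_
    filter_upwards [e.open_baseSet.mem_nhds hx₀] with y hy
    rw [e.symmL_apply (R := ℝ) hy]
    simp [hy]
  have hβ : ContMDiffAt 𝓘(ℝ, F) 𝓘(ℝ, F →L[ℝ] F →L[ℝ] ℝ) ∞ β x₀ := by
    refine contMDiffAt_clm fun v => contMDiffAt_clm fun w => ?_
    have := ContMDiffAt.clm_bundle_apply₂ (F₁ := F) (F₂ := F) (F₃ := ℝ)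
      (E₃ := Bundle.Trivial E ℝ) (g.contMDiff x₀) (hsec v) (hsec w)
    have h2 := (contMDiffAt_section (IB := 𝓘(ℝ, F)) (E := Bundle.Trivial E ℝ) (F := ℝ) x₀).1 this
    exact h2
  have key : ∀ x, x ∈ e.baseSet → p x ∈ e'.baseSet →
      (∀ v, (∀ w, β x v w = 0) → v = 0) ∧ Function.Surjective (a x) ∧
      (∀ v, a x v = 0 → e.symmL ℝ x v ∈ vertSpace (F := F) (G := G) p x) ∧
      (∀ v, a x v = 0 → v ≠ 0 → 0 < β x v v) := by
    intro x hx hx'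
    have e1 : ∀ v, e.symmL ℝ x (e.continuousLinearMapAt ℝ x v) = v :=
      e.symmL_continuousLinearMapAt hx
    have e2 : ∀ v, e.continuousLinearMapAt ℝ x (e.symmL ℝ x v) = v :=
      e.continuousLinearMapAt_symmL hx
    have e1' : ∀ v, e'.symmL ℝ (p x) (e'.continuousLinearMapAt ℝ (p x) v) = v :=
      e'.symmL_continuousLinearMapAt hx'
    have e2' : ∀ v, e'.continuousLinearMapAt ℝ (p x) (e'.symmL ℝ (p x) v) = v :=
      e'.continuousLinearMapAt_symmL hx'
    have h3 : ∀ v, a x v = 0 → e.symmL ℝ x v ∈ vertSpace (F := F) (G := G) p x := by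
      intro v hv
      have hv' : e'.continuousLinearMapAt ℝ (p x)
        (mfderiv 𝓘(ℝ, F) 𝓘(ℝ, G) p x (e.symmL ℝ x v)) = 0 := hv
      change mfderiv 𝓘(ℝ, F) 𝓘(ℝ, G) p x (e.symmL ℝ x v) = 0
      rw [← e1' (mfderiv 𝓘(ℝ, F) 𝓘(ℝ, G) p x (e.symmL ℝ x v)), hv', map_zero]
    refine ⟨fun v hv => ?_, fun y => ?_, h3, fun v hv hne => ?_⟩
    · have : e.symmL ℝ x v = 0 := g.nondegenerate x _ fun w => by
        rw [← e1 w]; exact hv _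
      rw [← e2 v, this, map_zero]
    · obtain ⟨w, hw⟩ := hsub x (e'.symmL ℝ (p x) y)
      refine ⟨e.continuousLinearMapAt ℝ x w, ?_⟩
      change e'.continuousLinearMapAt ℝ (p x) (mfderiv 𝓘(ℝ, F) 𝓘(ℝ, G) p x
        (e.symmL ℝ x (e.continuousLinearMapAt ℝ x w))) = y
      rw [e1, hw, e2']
    · refine hg x _ (h3 v hv) fun h0 => hne ?_
      have h0' : e.symmL ℝ x v = 0 := h0
      rw [← e2 v, h0', map_zero]
  refine ⟨fun x => horOp (a x) (β x), ?_, ?_⟩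
  · obtain ⟨h1, h2, h3, h4⟩ := key x₀ hx₀ hx₀'
    exact contMDiffAt_horOp ha hβ (B_invertible h1) (M_invertible h1 h2 h4)
  · filter_upwards [e.open_baseSet.mem_nhds hx₀,
      (hp x₀).continuousAt.preimage_mem_nhds (e'.open_baseSet.mem_nhds hx₀')] with x hx hx' v
    obtain ⟨h1, h2, h3, h4⟩ := key x hx hx'
    have e1 : ∀ v, e.symmL ℝ x (e.continuousLinearMapAt ℝ x v) = v :=
      e.symmL_continuousLinearMapAt hx
    refine ⟨fun w hw => ?_, ?_⟩
    · have hk : a x (e.continuousLinearMapAt ℝ x w) = 0 := by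
        change e'.continuousLinearMapAt ℝ (p x) (mfderiv 𝓘(ℝ, F) 𝓘(ℝ, G) p x
          (e.symmL ℝ x (e.continuousLinearMapAt ℝ x w))) = 0
        rw [e1, show mfderiv 𝓘(ℝ, F) 𝓘(ℝ, G) p x w = 0 from hw, map_zero]
      have := B_horOp (A := a x) h1 (e.continuousLinearMapAt ℝ x v) _ hk
      rw [← e1 w]
      exact this
    · have hA := A_horOp h1 h2 h4 (e.continuousLinearMapAt ℝ x v)
      have := h3 (e.continuousLinearMapAt ℝ x v - horOp (a x) (β x)
        (e.continuousLinearMapAt ℝ x v)) (by rw [map_sub, hA, sub_self])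
      rwa [map_sub, e1] at this

/-- The splitting `TE = D_H ⊕ D_V` into the vertical distribution of a submersion `p : E → B` and
its orthogonal complement, for a pseudo-Riemannian metric that is positive definite on the vertical
distribution. -/
def metricSplitting (p : E → B) (hp : ContMDiff 𝓘(ℝ, F) 𝓘(ℝ, G) ∞ p)
    (hsub : ∀ x, Function.Surjective (mfderiv 𝓘(ℝ, F) 𝓘(ℝ, G) p x))
    (g : PseudoRiemannianMetric F E)
    (hg : ∀ x, ∀ v ∈ vertSpace (F := F) (G := G) p x, v ≠ 0 → 0 < g.val x v v) :
    Splitting F E where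
  vert := vertSpace (G := G) p
  hor := horSpace (G := G) p g
  isCompl x := by
    refine ⟨?_, ?_⟩
    · rw [Submodule.disjoint_def]
      intro v hv hh
      by_contra hne
      exact (hg x v hv hne).ne' (hh v hv)
    · obtain ⟨H, -, hH⟩ := exists_horPart hp hsub g hg x
      rw [codisjoint_iff, Submodule.eq_top_iff']
      intro v
      obtain ⟨h1, h2⟩ := hH.self_of_nhds v
      exact Submodule.mem_sup.2 ⟨_, h2, _, h1, sub_add_cancel _ _⟩
  smooth V := by
    intro x₀
    obtain ⟨H, hHs, hH⟩ := exists_horPart hp hsub g hg x₀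
    set e := trivializationAt F (TangentSpace 𝓘(ℝ, F) : E → Type _) x₀ with he
    have hx₀ : x₀ ∈ e.baseSet := FiberBundle.mem_baseSet_trivializationAt' x₀
    rw [e.contMDiffAt_section_iff hx₀]
    have hV : ContMDiffAt 𝓘(ℝ, F) 𝓘(ℝ, F) ∞ (fun x => (e ⟨x, V x⟩).2) x₀ :=
      (e.contMDiffAt_section_iff hx₀).1 (V.contMDiff x₀)
    refine (hV.sub (hHs.clm_apply hV)).congr_of_eventuallyEq ?_
    filter_upwards [hH, e.open_baseSet.mem_nhds hx₀] with x hx hxb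
    have hc : ∀ w : TangentSpace 𝓘(ℝ, F) x, (e ⟨x, w⟩).2 = e.continuousLinearMapAt ℝ x w := by
      intro w
      rw [e.continuousLinearMapAt_apply ℝ, e.coe_linearMapAt_of_mem hxb]
    obtain ⟨h1, h2⟩ := hx (V x)
    have hproj : ∀ h : IsCompl (vertSpace (F := F) (G := G) p x) (horSpace (G := G) p g x),
        Submodule.projection _ _ h (V x) =
          V x - e.symmL ℝ x (H x (e.continuousLinearMapAt ℝ x (V x))) := by
      intro h
      conv_lhs => rw [← sub_add_cancel (V x) (e.symmL ℝ x (H x (e.continuousLinearMapAt ℝ x (V x))))]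
      rw [map_add, Submodule.projection_apply_of_mem_left h h2,
        Submodule.projection_apply_of_mem_right h h1, add_zero]
    rw [hproj, hc, map_sub, e.continuousLinearMapAt_symmL hxb, hc]

end Fibred
end Manifold

/-! ### Multivector fields and their insertion operators -/

section Multivector

variable {F : Type*} [NormedAddCommGroup F] [NormedSpace ℝ F] [FiniteDimensional ℝ F]
  {E : Type*} [TopologicalSpace E] [ChartedSpace F E] [IsManifold 𝓘(ℝ, F) ∞ E] [T2Space E]

variable (F E) in
/-- Sections of the bundle of exterior algebras of the tangent spaces, without smoothness; the
product is the pointwise wedge product. -/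
abbrev RawMultivector : Type _ := ∀ x : E, ExteriorAlgebra ℝ (TangentSpace 𝓘(ℝ, F) x)

variable (F E) in
/-- The linear combinations of wedge products of smooth functions and smooth vector fields. -/
def basicMultivectors : Subalgebra ℝ (RawMultivector F E) :=
  Algebra.adjoin ℝ
    (Set.range (fun (f : C^∞⟮𝓘(ℝ, F), E; ℝ⟯) (x : E) =>
        algebraMap ℝ (ExteriorAlgebra ℝ (TangentSpace 𝓘(ℝ, F) x)) (f x)) ∪
      Set.range (fun (V : VectorField F E) (x : E) =>
        ExteriorAlgebra.ι ℝ (M := TangentSpace 𝓘(ℝ, F) x) (V x)))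

variable (F E) in
/-- The algebra of smooth multivector fields on `E` under the wedge product: the sections that near
every point are linear combinations of wedge products of smooth functions and vector fields. -/
def MultivectorField : Subalgebra ℝ (RawMultivector F E) where
  carrier := {X | ∀ x₀, ∃ Y ∈ basicMultivectors F E, ∀ᶠ x in 𝓝 x₀, X x = Y x}
  mul_mem' := by
    intro X X' h h' x₀
    obtain ⟨Y, hY, e⟩ := h x₀
    obtain ⟨Y', hY', e'⟩ := h' x₀
    refine ⟨Y * Y', mul_mem hY hY', ?_⟩
    filter_upwards [e, e'] with x h1 h2
    rw [Pi.mul_apply, Pi.mul_apply, h1, h2]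
  add_mem' := by
    intro X X' h h' x₀
    obtain ⟨Y, hY, e⟩ := h x₀
    obtain ⟨Y', hY', e'⟩ := h' x₀
    refine ⟨Y + Y', add_mem hY hY', ?_⟩
    filter_upwards [e, e'] with x h1 h2
    rw [Pi.add_apply, Pi.add_apply, h1, h2]
  algebraMap_mem' := fun r _ =>
    ⟨algebraMap ℝ _ r, Subalgebra.algebraMap_mem _ r, Filter.Eventually.of_forall fun _ => rfl⟩

/-- A smooth function as a multivector field of degree zero. -/
def funMV (f : C^∞⟮𝓘(ℝ, F), E; ℝ⟯) : MultivectorField F E :=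
  ⟨fun x => algebraMap ℝ (ExteriorAlgebra ℝ (TangentSpace 𝓘(ℝ, F) x)) (f x), fun _ =>
    ⟨_, Algebra.subset_adjoin (Or.inl ⟨f, rfl⟩), Filter.Eventually.of_forall fun _ => rfl⟩⟩

/-- A vector field as a multivector field of degree one. -/
def vecMV (V : VectorField F E) : MultivectorField F E :=
  ⟨fun x => ExteriorAlgebra.ι ℝ (M := TangentSpace 𝓘(ℝ, F) x) (V x), fun _ =>
    ⟨_, Algebra.subset_adjoin (Or.inr ⟨V, rfl⟩), Filter.Eventually.of_forall fun _ => rfl⟩⟩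

/-- The wedge product `X₁ ∧ ⋯ ∧ Xₙ` of vector fields. -/
def wedge {n : ℕ} (X : Fin n → VectorField F E) : MultivectorField F E :=
  (List.ofFn fun i => vecMV (X i)).prod

/-- The multivector field `X` is homogeneous of degree `k`. -/
def HasDegree (X : MultivectorField F E) (k : ℕ) : Prop :=
  ∀ x, X.1 x ∈ ⋀[ℝ]^k (TangentSpace 𝓘(ℝ, F) x)

/-- Pointwise insertion of a section of the bundle of exterior algebras into a form. -/
def rawInsertion (X : RawMultivector F E) (α : RawForm F E) : RawForm F E :=
  fun x => insertAt (X x) (α x)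

theorem rawInsertion_mem_of_basic {X : RawMultivector F E} (hX : X ∈ basicMultivectors F E) :
    ∀ α ∈ Forms F E, rawInsertion X α ∈ Forms F E := by
  induction hX using Algebra.adjoin_induction with
  | mem X hX =>
    intro α hα
    rcases hX with ⟨f, rfl⟩ | ⟨V, rfl⟩
    · rw [mem_forms]
      intro n W
      refine (f.contMDiff.mul (mem_forms.1 hα n W)).congr fun x => ?_
      simp [rawInsertion]
    · rw [mem_forms]
      intro n W
      refine (mem_forms.1 hα (n + 1) (Matrix.vecCons V W)).congr fun x => ?_
      simp only [rawInsertion, insertAt, ExteriorAlgebra.lift_ι_apply]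
      change α x (n + 1) (Matrix.vecCons (V x) fun i => W i x) = _
      congr 1
      ext i
      refine Fin.cases ?_ (fun i => ?_) i <;> simp
  | algebraMap r =>
    intro α hα
    have : rawInsertion (algebraMap ℝ (RawMultivector F E) r) α = r • α := by
      ext1 x
      simp [rawInsertion]
    rw [this]
    exact Submodule.smul_mem _ r hα
  | add X Y _ _ hX hY =>
    intro α hα
    have : rawInsertion (X + Y) α = rawInsertion X α + rawInsertion Y α := by
      ext1 x
      simp [rawInsertion]
    rw [this]
    exact add_mem (hX α hα) (hY α hα)
  | mul X Y _ _ hX hY =>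
    intro α hα
    have : rawInsertion (X * Y) α = rawInsertion X (rawInsertion Y α) := by
      ext1 x
      simp [rawInsertion]
    rw [this]
    exact hX _ (hY α hα)

theorem rawInsertion_mem (X : MultivectorField F E) (α : Forms F E) :
    rawInsertion X.1 α.1 ∈ Forms F E := by
  rw [mem_forms]
  intro n W x₀
  obtain ⟨Y, hY, h⟩ := X.2 x₀
  refine (mem_forms.1 (rawInsertion_mem_of_basic hY α.1 α.2) n W x₀).congr_of_eventuallyEq ?_
  filter_upwards [h] with x hx
  simp only [rawInsertion, hx]

variable (F E) in
/-- The insertion operators `X ↦ i_X`, with values in the endomorphisms of `Ω(E)`. -/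
def insertion : MultivectorField F E →ₐ[ℝ] Module.End ℝ (Forms F E) :=
  AlgHom.ofLinearMap
    { toFun := fun X =>
        { toFun := fun α => ⟨rawInsertion X.1 α.1, rawInsertion_mem X α⟩
          map_add' := fun α β => by ext1; funext x; simp [rawInsertion]
          map_smul' := fun c α => by ext1; funext x; simp [rawInsertion] }
      map_add' := fun X Y => by ext1 α; ext1; funext x; simp [rawInsertion]
      map_smul' := fun c X => by ext1 α; ext1; funext x; simp [rawInsertion] }
    (by ext1 α; ext1; funext x; simp [rawInsertion])
    (fun X Y => by ext1 α; ext1; funext x; simp [rawInsertion])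

/-- A smooth function as a form of degree zero. -/
def ofFun (f : C^∞⟮𝓘(ℝ, F), E; ℝ⟯) : Forms F E :=
  ⟨fun x n => match n with
    | 0 => AlternatingMap.constOfIsEmpty ℝ (TangentSpace 𝓘(ℝ, F) x) (Fin 0) (f x)
    | _ + 1 => 0, by
    rw [mem_forms]
    intro n W
    cases n with
    | zero => exact f.contMDiff
    | succ n => exact contMDiff_const⟩

/-- The conjugate insertion operator of (the degree one part of) a form `θ`: the antiderivation
`X₁ ∧ ⋯ ∧ Xₙ ↦ ∑ i, (-1)^(i-1) θ(Xᵢ) X₁ ∧ ⋯ X̂ᵢ ⋯ ∧ Xₙ` of the wedge product. -/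
def conjInsert (θ : Forms F E) (X : MultivectorField F E) : RawMultivector F E := fun x =>
  CliffordAlgebra.contractLeft
    ((AlternatingMap.ofSubsingleton ℝ (TangentSpace 𝓘(ℝ, F) x) ℝ (0 : Fin 1)).symm (θ.1 x 1))
    (X.1 x)

/-! ### Graded endomorphisms of the graded space of forms -/

instance : AddCommGroup (Forms F E) := Submodule.addCommGroup _

instance : Ring (Module.End ℝ (Forms F E)) := Module.End.instRing

instance : Algebra ℝ (Module.End ℝ (Forms F E)) := Module.End.instAlgebra ℝ ℝ (Forms F E)

instance : Module ℝ (Module.End ℝ (Forms F E)) := Algebra.toModule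

/-- The projection of `Ω(E)` onto the forms of degree `n`. -/
def degProj (n : ℕ) : Module.End ℝ (Forms F E) where
  toFun α := ⟨fun x m => if m = n then α.1 x m else 0, by
    rw [mem_forms]
    intro m W
    by_cases h : m = n
    · simpa only [h, if_true] using mem_forms.1 α.2 m W
    · simpa [h] using contMDiff_const⟩
  map_add' α β := by ext x m v; by_cases h : m = n <;> simp [h]
  map_smul' c α := by ext x m v; by_cases h : m = n <;> simp [h]

/-- The endomorphism `T` of `Ω(E)` is homogeneous of degree `a`. -/
def IsHomogeneousEnd (T : Module.End ℝ (Forms F E)) (a : ℤ) : Prop :=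
  ∀ n m : ℕ, (m : ℤ) ≠ n + a → degProj m * T * degProj n = 0

/-- The grading involution of `Ω(E)`, equal to `(-1)ⁿ` on forms of degree `n`. -/
def parity : Module.End ℝ (Forms F E) where
  toFun α := ⟨fun x n => (-1 : ℝ) ^ n • α.1 x n, by
    rw [mem_forms]
    intro n W
    exact (contMDiff_const (c := (-1 : ℝ) ^ n)).mul (mem_forms.1 α.2 n W)⟩
  map_add' α β := by ext x n v; simp
  map_smul' c α := by ext x n v; simp [mul_left_comm]

/-- The part of odd degree of an endomorphism of `Ω(E)`. -/
def oddPart (T : Module.End ℝ (Forms F E)) : Module.End ℝ (Forms F E) :=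
  (2⁻¹ : ℝ) • (T - parity * T * parity)

/-- The graded commutator: the bilinear operation on the endomorphisms of `Ω(E)` that equals
`S ∘ T - (-1)^{ab} T ∘ S` for `S` of degree `a` and `T` of degree `b`. -/
def gradedComm (S T : Module.End ℝ (Forms F E)) : Module.End ℝ (Forms F E) :=
  S * T - T * S + (2 : ℝ) • (oddPart T * oddPart S)

theorem sum_degProj :
    ∑ n ∈ Finset.range (Module.finrank ℝ F + 1), degProj n = (1 : Module.End ℝ (Forms F E)) := by
  have key : ∀ (s : Finset ℕ) (α : Forms F E) (x : E) (m : ℕ),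
      ((∑ n ∈ s, degProj n) α).1 x m = if m ∈ s then α.1 x m else 0 := by
    intro s α x m
    induction s using Finset.induction_on with
    | empty => simp
    | insert n s hn ih =>
      rw [Finset.sum_insert hn, LinearMap.add_apply]
      change (degProj n α).1 x m + ((∑ n ∈ s, degProj n) α).1 x m = _
      rw [ih]
      by_cases h : m = n
      · subst h; simp [degProj, hn]
      · simp [degProj, h]
  ext α x m v
  rw [key]
  by_cases h : m ∈ Finset.range (Module.finrank ℝ F + 1)
  · simp [h]
  · have hm : Module.finrank ℝ (TangentSpace 𝓘(ℝ, F) x) < m := by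
      change Module.finrank ℝ F < m
      simpa using h
    have hv : ¬ LinearIndependent ℝ v := fun hl => by
      have : FiniteDimensional ℝ (TangentSpace 𝓘(ℝ, F) x) := ‹FiniteDimensional ℝ F›
      have := hl.fintype_card_le_finrank
      simp at this
      omega
    have := (α.1 x m).map_linearDependent v hv
    simp [h, this]

theorem parity_mul_degProj (n : ℕ) :
    parity * degProj n = ((-1 : ℝ) ^ n • degProj n : Module.End ℝ (Forms F E)) := by
  ext α x m v
  by_cases h : m = n
  · subst h; simp [parity, degProj]
  · simp [parity, degProj, h]

theorem degProj_mul_parity (n : ℕ) :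
    degProj n * parity = ((-1 : ℝ) ^ n • degProj n : Module.End ℝ (Forms F E)) := by
  ext α x m v
  by_cases h : m = n
  · subst h; simp [parity, degProj]
  · simp [parity, degProj, h]

theorem parity_conj {T : Module.End ℝ (Forms F E)} {a : ℤ} (hT : IsHomogeneousEnd T a) :
    parity * T * parity = (-1 : ℝ) ^ a • T := by
  have hdec : ∀ U : Module.End ℝ (Forms F E), U =
      ∑ m ∈ Finset.range (Module.finrank ℝ F + 1), ∑ n ∈ Finset.range (Module.finrank ℝ F + 1),
        degProj m * U * degProj n := by
    intro U
    simp_rw [← Finset.mul_sum, ← Finset.sum_mul, sum_degProj, one_mul, mul_one]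
  rw [hdec (parity * T * parity), hdec ((-1 : ℝ) ^ a • T)]
  refine Finset.sum_congr rfl fun m _ => Finset.sum_congr rfl fun n _ => ?_
  have h1 : degProj m * (parity * T * parity) * degProj n =
      (degProj m * parity) * T * (parity * degProj n) := by simp only [mul_assoc]
  rw [h1, parity_mul_degProj, degProj_mul_parity]
  simp only [smul_mul_assoc, mul_smul_comm, smul_smul]
  by_cases h : (m : ℤ) = n + a
  · congr 1
    have ha : a = m - n := by omega
    rw [ha, zpow_sub₀ (by norm_num)]
    rcases neg_one_pow_eq_or ℝ n with h | h <;> simp [h, div_neg]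
  · rw [hT n m h, smul_zero, smul_zero]

theorem gradedComm_eq {S T : Module.End ℝ (Forms F E)} {a b : ℤ} (hS : IsHomogeneousEnd S a)
    (hT : IsHomogeneousEnd T b) : gradedComm S T = S * T - (-1 : ℝ) ^ (a * b) • (T * S) := by
  rw [gradedComm, oddPart, oddPart, parity_conj hS, parity_conj hT]
  rcases Int.even_or_odd a with ha | ha
  · simp [ha.neg_one_zpow, (ha.mul_right b).neg_one_zpow]
  rcases Int.even_or_odd b with hb | hb
  · simp [hb.neg_one_zpow, (hb.mul_left a).neg_one_zpow]
  · rw [ha.neg_one_zpow, hb.neg_one_zpow, (ha.mul hb).neg_one_zpow]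
    have h : ∀ U : Module.End ℝ (Forms F E), (2⁻¹ : ℝ) • (U - (-1 : ℝ) • U) = U := by
      intro U
      rw [neg_one_smul, sub_neg_eq_add, ← two_smul ℝ U, smul_smul]; norm_num
    rw [h, h, neg_one_smul, two_smul]
    abel

/-- The derived bracket `[S, T]_δ = [[S, δ], T]` of the graded commutator. -/
def derivedBracket (δ S T : Module.End ℝ (Forms F E)) : Module.End ℝ (Forms F E) :=
  gradedComm (gradedComm S δ) T

end Multivector

end
end VerticalSchouten

open VerticalSchouten

/-!
Write `δ` for the vertical differential.  The derived bracket `[[i_X, δ], i_Y]` is a graded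
derivation in each argument, with respect to the composition of insertion operators, so that its
values are determined by those on functions and vector fields.  If the latter are again insertions
of functions and vector fields, as for an operator of first order (`IsFirstOrder`), then the algebra
generated by all the insertions of functions and vector fields is closed under the bracket
(`IsFirstOrder.derivedBracket_mem`).

For the exterior derivative `d` itself, the required identities are classical: `[[i_f, d], i_g] = 0`,
`[[i_f, d], i_Y]` is multiplication with `-Y f`, and `[[i_X, d], i_Y]` is the insertion of the Lie
bracket.  They are checked at one point in a chart, where `d α` is the antisymmetrization of the
derivative of the coefficients of `α`, and insertion is an antiderivation of antisymmetrization
(`insertVec_antisymm`).  Smoothness of the resulting function or field comes for free, since its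
values can be read off from an operator that preserves smooth forms.

The passage from `d` to `δ` uses only the grading by the vertical degree.  The operator `δ` is the
component of degree one of `d`, the insertion of a vertical field has degree `-1`, and
multiplications with functions and insertions of horizontal fields have degree `0`.  Hence a bracket
of homogeneous factors formed with `δ` is a component, of known degree, of the bracket formed with
`d`, and a component of the insertion of a field is the insertion of its vertical part, of its
horizontal part, or zero.  This gives `Splitting.isFirstOrder_vertD`; neither integrability of the
distributions nor any property of the metric enters beyond the smooth splitting.

A multivector field is only locally a combination of products of vector fields.  Since `δ` is local
(`EqNear.vertD`), the bracket is the insertion of some multivector field near each point, and these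
agree on overlaps because the value of a multivector field at a point can be recovered from its
insertion operator (`eq_zero_of_insertAt_eq_zero`, by pairing the exterior algebra with all of its
linear functionals).  This proves injectivity and the existence of the bracket.

The bracket of a function `f` with `X`, and `X ↦ -ī(δf) X`, are both antiderivations, and agree on
functions and vector fields; the value on a vector field is found by evaluating the operators on the
constant function one.  The bracket in the opposite order follows from the Jacobi identity for
graded commutators, since `i_f` and `i_X` commute.  The formula for products of vector fields is the
expansion of a derivation on a product, first in the first argument and then in the second, with the
values of the derivation moved to the front (`twistedDerivation_prod_ofFn`).
-/

namespace VerticalSchouten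
set_option linter.unusedSectionVars false

noncomputable section

/-! ### Alternating forms on one vector space -/

section Linear

variable {V : Type*} [AddCommGroup V] [Module ℝ V]

theorem insertVec_apply (v : V) (α : AltForms V) (n : ℕ) (w : Fin n → V) :
    insertVec v α n w = α (n + 1) (Matrix.vecCons v w) := rfl

theorem insertAt_ι (v : V) : insertAt (ExteriorAlgebra.ι ℝ v) = insertVec v := by
  simp [insertAt]

/-- The form `∑ᵢ eⁱ ∧ A(eᵢ)`, where `eᵢ` is a basis of `V` and `eⁱ` the dual basis, obtained from a
linear family `A` of forms by antisymmetrizing the additional argument. -/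
def antisymm (A : V →ₗ[ℝ] AltForms V) : AltForms V := fun n =>
  match n with
  | 0 => 0
  | n + 1 => AlternatingMap.alternatizeUncurryFin (LinearMap.proj n ∘ₗ A)

theorem antisymm_succ_apply (A : V →ₗ[ℝ] AltForms V) (n : ℕ) (w : Fin (n + 1) → V) :
    antisymm A (n + 1) w =
      ∑ i : Fin (n + 1), (-1 : ℝ) ^ (i : ℕ) * A (w i) n (i.removeNth w) := by
  refine (AlternatingMap.alternatizeUncurryFin_apply _ _).trans (Finset.sum_congr rfl fun i _ => ?_)
  simp

theorem antisymm_add (A A' : V →ₗ[ℝ] AltForms V) :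
    antisymm (A + A') = antisymm A + antisymm A' := by
  ext n w
  cases n with
  | zero => simp [antisymm]
  | succ n => simp [antisymm_succ_apply, mul_add, Finset.sum_add_distrib]

theorem antisymm_smul (c : ℝ) (A : V →ₗ[ℝ] AltForms V) :
    antisymm (c • A) = c • antisymm A := by
  ext n w
  cases n with
  | zero => simp [antisymm]
  | succ n =>
    simp only [antisymm_succ_apply, Finset.mul_sum, Pi.smul_apply, AlternatingMap.smul_apply,
      LinearMap.smul_apply, smul_eq_mul]
    exact Finset.sum_congr rfl fun i _ => by ring

theorem antisymm_neg (A : V →ₗ[ℝ] AltForms V) : antisymm (-A) = -antisymm A := by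
  rw [← neg_one_smul ℝ A, antisymm_smul]
  exact neg_one_smul ℝ (antisymm A)

/-- Insertion is an antiderivation of the wedge product of a family of covectors with a family of
forms. -/
theorem insertVec_antisymm (v : V) (A : V →ₗ[ℝ] AltForms V) :
    insertVec v (antisymm A) = A v - antisymm (insertVec v ∘ₗ A) := by
  ext n w
  rw [insertVec_apply, antisymm_succ_apply, Fin.sum_univ_succ]
  have h0 : (Fin.removeNth 0 (Matrix.vecCons v w) : Fin n → V) = w := by
    ext i; simp [Fin.removeNth]
  simp only [Fin.val_zero, pow_zero, one_mul, h0, Matrix.cons_val_zero, Matrix.cons_val_succ]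
  change _ = A v n w - antisymm (insertVec v ∘ₗ A) n w
  rw [sub_eq_add_neg]
  congr 1
  cases n with
  | zero => simp [antisymm]
  | succ n =>
    rw [antisymm_succ_apply, ← Finset.sum_neg_distrib]
    refine Finset.sum_congr rfl fun i _ => ?_
    have h1 : (Fin.removeNth i.succ (Matrix.vecCons v w) : Fin (n + 1) → V) =
        Matrix.vecCons v (i.removeNth w) := by
      ext j
      refine Fin.cases ?_ (fun j => ?_) j <;> simp [Fin.removeNth]
    rw [h1, Fin.val_succ, pow_succ]
    simp [insertVec_apply]

/-! #### Nondegeneracy of the insertion pairing -/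

/-- The forms `(w₁, …, wₙ) ↦ φ(wₙ ∧ ⋯ ∧ w₁)` given by a linear functional `φ` on the exterior
algebra.  The arguments are reversed to match the order of the insertions in `insertAt`. -/
def formOfDual (φ : ExteriorAlgebra ℝ V →ₗ[ℝ] ℝ) : AltForms V := fun n =>
  (φ ∘ₗ CliffordAlgebra.reverse).compAlternatingMap (ExteriorAlgebra.ιMulti ℝ n)

/-- Insertion into the forms given by functionals is the transpose of right multiplication. -/
theorem insertAt_formOfDual (a : ExteriorAlgebra ℝ V) (φ : ExteriorAlgebra ℝ V →ₗ[ℝ] ℝ) :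
    insertAt a (formOfDual φ) = formOfDual (φ ∘ₗ LinearMap.mulRight ℝ a) := by
  induction a using ExteriorAlgebra.induction generalizing φ with
  | algebraMap r =>
    ext n w
    simp [formOfDual, Algebra.algebraMap_eq_smul_one]
  | ι v =>
    ext n w
    rw [insertAt_ι, insertVec_apply]
    simp only [formOfDual, LinearMap.compAlternatingMap_apply, ExteriorAlgebra.ιMulti_succ_apply,
      LinearMap.comp_apply, LinearMap.mulRight_apply, Matrix.cons_val_zero]
    congr 1
    erw [CliffordAlgebra.reverse.map_mul, CliffordAlgebra.reverse_ι]
    rfl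
  | mul a b ha hb =>
    rw [map_mul, Module.End.mul_apply, hb, ha]
    congr 1
    ext c
    simp [mul_assoc]
  | add a b ha hb =>
    rw [map_add, LinearMap.add_apply, ha, hb]
    ext n w
    simp [formOfDual, mul_add]

/-- An element of the exterior algebra is determined by its insertion operator. -/
theorem eq_zero_of_insertAt_eq_zero {a : ExteriorAlgebra ℝ V} (h : insertAt a = 0) : a = 0 := by
  refine (Module.forall_dual_apply_eq_zero_iff ℝ a).1 fun φ => ?_
  have h1 := insertAt_formOfDual a φ
  rw [h] at h1
  have h2 := DFunLike.congr_fun (congrFun h1 0) ![]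
  simpa [formOfDual] using h2.symm

/-! #### The grading by the vertical degree -/

variable (P : V →ₗ[ℝ] V)

theorem vertPart_zero_zero (α : V [⋀^Fin 0]→ₗ[ℝ] ℝ) : vertPart P 0 α = α := by
  ext v
  simp [vertPart_apply, Subsingleton.elim (splitArgs P _ v) v]

theorem vertPart_eq_zero {q n : ℕ} (h : n < q) (α : V [⋀^Fin n]→ₗ[ℝ] ℝ) : vertPart P q α = 0 := by
  ext v
  rw [vertPart_apply, Finset.powersetCard_eq_empty.2 (by simpa using h)]
  simp

/-- Inserting the vertical part of a vector lowers the vertical degree by one, and inserting the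
horizontal part keeps it. -/
theorem vertPart_succ_curryLeft (q : ℕ) {n : ℕ} (α : V [⋀^Fin (n + 1)]→ₗ[ℝ] ℝ) (v : V) :
    (vertPart P (q + 1) α).curryLeft v =
      vertPart P q (α.curryLeft (P v)) + vertPart P (q + 1) (α.curryLeft (v - P v)) := by
  ext w
  simp only [AlternatingMap.curryLeft_apply_apply, AlternatingMap.add_apply, vertPart_apply]
  have hu : (Finset.univ : Finset (Fin (n + 1))) =
      insert 0 (Finset.univ.map (Fin.succEmb n)) := by
    ext i; refine Fin.cases ?_ (fun i => ?_) i <;> simp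
  have hs : ∀ T : Finset (Fin n), (0 : Fin (n + 1)) ∉ T.map (Fin.succEmb n) := by
    intro T; simp [Fin.succ_ne_zero]
  rw [hu, Finset.powersetCard_succ_insert (hs _), Finset.sum_union, add_comm, Finset.sum_image]
  · rw [Finset.powersetCard_map, Finset.powersetCard_map, Finset.sum_map, Finset.sum_map]
    congr 1
    · refine Finset.sum_congr rfl fun T _ => ?_
      congr 1
      ext i
      refine Fin.cases ?_ (fun i => ?_) i <;> simp [splitArgs, Fin.succ_ne_zero]
    · refine Finset.sum_congr rfl fun T _ => ?_
      congr 1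
      ext i
      refine Fin.cases ?_ (fun i => ?_) i <;> simp [splitArgs, Fin.succ_ne_zero]
  -- The sets of slots that contain the first one correspond injectively to the others.
  · intro S hS T hT hST
    have h1 : (0 : Fin (n + 1)) ∉ S := fun h =>
      hs _ ((Finset.mem_powersetCard.1 hS).1 h)
    have h2 : (0 : Fin (n + 1)) ∉ T := fun h =>
      hs _ ((Finset.mem_powersetCard.1 hT).1 h)
    rw [← Finset.erase_insert h1, hST, Finset.erase_insert h2]
  · rw [Finset.disjoint_left]
    intro S hS hS'
    obtain ⟨T, -, rfl⟩ := Finset.mem_image.1 hS'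
    exact hs _ ((Finset.mem_powersetCard.1 hS).1 (Finset.mem_insert_self _ _))

theorem vertPart_zero_curryLeft {n : ℕ} (α : V [⋀^Fin (n + 1)]→ₗ[ℝ] ℝ) (v : V) :
    (vertPart P 0 α).curryLeft v = vertPart P 0 (α.curryLeft (v - P v)) := by
  ext w
  simp only [AlternatingMap.curryLeft_apply_apply, vertPart_apply, Finset.powersetCard_zero,
    Finset.sum_singleton]
  congr 1
  ext i
  refine Fin.cases ?_ (fun i => ?_) i <;> simp [splitArgs]

theorem vertPart_vertPart (hP : ∀ v, P (P v) = P v) (q r : ℕ) {n : ℕ} (α : V [⋀^Fin n]→ₗ[ℝ] ℝ) :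
    vertPart P q (vertPart P r α) = if q = r then vertPart P q α else 0 := by
  ext v
  have key : ∀ S T : Finset (Fin n), α (splitArgs P T (splitArgs P S v)) =
      if S = T then α (splitArgs P S v) else 0 := by
    intro S T
    split_ifs with h
    · subst h
      congr 1
      ext i
      by_cases hi : i ∈ S <;> simp [splitArgs, hi, hP]
    · obtain ⟨i, hi⟩ : ∃ i, ¬ (i ∈ S ↔ i ∈ T) := by
        by_contra! hc
        exact h (Finset.ext hc)
      -- In a slot in which `S` and `T` differ, complementary projections are composed.
      refine α.map_coord_zero i ?_
      by_cases h1 : i ∈ S <;> by_cases h2 : i ∈ T <;> simp [splitArgs, h1, h2, hP] <;> tauto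
  rw [vertPart_apply]
  simp only [vertPart_apply, key]
  split_ifs with h
  · subst h
    rw [vertPart_apply]
    refine Finset.sum_congr rfl fun S hS => ?_
    rw [Finset.sum_ite_eq, if_pos hS]
  · refine Finset.sum_eq_zero fun S hS => Finset.sum_eq_zero fun T hT => if_neg ?_
    rintro rfl
    exact h ((Finset.mem_powersetCard.1 hS).2.symm.trans (Finset.mem_powersetCard.1 hT).2)

end Linear

/-! ### The exterior derivative in coordinates -/

section Coordinates

variable {F : Type*} [NormedAddCommGroup F] [NormedSpace ℝ F] [FiniteDimensional ℝ F]
  {E : Type*} [TopologicalSpace E] [ChartedSpace F E] [IsManifold 𝓘(ℝ, F) ∞ E]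

theorem continuousLinearMapAt_self (x : E) (v : TangentSpace 𝓘(ℝ, F) x) :
    (trivializationAt F (TangentSpace 𝓘(ℝ, F)) x).continuousLinearMapAt ℝ x v = v := by
  rw [TangentBundle.continuousLinearMapAt_trivializationAt_eq_core (mem_chart_source F x)]
  exact (tangentBundleCore 𝓘(ℝ, F) E).coordChange_self (achart F x) x (mem_chart_source F x) v

theorem symmL_self (x : E) (v : F) :
    (trivializationAt F (TangentSpace 𝓘(ℝ, F)) x).symmL ℝ x v = v := by
  rw [TangentBundle.symmL_trivializationAt_eq_core (mem_chart_source F x)]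
  exact (tangentBundleCore 𝓘(ℝ, F) E).coordChange_self (achart F x) x (mem_chart_source F x) v

/-- A vector field in the chart around `x`. -/
def chartField (X : VectorField F E) (x : E) (y : F) : F :=
  (trivializationAt F (TangentSpace 𝓘(ℝ, F)) x).continuousLinearMapAt ℝ
    ((extChartAt 𝓘(ℝ, F) x).symm y) (X ((extChartAt 𝓘(ℝ, F) x).symm y))

/-- The derivative at `x` of the coefficients of a form in the chart around `x`. -/
def coordDeriv (α : RawForm F E) (x : E) :
    TangentSpace 𝓘(ℝ, F) x →ₗ[ℝ] AltForms (TangentSpace 𝓘(ℝ, F) x) where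
  toFun w n := (fderiv ℝ (chartForm α x n) (extChartAt 𝓘(ℝ, F) x x) w).toAlternatingMap
  map_add' w w' := funext fun n => congrArg ContinuousAlternatingMap.toAlternatingMap
    ((fderiv ℝ (chartForm α x n) (extChartAt 𝓘(ℝ, F) x x)).map_add w w')
  map_smul' c w := funext fun n => congrArg ContinuousAlternatingMap.toAlternatingMap
    ((fderiv ℝ (chartForm α x n) (extChartAt 𝓘(ℝ, F) x x)).map_smul c w)

/-- The derivative at `x` of the coefficients of a vector field in the chart around `x`. -/
def coordDerivField (X : VectorField F E) (x : E) :
    TangentSpace 𝓘(ℝ, F) x →ₗ[ℝ] TangentSpace 𝓘(ℝ, F) x :=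
  (fderiv ℝ (chartField X x) (extChartAt 𝓘(ℝ, F) x x)).toLinearMap

/-- The differential of a function at `x`, computed in the chart around `x`. -/
def coordDerivFun (f : E → ℝ) (x : E) : TangentSpace 𝓘(ℝ, F) x →ₗ[ℝ] ℝ :=
  (fderiv ℝ (f ∘ (extChartAt 𝓘(ℝ, F) x).symm) (extChartAt 𝓘(ℝ, F) x x)).toLinearMap

theorem chartForm_self (α : RawForm F E) (x : E) (n : ℕ) (v : Fin n → F) :
    chartForm α x n (extChartAt 𝓘(ℝ, F) x x) v = α x n v := by
  rw [chartForm_apply α x n (mem_chart_source F x)]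
  congr 1
  ext i
  exact symmL_self x (v i)

theorem rawExtDeriv_eq_antisymm (α : RawForm F E) (x : E) :
    rawExtDeriv α x = antisymm (coordDeriv α x) := by
  ext n v
  cases n with
  | zero => rfl
  | succ n =>
    rw [antisymm_succ_apply]
    change extDeriv (chartForm α x n) (extChartAt 𝓘(ℝ, F) x x)
      (fun i => mfderiv 𝓘(ℝ, F) 𝓘(ℝ, F) (extChartAt 𝓘(ℝ, F) x) x (v i)) = _
    have hv : (fun i => mfderiv 𝓘(ℝ, F) 𝓘(ℝ, F) (extChartAt 𝓘(ℝ, F) x) x (v i)) = v := by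
      rw [mfderiv_extChartAt_self]; rfl
    rw [hv]
    refine (ContinuousAlternatingMap.alternatizeUncurryFin_apply _ _).trans
      (Finset.sum_congr rfl fun i _ => ?_)
    rw [zsmul_eq_mul]
    push_cast
    rfl

theorem chartForm_differentiableAt [T2Space E] {α : RawForm F E} (hα : α ∈ Forms F E) (x : E)
    (n : ℕ) : DifferentiableAt ℝ (chartForm α x n) (extChartAt 𝓘(ℝ, F) x x) :=
  ((chartForm_contDiffOn hα x n).contDiffAt ((isOpen_extChartAt_target x).mem_nhds
    (mem_extChartAt_target x))).differentiableAt (by simp)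

theorem contMDiffAt_continuousLinearMapAt (X : VectorField F E) (x₀ : E) {x : E}
    (hx : x ∈ (trivializationAt F (TangentSpace 𝓘(ℝ, F) : E → Type _) x₀).baseSet) :
    ContMDiffAt 𝓘(ℝ, F) 𝓘(ℝ, F) ∞
      (fun x => (trivializationAt F (TangentSpace 𝓘(ℝ, F)) x₀).continuousLinearMapAt ℝ x (X x))
      x := by
  set e := trivializationAt F (TangentSpace 𝓘(ℝ, F) : E → Type _) x₀ with he
  refine ((e.contMDiffAt_section_iff hx).1 (X.contMDiff x)).congr_of_eventuallyEq ?_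
  filter_upwards [e.open_baseSet.mem_nhds hx] with y hy
  rw [e.continuousLinearMapAt_apply ℝ, e.coe_linearMapAt_of_mem hy]

theorem differentiableAt_comp_extChartAt_symm {N : Type*} [NormedAddCommGroup N] [NormedSpace ℝ N]
    {f : E → N} {x : E} (hf : ContMDiffAt 𝓘(ℝ, F) 𝓘(ℝ, N) ∞ f x) :
    DifferentiableAt ℝ (f ∘ (extChartAt 𝓘(ℝ, F) x).symm) (extChartAt 𝓘(ℝ, F) x x) := by
  have h : ContMDiffAt 𝓘(ℝ, F) 𝓘(ℝ, N) ∞ (f ∘ (extChartAt 𝓘(ℝ, F) x).symm)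
      (extChartAt 𝓘(ℝ, F) x x) := by
    refine ContMDiffAt.comp _ ?_ ((contMDiffOn_extChartAt_symm x).contMDiffAt
      ((isOpen_extChartAt_target x).mem_nhds (mem_extChartAt_target x)))
    rwa [(extChartAt 𝓘(ℝ, F) x).left_inv (mem_extChartAt_source x)]
  exact (contMDiffAt_iff_contDiffAt.1 h).differentiableAt (by simp)

theorem chartField_self (X : VectorField F E) (x : E) :
    chartField X x (extChartAt 𝓘(ℝ, F) x x) = X x := by
  have key : ∀ q : E, q = x →
      (trivializationAt F (TangentSpace 𝓘(ℝ, F)) x).continuousLinearMapAt ℝ q (X q) = X x := by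
    rintro q rfl
    exact continuousLinearMapAt_self q (X q)
  exact key _ ((extChartAt 𝓘(ℝ, F) x).left_inv (mem_extChartAt_source x))

theorem chartField_differentiableAt (X : VectorField F E) (x : E) :
    DifferentiableAt ℝ (chartField X x) (extChartAt 𝓘(ℝ, F) x x) :=
  differentiableAt_comp_extChartAt_symm
    (contMDiffAt_continuousLinearMapAt X x (FiberBundle.mem_baseSet_trivializationAt' x))

/-- The Leibniz rule for the product with a function, in coordinates. -/
theorem coordDeriv_smul [T2Space E] (f : C^∞⟮𝓘(ℝ, F), E; ℝ⟯) {α : RawForm F E}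
    (hα : α ∈ Forms F E) (x : E) :
    coordDeriv (fun x => f x • α x) x =
      f x • coordDeriv α x + (coordDerivFun f x).smulRight (α x) := by
  ext w n v
  have h : chartForm (fun x => f x • α x) x n =
      fun y => (f ∘ (extChartAt 𝓘(ℝ, F) x).symm) y • chartForm α x n y := by
    ext y u; rfl
  have hd : fderiv ℝ (fun y => (f ∘ (extChartAt 𝓘(ℝ, F) x).symm) y • chartForm α x n y)
      (extChartAt 𝓘(ℝ, F) x x) = _ :=
    ((differentiableAt_comp_extChartAt_symm (f.contMDiff x)).hasFDerivAt.smul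
      (chartForm_differentiableAt hα x n).hasFDerivAt).fderiv
  change fderiv ℝ (chartForm (fun x => f x • α x) x n) _ w v = _
  rw [h, hd]
  have h0 := chartForm_self α x n v
  simp only [Function.comp_apply, (extChartAt 𝓘(ℝ, F) x).left_inv (mem_extChartAt_source x)]
  change f x * fderiv ℝ (chartForm α x n) _ w v + fderiv ℝ _ _ w * chartForm α x n _ v = _
  rw [h0]
  rfl

/-- The Leibniz rule for the insertion of a vector field, in coordinates. -/
theorem coordDeriv_insertVec [T2Space E] (X : VectorField F E) {α : RawForm F E}
    (hα : α ∈ Forms F E) (hX : (fun x => insertVec (X x) (α x)) ∈ Forms F E) (x : E)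
    (w : TangentSpace 𝓘(ℝ, F) x) :
    coordDeriv (fun x => insertVec (X x) (α x)) x w =
      insertVec (X x) (coordDeriv α x w) + insertVec (coordDerivField X x w) (α x) := by
  ext n v
  set φ := extChartAt 𝓘(ℝ, F) x with hφ
  let u : Fin (n + 1) → F → F := fun i => Fin.cases (chartField X x) (fun j _ => v j) i
  have hu : ∀ y, (fun i => u i y) = Matrix.vecCons (chartField X x y) v := by
    intro y
    ext i
    refine Fin.cases ?_ (fun i => ?_) i <;> rfl
  have h : (fun y => chartForm (fun x => insertVec (X x) (α x)) x n y v) =ᶠ[𝓝 (φ x)]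
      fun y => chartForm α x (n + 1) y (fun i => u i y) := by
    filter_upwards [(isOpen_extChartAt_target (I := 𝓘(ℝ, F)) x).mem_nhds
      (mem_extChartAt_target x)] with y hy
    set q := φ.symm y with hq
    have hqs : q ∈ (chartAt F x).source := by
      have := φ.map_target hy
      rwa [hφ, extChartAt_source] at this
    have hqb : q ∈ (trivializationAt F (TangentSpace 𝓘(ℝ, F) : E → Type _) x).baseSet := by
      simpa using hqs
    have hyq : y = φ q := (φ.right_inv hy).symm
    rw [hu, hyq, hφ]
    refine (chartForm_apply _ x n hqs v).trans
      (Eq.trans ?_ (chartForm_apply _ x (n + 1) hqs _).symm)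
    change α q (n + 1) (Matrix.vecCons (X q) _) = _
    congr 1
    ext i
    refine Fin.cases ?_ (fun i => ?_) i
    · have key : ∀ r : E, r = q → (trivializationAt F (TangentSpace 𝓘(ℝ, F)) x).symmL ℝ q
          ((trivializationAt F (TangentSpace 𝓘(ℝ, F)) x).continuousLinearMapAt ℝ r (X r)) =
            X q := by
        rintro r rfl
        exact Trivialization.symmL_continuousLinearMapAt _ hqb _
      exact (key _ (φ.left_inv (by simpa [hφ] using hqs))).symm
    · rfl
  have h1 : fderiv ℝ (chartForm (fun x => insertVec (X x) (α x)) x n) (φ x) w v =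
      fderiv ℝ (fun y => chartForm (fun x => insertVec (X x) (α x)) x n y v) (φ x) w :=
    (fderiv_continuousAlternatingMap_apply_const_apply
      (chartForm_differentiableAt hX x n) v w).symm
  have hud : ∀ i, DifferentiableAt ℝ (u i) (φ x) := by
    intro i
    refine Fin.cases ?_ (fun i => ?_) i
    · exact chartField_differentiableAt X x
    · exact differentiableAt_const _
  have h2 := fderiv_continuousAlternatingMap_apply_apply
    (chartForm_differentiableAt hα x (n + 1)) hud w
  change fderiv ℝ (chartForm (fun x => insertVec (X x) (α x)) x n) (φ x) w v = _
  rw [h1, h.fderiv_eq]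
  refine h2.trans ?_
  rw [Fin.sum_univ_succ, hu, chartField_self]
  have h3 : ∀ i : Fin n, chartForm α x (n + 1) (φ x) (Function.update
      (Matrix.vecCons (X x) v : Fin (n + 1) → F) i.succ (fderiv ℝ (u i.succ) (φ x) w)) = 0 := by
    intro i
    refine (chartForm α x (n + 1) (φ x)).map_coord_zero i.succ ?_
    have : fderiv ℝ (u i.succ) (φ x) = 0 := fderiv_const_apply (v i)
    rw [Function.update_self, this]
    rfl
  rw [Finset.sum_eq_zero fun i _ => h3 i, add_zero]
  have h4 : (Function.update (Matrix.vecCons (X x) v : Fin (n + 1) → F) 0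
      (fderiv ℝ (u 0) (φ x) w)) = Matrix.vecCons (coordDerivField X x w) v := by
    ext i
    refine Fin.cases ?_ (fun i => ?_) i <;> rfl
  rw [h4]
  exact congrArg (fderiv ℝ (chartForm α x (n + 1)) (φ x) w (Matrix.vecCons (X x) v) + ·)
    (chartForm_self α x (n + 1) _)

/-! ### Global forms and vector fields from local ones -/

/-- A form with constant coefficients in the chart around `x₀`, cut off. -/
theorem exists_form_eventually_const [T2Space E] (x₀ : E) (β : AltForms F) :
    ∃ α ∈ Forms F E, ∀ᶠ y in 𝓝 x₀, ∀ n, α y n = (β n).compLinearMap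
      ((trivializationAt F (TangentSpace 𝓘(ℝ, F)) x₀).continuousLinearMapAt ℝ y).toLinearMap := by
  set e := trivializationAt F (TangentSpace 𝓘(ℝ, F) : E → Type _) x₀ with he
  obtain ⟨f, -, hf⟩ := ((SmoothBumpFunction.nhds_basis_tsupport (I := 𝓘(ℝ, F)) x₀).mem_iff.1
    (e.open_baseSet.mem_nhds (FiberBundle.mem_baseSet_trivializationAt' x₀)))
  refine ⟨fun y n => (f y : ℝ) • (β n).compLinearMap (e.continuousLinearMapAt ℝ y).toLinearMap,
    ?_, ?_⟩
  · rw [mem_forms]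
    intro n V x
    by_cases hx : x ∈ tsupport f
    · refine (f.contMDiff x).mul ?_
      let b := Module.finBasis ℝ F
      have hfin : ContMDiffAt 𝓘(ℝ, F) 𝓘(ℝ, ℝ) ∞ (fun x =>
          ∑ r : Fin n → Fin (Module.finrank ℝ F),
            (∏ i, b.repr (e.continuousLinearMapAt ℝ x (V i x)) (r i)) *
              β n (fun i => b (r i))) x := by
        refine contMDiffAt_finsetSum fun r _ => ContMDiffAt.mul ?_ contMDiffAt_const
        refine contMDiffAt_finsetProd fun i _ => ?_
        exact (LinearMap.toContinuousLinearMap (b.coord (r i))).contMDiff.contMDiffAt.comp x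
          (contMDiffAt_continuousLinearMapAt (V i) x₀ (hf hx))
      refine hfin.congr_of_eventuallyEq (Filter.Eventually.of_forall fun x => ?_)
      exact altMap_expand b (β n) _
    · refine (contMDiffAt_const (c := (0 : ℝ))).congr_of_eventuallyEq ?_
      filter_upwards [(isClosed_tsupport f).isOpen_compl.mem_nhds hx] with y hy
      have : f y = 0 := image_eq_zero_of_notMem_tsupport hy
      simp [this]
  · filter_upwards [f.eventuallyEq_one] with y hy n
    rw [hy]
    exact one_smul ℝ _

theorem exists_form_eq [T2Space E] (x₀ : E) (β : AltForms (TangentSpace 𝓘(ℝ, F) x₀)) :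
    ∃ α : Forms F E, α.1 x₀ = β := by
  obtain ⟨α, hα, h⟩ := exists_form_eventually_const (F := F) x₀ (β := β)
  refine ⟨⟨α, hα⟩, ?_⟩
  ext n v
  change α x₀ n v = _
  rw [h.self_of_nhds n]
  change β n _ = _
  congr 1
  ext i
  exact continuousLinearMapAt_self x₀ (v i)

/-- A vector field is smooth if all smooth forms of degree one have smooth values on it. -/
theorem exists_vectorField_of_contMDiff [T2Space E] (Z : ∀ x : E, TangentSpace 𝓘(ℝ, F) x)
    (hZ : ∀ α ∈ Forms F E, ContMDiff 𝓘(ℝ, F) 𝓘(ℝ, ℝ) ∞ fun x => α x 1 ![Z x]) :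
    ∃ W : VectorField F E, ∀ x, W x = Z x := by
  refine ⟨⟨Z, fun x₀ => ?_⟩, fun _ => rfl⟩
  set e := trivializationAt F (TangentSpace 𝓘(ℝ, F) : E → Type _) x₀ with he
  have hx₀ : x₀ ∈ e.baseSet := FiberBundle.mem_baseSet_trivializationAt' x₀
  rw [e.contMDiffAt_section_iff hx₀]
  let b := Module.finBasis ℝ F
  have hi : ∀ i, ContMDiffAt 𝓘(ℝ, F) 𝓘(ℝ, ℝ) ∞
      (fun x => b.coord i (e.continuousLinearMapAt ℝ x (Z x))) x₀ := by
    intro i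
    let β : AltForms F := fun n => match n with
      | 1 => AlternatingMap.ofSubsingleton ℝ F ℝ (0 : Fin 1) (b.coord i)
      | _ => 0
    obtain ⟨α, hα, h⟩ := exists_form_eventually_const x₀ β
    refine (hZ α hα x₀).congr_of_eventuallyEq ?_
    filter_upwards [h] with x hx
    rw [hx 1]
    simp [β, he]
  have hsum : ContMDiffAt 𝓘(ℝ, F) 𝓘(ℝ, F) ∞
      (fun x => ∑ i, b.coord i (e.continuousLinearMapAt ℝ x (Z x)) • b i) x₀ :=
    contMDiffAt_finsetSum fun i _ => (hi i).smul contMDiffAt_const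
  refine hsum.congr_of_eventuallyEq ?_
  filter_upwards [e.open_baseSet.mem_nhds hx₀] with x hx
  have h : (e ⟨x, Z x⟩).2 = e.continuousLinearMapAt ℝ x (Z x) := by
    rw [e.continuousLinearMapAt_apply ℝ, e.coe_linearMapAt_of_mem hx]
  rw [h]
  exact (b.sum_repr _).symm

end Coordinates

/-! ### Parity of operators on forms -/

section Parity

variable {F : Type*} [NormedAddCommGroup F] [NormedSpace ℝ F] [FiniteDimensional ℝ F]
  {E : Type*} [TopologicalSpace E] [ChartedSpace F E] [IsManifold 𝓘(ℝ, F) ∞ E] [T2Space E]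

theorem insertion_apply (X : MultivectorField F E) (α : Forms F E) (x : E) :
    (insertion F E X α).1 x = insertAt (X.1 x) (α.1 x) := rfl

theorem insertion_funMV_apply (f : C^∞⟮𝓘(ℝ, F), E; ℝ⟯) (α : Forms F E) (x : E) :
    (insertion F E (funMV f) α).1 x = f x • α.1 x := by
  rw [insertion_apply]
  simp [funMV]

theorem insertion_vecMV_apply (X : VectorField F E) (α : Forms F E) (x : E) :
    (insertion F E (vecMV X) α).1 x = insertVec (X x) (α.1 x) := by
  rw [insertion_apply, vecMV, insertAt_ι]

theorem end_ext {S T : Module.End ℝ (Forms F E)}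
    (h : ∀ (α : Forms F E) (x : E), (S α).1 x = (T α).1 x) : S = T :=
  LinearMap.ext fun α => Subtype.ext (funext fun x => h α x)

theorem extD_apply (α : Forms F E) (x : E) : (extD α).1 x = antisymm (coordDeriv α.1 x) :=
  rawExtDeriv_eq_antisymm α.1 x

theorem parity_apply (α : Forms F E) (x : E) (n : ℕ) :
    (parity α).1 x n = (-1 : ℝ) ^ n • α.1 x n := rfl

theorem parity_mul_parity : parity * parity = (1 : Module.End ℝ (Forms F E)) := by
  refine end_ext fun α x => funext fun n => ?_
  change (-1 : ℝ) ^ n • (-1 : ℝ) ^ n • α.1 x n = α.1 x n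
  rw [smul_smul, ← mul_pow]
  simp

/-- The grading automorphism of the algebra of endomorphisms of `Ω(E)`, equal to `(-1)^a` on the
endomorphisms of degree `a`. -/
def sign : Module.End ℝ (Forms F E) →ₐ[ℝ] Module.End ℝ (Forms F E) :=
  AlgHom.ofLinearMap
    { toFun := fun T => parity * T * parity
      map_add' := fun S T => by rw [mul_add, add_mul]
      map_smul' := fun c T => by rw [mul_smul_comm, smul_mul_assoc, RingHom.id_apply] }
    (by change parity * 1 * parity = 1; rw [mul_one, parity_mul_parity])
    (fun S T => by
      change parity * (S * T) * parity = parity * S * parity * (parity * T * parity)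
      calc parity * (S * T) * parity = parity * S * 1 * T * parity := by
            rw [mul_one]; simp only [mul_assoc]
        _ = _ := by rw [← parity_mul_parity]; simp only [mul_assoc])

theorem sign_apply (T : Module.End ℝ (Forms F E)) : sign T = parity * T * parity := rfl

theorem sign_sign (T : Module.End ℝ (Forms F E)) : sign (sign T) = T := by
  rw [sign_apply, sign_apply]
  calc parity * (parity * T * parity) * parity = (parity * parity) * T * (parity * parity) := by
        simp only [mul_assoc]
    _ = T := by rw [parity_mul_parity, one_mul, mul_one]

theorem sign_apply_apply (T : Module.End ℝ (Forms F E)) (α : Forms F E) (x : E) (n : ℕ) :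
    (sign T α).1 x n = (-1 : ℝ) ^ n • (T (parity α)).1 x n := rfl

theorem sign_extD : sign (extD : Module.End ℝ (Forms F E)) = -extD := by
  refine end_ext fun α x => funext fun n => ?_
  rw [sign_apply_apply]
  cases n with
  | zero =>
    ext v
    change (-1 : ℝ) ^ 0 * (0 : ℝ) = -0
    simp
  | succ n =>
    ext v
    have hc : chartForm (parity α).1 x n = (-1 : ℝ) ^ n • chartForm α.1 x n := by
      ext y u; rfl
    change (-1 : ℝ) ^ (n + 1) * extDeriv (chartForm (parity α).1 x n) _ _ =
      -extDeriv (chartForm α.1 x n) _ _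
    rw [hc, extDeriv_smul]
    have h : ∀ r : ℝ, (-1 : ℝ) ^ (n + 1) * ((-1 : ℝ) ^ n * r) = -r := by
      intro r
      have h2 : (-1 : ℝ) ^ n * (-1) ^ n = 1 := by rw [← mul_pow]; simp
      rw [pow_succ]
      linear_combination -r * h2
    exact h _

theorem sign_vecMV (X : VectorField F E) :
    sign (insertion F E (vecMV X)) = -insertion F E (vecMV X) := by
  refine end_ext fun α x => funext fun n => ?_
  rw [sign_apply_apply, insertion_vecMV_apply]
  change _ = -(insertion F E (vecMV X) α).1 x n
  rw [insertion_vecMV_apply]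
  ext v
  change (-1 : ℝ) ^ n * ((-1 : ℝ) ^ (n + 1) * α.1 x (n + 1) (Matrix.vecCons (X x) v)) =
    -α.1 x (n + 1) (Matrix.vecCons (X x) v)
  have h2 : (-1 : ℝ) ^ n * (-1) ^ n = 1 := by rw [← mul_pow]; simp
  rw [pow_succ]
  linear_combination -(α.1 x (n + 1)) (Matrix.vecCons (X x) v) * h2

theorem sign_funMV (f : C^∞⟮𝓘(ℝ, F), E; ℝ⟯) :
    sign (insertion F E (funMV f)) = insertion F E (funMV f) := by
  refine end_ext fun α x => funext fun n => ?_
  rw [sign_apply_apply, insertion_funMV_apply, insertion_funMV_apply]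
  change (-1 : ℝ) ^ n • f x • (-1 : ℝ) ^ n • α.1 x n = f x • α.1 x n
  have h2 : (-1 : ℝ) ^ n * (-1) ^ n = 1 := by rw [← mul_pow]; simp
  rw [smul_smul, smul_smul]
  congr 1
  linear_combination f x * h2

theorem sign_vertComp (S : Splitting F E) (q : ℕ) : sign (S.vertComp q) = S.vertComp q := by
  refine end_ext fun α x => funext fun n => ?_
  rw [sign_apply_apply]
  change (-1 : ℝ) ^ n • vertPart (S.proj x) q ((-1 : ℝ) ^ n • α.1 x n) =
    vertPart (S.proj x) q (α.1 x n)
  rw [map_smul, smul_smul, ← mul_pow]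
  simp

theorem sign_vertD (S : Splitting F E) : sign S.vertD = -S.vertD := by
  rw [Splitting.vertD, map_sum, ← Finset.sum_neg_distrib]
  refine Finset.sum_congr rfl fun q _ => ?_
  rw [map_mul, map_mul, sign_vertComp, sign_vertComp, sign_extD]
  simp

/-! ### Graded commutators -/

theorem gradedComm_eq_of_odd_right {S T : Module.End ℝ (Forms F E)} (hT : sign T = -T) :
    gradedComm S T = S * T - T * sign S := by
  have h : oddPart T = T := by
    rw [oddPart, ← sign_apply, hT, sub_neg_eq_add, ← two_smul ℝ T, smul_smul]; norm_num
  rw [gradedComm, h, oddPart, ← sign_apply, mul_smul_comm, smul_smul]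
  norm_num
  rw [mul_sub]
  abel

theorem gradedComm_eq_of_even_right {S T : Module.End ℝ (Forms F E)} (hT : sign T = T) :
    gradedComm S T = S * T - T * S := by
  have h : oddPart T = 0 := by rw [oddPart, ← sign_apply, hT, sub_self, smul_zero]
  rw [gradedComm, h, zero_mul, smul_zero, add_zero]

theorem gradedComm_eq_of_odd_left {S T : Module.End ℝ (Forms F E)} (hS : sign S = -S) :
    gradedComm S T = S * T - sign T * S := by
  have h : oddPart S = S := by
    rw [oddPart, ← sign_apply, hS, sub_neg_eq_add, ← two_smul ℝ S, smul_smul]; norm_num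
  rw [gradedComm, h, oddPart, ← sign_apply, smul_mul_assoc, smul_smul]
  norm_num
  rw [sub_mul]
  abel

theorem gradedComm_eq_of_even_left {S T : Module.End ℝ (Forms F E)} (hS : sign S = S) :
    gradedComm S T = S * T - T * S := by
  have h : oddPart S = 0 := by rw [oddPart, ← sign_apply, hS, sub_self, smul_zero]
  rw [gradedComm, h, mul_zero, smul_zero, add_zero]

theorem gradedComm_funMV_right (S : Module.End ℝ (Forms F E)) (f : C^∞⟮𝓘(ℝ, F), E; ℝ⟯) :
    gradedComm S (insertion F E (funMV f)) =
      S * insertion F E (funMV f) - insertion F E (funMV f) * S :=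
  gradedComm_eq_of_even_right (sign_funMV f)

theorem gradedComm_vecMV_right (S : Module.End ℝ (Forms F E)) (Y : VectorField F E) :
    gradedComm S (insertion F E (vecMV Y)) =
      S * insertion F E (vecMV Y) - insertion F E (vecMV Y) * sign S :=
  gradedComm_eq_of_odd_right (sign_vecMV Y)

theorem gradedComm_funMV_left (f : C^∞⟮𝓘(ℝ, F), E; ℝ⟯) (δ : Module.End ℝ (Forms F E)) :
    gradedComm (insertion F E (funMV f)) δ =
      insertion F E (funMV f) * δ - δ * insertion F E (funMV f) :=
  gradedComm_eq_of_even_left (sign_funMV f)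

theorem gradedComm_vecMV_left {δ : Module.End ℝ (Forms F E)} (hδ : sign δ = -δ)
    (X : VectorField F E) :
    gradedComm (insertion F E (vecMV X)) δ =
      insertion F E (vecMV X) * δ + δ * insertion F E (vecMV X) := by
  rw [gradedComm_eq_of_odd_right hδ, sign_vecMV, mul_neg, sub_neg_eq_add]

theorem sign_gradedComm_funMV {δ : Module.End ℝ (Forms F E)} (hδ : sign δ = -δ)
    (f : C^∞⟮𝓘(ℝ, F), E; ℝ⟯) :
    sign (gradedComm (insertion F E (funMV f)) δ) = -gradedComm (insertion F E (funMV f)) δ := by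
  rw [gradedComm_funMV_left, map_sub, map_mul, map_mul, sign_funMV, hδ, mul_neg, neg_mul]
  abel

theorem sign_gradedComm_vecMV {δ : Module.End ℝ (Forms F E)} (hδ : sign δ = -δ)
    (X : VectorField F E) :
    sign (gradedComm (insertion F E (vecMV X)) δ) = gradedComm (insertion F E (vecMV X)) δ := by
  rw [gradedComm_vecMV_left hδ, map_add, map_mul, map_mul, sign_vecMV, hδ, neg_mul_neg, neg_mul_neg]

theorem derivedBracket_funMV_funMV (δ : Module.End ℝ (Forms F E)) (f g : C^∞⟮𝓘(ℝ, F), E; ℝ⟯) :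
    derivedBracket δ (insertion F E (funMV f)) (insertion F E (funMV g)) =
      gradedComm (insertion F E (funMV f)) δ * insertion F E (funMV g) -
        insertion F E (funMV g) * gradedComm (insertion F E (funMV f)) δ :=
  gradedComm_funMV_right _ g

theorem derivedBracket_funMV_vecMV {δ : Module.End ℝ (Forms F E)} (hδ : sign δ = -δ)
    (f : C^∞⟮𝓘(ℝ, F), E; ℝ⟯) (Y : VectorField F E) :
    derivedBracket δ (insertion F E (funMV f)) (insertion F E (vecMV Y)) =
      gradedComm (insertion F E (funMV f)) δ * insertion F E (vecMV Y) +
        insertion F E (vecMV Y) * gradedComm (insertion F E (funMV f)) δ := by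
  rw [derivedBracket, gradedComm_vecMV_right, sign_gradedComm_funMV hδ, mul_neg, sub_neg_eq_add]

theorem derivedBracket_vecMV_vecMV {δ : Module.End ℝ (Forms F E)} (hδ : sign δ = -δ)
    (X Y : VectorField F E) :
    derivedBracket δ (insertion F E (vecMV X)) (insertion F E (vecMV Y)) =
      gradedComm (insertion F E (vecMV X)) δ * insertion F E (vecMV Y) -
        insertion F E (vecMV Y) * gradedComm (insertion F E (vecMV X)) δ := by
  rw [derivedBracket, gradedComm_vecMV_right, sign_gradedComm_vecMV hδ]

end Parity

/-! ### Derived brackets of the exterior derivative -/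

section ExteriorDerivative

variable {F : Type*} [NormedAddCommGroup F] [NormedSpace ℝ F] [FiniteDimensional ℝ F]
  {E : Type*} [TopologicalSpace E] [ChartedSpace F E] [IsManifold 𝓘(ℝ, F) ∞ E] [T2Space E]

theorem coordDeriv_insertion_funMV (f : C^∞⟮𝓘(ℝ, F), E; ℝ⟯) (α : Forms F E) (x : E) :
    coordDeriv (insertion F E (funMV f) α).1 x =
      f x • coordDeriv α.1 x + (coordDerivFun (F := F) f x).smulRight (α.1 x) := by
  rw [← coordDeriv_smul f α.2, show (insertion F E (funMV f) α).1 = fun x => f x • α.1 x from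
    funext (insertion_funMV_apply f α)]

theorem coordDeriv_insertion_vecMV (X : VectorField F E) (α : Forms F E) (x : E) :
    coordDeriv (insertion F E (vecMV X) α).1 x = insertVec (X x) ∘ₗ coordDeriv α.1 x +
      LinearMap.flip insertVec (α.1 x) ∘ₗ coordDerivField X x := by
  have h : (insertion F E (vecMV X) α).1 = fun x => insertVec (X x) (α.1 x) :=
    funext (insertion_vecMV_apply X α)
  ext1 w
  rw [h, coordDeriv_insertVec X α.2 (h ▸ (insertion F E (vecMV X) α).2)]
  rfl

/-- The commutator of a function `f` with the exterior derivative is the wedge product with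
`-df`. -/
theorem commutator_funMV_extD (f : C^∞⟮𝓘(ℝ, F), E; ℝ⟯) (α : Forms F E) (x : E) :
    (gradedComm (insertion F E (funMV f)) extD α).1 x =
      -antisymm ((coordDerivFun (F := F) f x).smulRight (α.1 x)) := by
  rw [gradedComm_funMV_left]
  change (insertion F E (funMV f) (extD α)).1 x - (extD (insertion F E (funMV f) α)).1 x = _
  rw [insertion_funMV_apply, extD_apply, extD_apply, coordDeriv_insertion_funMV, antisymm_add,
    antisymm_smul]
  abel

/-- Cartan's formula for the Lie derivative, in coordinates. -/
theorem cartan_apply (X : VectorField F E) (α : Forms F E) (x : E) :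
    (gradedComm (insertion F E (vecMV X)) extD α).1 x =
      coordDeriv α.1 x (X x) +
        antisymm (LinearMap.flip insertVec (α.1 x) ∘ₗ coordDerivField X x) := by
  rw [gradedComm_vecMV_left sign_extD]
  change (insertion F E (vecMV X) (extD α)).1 x + (extD (insertion F E (vecMV X) α)).1 x = _
  rw [insertion_vecMV_apply, extD_apply, extD_apply, coordDeriv_insertion_vecMV, antisymm_add,
    insertVec_antisymm]
  abel

theorem insertVec_anticomm {V : Type*} [AddCommGroup V] [Module ℝ V] (v w : V) (α : AltForms V) :
    insertVec v (insertVec w α) = -insertVec w (insertVec v α) := by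
  have h := insertVec_mul_self (v + w)
  rw [map_add, add_mul, mul_add, mul_add, insertVec_mul_self, insertVec_mul_self, zero_add,
    add_zero] at h
  exact eq_neg_of_add_eq_zero_left (LinearMap.congr_fun h α)

theorem derivedBracket_extD_funMV_funMV (f g : C^∞⟮𝓘(ℝ, F), E; ℝ⟯) :
    derivedBracket extD (insertion F E (funMV f)) (insertion F E (funMV g)) = 0 := by
  rw [derivedBracket_funMV_funMV, sub_eq_zero]
  refine end_ext fun α x => ?_
  rw [Module.End.mul_apply, Module.End.mul_apply, commutator_funMV_extD, insertion_funMV_apply,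
    insertion_funMV_apply, commutator_funMV_extD, smul_neg, ← antisymm_smul]
  congr 2
  ext1 w
  exact smul_comm _ _ _

theorem contMDiff_zeroForm (α : Forms F E) :
    ContMDiff 𝓘(ℝ, F) 𝓘(ℝ, ℝ) ∞ (fun x => α.1 x 0 ![]) := by
  have h := mem_forms.1 α.2 0 ![]
  have e : (fun x => α.1 x 0 ![]) =
      fun x => α.1 x 0 (fun i => (![] : Fin 0 → VectorField F E) i x) := by
    funext x
    congr 1
    ext i
    exact i.elim0
  rw [e]
  exact h

/-- The constant function one, as a form. -/
def oneForm : Forms F E := ofFun 1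

theorem exists_derivedBracket_extD_funMV_vecMV (f : C^∞⟮𝓘(ℝ, F), E; ℝ⟯) (Y : VectorField F E) :
    ∃ h : C^∞⟮𝓘(ℝ, F), E; ℝ⟯,
      derivedBracket extD (insertion F E (funMV f)) (insertion F E (vecMV Y)) =
        insertion F E (funMV h) := by
  set T : Module.End ℝ (Forms F E) :=
    derivedBracket extD (insertion F E (funMV f)) (insertion F E (vecMV Y)) with hT
  rw [derivedBracket_funMV_vecMV sign_extD] at hT
  have key : ∀ (α : Forms F E) (x : E), (T α).1 x = -coordDerivFun (F := F) f x (Y x) • α.1 x := by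
    intro α x
    rw [hT]
    change (gradedComm (insertion F E (funMV f)) extD
      (insertion F E (vecMV Y) α)).1 x + (insertion F E (vecMV Y)
      (gradedComm (insertion F E (funMV f)) extD α)).1 x = _
    rw [commutator_funMV_extD, insertion_vecMV_apply, insertion_vecMV_apply,
      commutator_funMV_extD, map_neg, insertVec_antisymm]
    have h1 : insertVec (Y x) ∘ₗ (coordDerivFun (F := F) f x).smulRight (α.1 x) =
        (coordDerivFun (F := F) f x).smulRight (insertVec (Y x) (α.1 x)) := by
      ext1 w
      simp
    have h2 : -coordDerivFun (F := F) f x (Y x) • α.1 x =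
      -(coordDerivFun (F := F) f x (Y x) • α.1 x) := by
      ext n v
      exact neg_mul _ _
    rw [h1, LinearMap.smulRight_apply, h2]
    abel
  let h : C^∞⟮𝓘(ℝ, F), E; ℝ⟯ := ⟨fun x => (T oneForm).1 x 0 ![], contMDiff_zeroForm (T oneForm)⟩
  refine ⟨h, end_ext fun α x => ?_⟩
  rw [insertion_funMV_apply, key]
  congr 1
  change _ = (T oneForm).1 x 0 ![]
  rw [key]
  simp [oneForm, ofFun]

theorem exists_derivedBracket_extD_vecMV_vecMV (X Y : VectorField F E) :
    ∃ Z : VectorField F E,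
      derivedBracket extD (insertion F E (vecMV X)) (insertion F E (vecMV Y)) =
        insertion F E (vecMV Z) := by
  set T := derivedBracket extD (insertion F E (vecMV X)) (insertion F E (vecMV Y)) with hT
  rw [derivedBracket_vecMV_vecMV sign_extD] at hT
  -- The Lie bracket in coordinates.
  let Z : ∀ x : E, TangentSpace 𝓘(ℝ, F) x := fun x =>
    coordDerivField Y x (X x) - coordDerivField X x (Y x)
  have key : ∀ (α : Forms F E) (x : E), (T α).1 x = insertVec (Z x) (α.1 x) := by
    intro α x
    rw [hT]
    change (gradedComm (insertion F E (vecMV X)) extD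
      (insertion F E (vecMV Y) α)).1 x - (insertion F E (vecMV Y)
      (gradedComm (insertion F E (vecMV X)) extD α)).1 x = _
    rw [cartan_apply, insertion_vecMV_apply, insertion_vecMV_apply, cartan_apply, map_add,
      insertVec_antisymm, coordDeriv_insertion_vecMV]
    have h1 : LinearMap.flip insertVec (insertVec (Y x) (α.1 x)) ∘ₗ coordDerivField X x =
        -(insertVec (Y x) ∘ₗ (LinearMap.flip insertVec (α.1 x) ∘ₗ coordDerivField X x)) := by
      ext1 w
      exact insertVec_anticomm _ _ _
    rw [h1, antisymm_neg, map_sub, LinearMap.sub_apply]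
    simp only [LinearMap.add_apply, LinearMap.comp_apply, LinearMap.flip_apply]
    abel
  obtain ⟨W, hW⟩ := exists_vectorField_of_contMDiff Z fun α hα => by
    have h := contMDiff_zeroForm (T ⟨α, hα⟩)
    have e : (fun x => α x 1 ![Z x]) = fun x => (T ⟨α, hα⟩).1 x 0 ![] := by
      funext x
      rw [key]
      rfl
    rw [e]
    exact h
  exact ⟨W, end_ext fun α x => by rw [insertion_vecMV_apply, key, hW]⟩

end ExteriorDerivative

/-! ### Components of operators with respect to a grading -/

section Components

variable {R : Type*} [Ring R] {p : ℤ → R}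

/-- For a family `p` of projections onto the homogeneous parts of a graded module, `T'` is the
component of degree `k` of the operator `T`. -/
def IsComponent (p : ℤ → R) (T' T : R) (k : ℤ) : Prop :=
  ∀ r q : ℤ, p r * T' * p q = if r = q + k then p r * T * p q else 0

namespace IsComponent

variable {S S' T T' a : R} {k s : ℤ}

theorem add (h : IsComponent p T' T k) (h' : IsComponent p S' S k) :
    IsComponent p (T' + S') (T + S) k := by
  intro r q
  rw [mul_add, add_mul, h, h', mul_add, add_mul]
  split_ifs <;> simp

theorem sub (h : IsComponent p T' T k) (h' : IsComponent p S' S k) :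
    IsComponent p (T' - S') (T - S) k := by
  intro r q
  rw [mul_sub, sub_mul, h, h', mul_sub, sub_mul]
  split_ifs <;> simp

theorem mul_left (h : IsComponent p T' T k) (ha : ∀ r, p r * a = a * p (r + s)) :
    IsComponent p (a * T') (a * T) (k - s) := by
  intro r q
  have h1 : ∀ U, p r * (a * U) * p q = a * (p (r + s) * U * p q) := by
    intro U
    rw [← mul_assoc, ha]; simp only [mul_assoc]
  rw [h1, h1, h]
  by_cases hr : r = q + (k - s)
  · rw [if_pos hr, if_pos (by omega)]
  · rw [if_neg hr, if_neg (by omega), mul_zero]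

theorem mul_right (h : IsComponent p T' T k) (ha : ∀ r, p r * a = a * p (r + s)) :
    IsComponent p (T' * a) (T * a) (k - s) := by
  intro r q
  have h1 : ∀ U, p r * (U * a) * p q = p r * U * p (q - s) * a := by
    intro U
    have h2 := ha (q - s)
    rw [sub_add_cancel] at h2
    simp only [mul_assoc]
    rw [h2]
  rw [h1, h1, h]
  by_cases hr : r = q + (k - s)
  · rw [if_pos hr, if_pos (by omega)]
  · rw [if_neg hr, if_neg (by omega), zero_mul]

/-- An operator that is homogeneous of degree `-s` is its own component of degree `-s`. -/
theorem self (hp : ∀ q r, p q * p r = if q = r then p q else 0)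
    (ha : ∀ r, p r * a = a * p (r + s)) : IsComponent p a a (-s) := by
  intro r q
  by_cases hr : r = q + -s
  · rw [if_pos hr]
  · rw [if_neg hr, ha, mul_assoc, hp, if_neg (by omega), mul_zero]

/-- The components of a homogeneous operator in the other degrees are zero. -/
theorem zero (hp : ∀ q r, p q * p r = if q = r then p q else 0)
    (ha : ∀ r, p r * a = a * p (r + s)) (hs : k + s ≠ 0) : IsComponent p 0 a k := by
  intro r q
  rw [mul_zero, zero_mul]
  by_cases hr : r = q + k
  · rw [if_pos hr, ha, mul_assoc, hp, if_neg (by omega), mul_zero]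
  · rw [if_neg hr]

/-- If the projections sum to one, then an operator has only one component of each degree. -/
theorem unique {s : Finset ℤ} (hp : ∑ q ∈ s, p q = 1) (h : IsComponent p T' T k)
    (h' : IsComponent p S' T k) : T' = S' := by
  have hdec : ∀ U : R, U = ∑ r ∈ s, ∑ q ∈ s, p r * U * p q := by
    intro U
    simp_rw [← Finset.mul_sum, ← Finset.sum_mul, hp, one_mul, mul_one]
  rw [hdec T', hdec S']
  simp_rw [h _ _, h' _ _]

end IsComponent

end Components

/-! ### Derived brackets of the vertical differential -/

section Vertical

variable {F : Type*} [NormedAddCommGroup F] [NormedSpace ℝ F] [FiniteDimensional ℝ F]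
  {E : Type*} [TopologicalSpace E] [ChartedSpace F E] [IsManifold 𝓘(ℝ, F) ∞ E] [T2Space E]

theorem oddPart_add (S T : Module.End ℝ (Forms F E)) :
    oddPart (S + T) = oddPart S + oddPart T := by
  rw [oddPart, oddPart, oddPart, ← sign_apply, ← sign_apply, ← sign_apply, map_add, ← smul_add]
  congr 1
  abel

theorem gradedComm_add_left (S S' T : Module.End ℝ (Forms F E)) :
    gradedComm (S + S') T = gradedComm S T + gradedComm S' T := by
  rw [gradedComm, gradedComm, gradedComm, oddPart_add, mul_add, add_mul, mul_add, smul_add]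
  abel

theorem gradedComm_add_right (S T T' : Module.End ℝ (Forms F E)) :
    gradedComm S (T + T') = gradedComm S T + gradedComm S T' := by
  rw [gradedComm, gradedComm, gradedComm, oddPart_add, mul_add, add_mul, add_mul, smul_add]
  abel

theorem derivedBracket_add_left (δ S S' T : Module.End ℝ (Forms F E)) :
    derivedBracket δ (S + S') T = derivedBracket δ S T + derivedBracket δ S' T := by
  rw [derivedBracket, gradedComm_add_left, gradedComm_add_left]
  rfl

theorem derivedBracket_add_right (δ S T T' : Module.End ℝ (Forms F E)) :
    derivedBracket δ S (T + T') = derivedBracket δ S T + derivedBracket δ S T' :=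
  gradedComm_add_right _ _ _

theorem vecMV_add (X Y : VectorField F E) : vecMV (X + Y) = vecMV X + vecMV Y := by
  ext x
  exact map_add _ _ _

theorem form_eq_zero_of_finrank_lt (α : Forms F E) (x : E) {n : ℕ}
    (hn : Module.finrank ℝ F < n) : α.1 x n = 0 := by
  ext v
  refine (α.1 x n).map_linearDependent v fun hl => ?_
  have : FiniteDimensional ℝ (TangentSpace 𝓘(ℝ, F) x) := ‹FiniteDimensional ℝ F›
  have h := hl.fintype_card_le_finrank
  rw [Fintype.card_fin] at h
  exact absurd hn (not_lt.2 h)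

namespace Splitting

variable (S : Splitting F E)

theorem proj_proj (x : E) (v : TangentSpace 𝓘(ℝ, F) x) : S.proj x (S.proj x v) = S.proj x v :=
  Submodule.projection_apply_of_mem_left _ (Submodule.projection_apply_mem _ v)

/-- The projection onto the forms of vertical degree `q`, zero for negative `q`. -/
def comp (q : ℤ) : Module.End ℝ (Forms F E) := if 0 ≤ q then S.vertComp q.toNat else 0

theorem comp_natCast (q : ℕ) : S.comp q = S.vertComp q := by simp [comp]

theorem comp_of_neg {q : ℤ} (h : q < 0) : S.comp q = 0 := if_neg (not_le.2 h)

theorem vertComp_apply (q : ℕ) (α : Forms F E) (x : E) (n : ℕ) :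
    (S.vertComp q α).1 x n = vertPart (S.proj x) q (α.1 x n) := rfl

theorem vertComp_mul_vertComp (q r : ℕ) :
    S.vertComp q * S.vertComp r = if q = r then S.vertComp q else 0 := by
  refine end_ext fun α x => funext fun n => ?_
  rw [Module.End.mul_apply, vertComp_apply, vertComp_apply,
    vertPart_vertPart _ (S.proj_proj x)]
  split_ifs <;> rfl

theorem comp_mul_comp (q r : ℤ) : S.comp q * S.comp r = if q = r then S.comp q else 0 := by
  rcases lt_or_ge q 0 with hq | hq
  · rw [S.comp_of_neg hq, zero_mul, ite_self]
  rcases lt_or_ge r 0 with hr | hr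
  · rw [S.comp_of_neg hr, mul_zero, if_neg (by omega)]
  lift q to ℕ using hq
  lift r to ℕ using hr
  simp only [comp_natCast, vertComp_mul_vertComp, Nat.cast_inj]

theorem vertComp_eq_zero {q : ℕ} (hq : Module.finrank ℝ F < q) : S.vertComp q = 0 := by
  refine end_ext fun α x => funext fun n => ?_
  rw [vertComp_apply]
  rcases lt_or_ge n q with h | h
  · rw [vertPart_eq_zero _ h]; rfl
  · rw [form_eq_zero_of_finrank_lt α x (hq.trans_le h), map_zero]; rfl

theorem sum_vertComp :
    ∑ q ∈ Finset.range (Module.finrank ℝ F + 1), S.vertComp q = 1 := by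
  refine end_ext fun α x => funext fun n => ?_
  have h : ∀ s : Finset ℕ, ((∑ q ∈ s, S.vertComp q) α).1 x n =
      ∑ q ∈ s, vertPart (S.proj x) q (α.1 x n) := by
    intro s
    induction s using Finset.induction_on with
    | empty => simp
    | insert q s hq ih =>
      rw [Finset.sum_insert hq, Finset.sum_insert hq, ← ih]
      rfl
  rw [h]
  change _ = α.1 x n
  rcases lt_or_ge (Module.finrank ℝ F) n with hn | hn
  · rw [form_eq_zero_of_finrank_lt α x hn]
    simp
  · conv_rhs => rw [← sum_vertPart (S.proj x) (α.1 x n)]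
    refine (Finset.sum_subset (Finset.range_mono (by omega)) fun q _ hq => ?_).symm
    exact vertPart_eq_zero _ (by simpa using hq) _

theorem sum_comp : ∑ q ∈ (Finset.range (Module.finrank ℝ F + 1)).map Nat.castEmbedding,
    S.comp q = 1 := by
  rw [Finset.sum_map, ← S.sum_vertComp]
  exact Finset.sum_congr rfl fun q _ => S.comp_natCast q

/-- The vertical differential is the component of the exterior derivative that raises the vertical
degree by one. -/
theorem isComponent_vertD : IsComponent S.comp S.vertD extD 1 := by
  intro r q
  rcases lt_or_ge q 0 with hq | hq
  · rw [S.comp_of_neg hq, mul_zero, mul_zero, ite_self]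
  lift q to ℕ using hq
  rw [Splitting.vertD, Finset.mul_sum, Finset.sum_mul]
  have h : ∀ i : ℕ, S.comp r * (S.vertComp (i + 1) * extD * S.vertComp i) * S.comp q =
      if i = q then (if r = q + 1 then S.comp r * extD * S.comp q else 0) else 0 := by
    intro i
    have h1 : S.comp r * (S.vertComp (i + 1) * extD * S.vertComp i) * S.comp q =
        (S.comp r * S.comp ((i : ℤ) + 1)) * extD * (S.comp i * S.comp q) := by
      rw [← comp_natCast, ← comp_natCast]
      push_cast
      simp only [mul_assoc]
    rw [h1, comp_mul_comp, comp_mul_comp]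
    by_cases hi : i = q
    · subst hi
      by_cases hr : r = i + 1
      · simp [hr]
      · simp [hr]
    · simp [hi]
  rw [Finset.sum_congr rfl fun i _ => h i, Finset.sum_ite_eq']
  split_ifs with h1 h2 h2
  · rfl
  · rfl
  -- The sum defining `vertD` omits only degrees in which there are no nonzero forms.
  · rw [S.comp_natCast, S.vertComp_eq_zero (by simpa using h1), mul_zero]
  · rfl

theorem comp_mul_funMV (f : C^∞⟮𝓘(ℝ, F), E; ℝ⟯) (r : ℤ) :
    S.comp r * insertion F E (funMV f) = insertion F E (funMV f) * S.comp (r + 0) := by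
  rw [add_zero]
  rcases lt_or_ge r 0 with hr | hr
  · rw [S.comp_of_neg hr, mul_zero, zero_mul]
  lift r to ℕ using hr
  rw [comp_natCast]
  refine end_ext fun α x => funext fun n => ?_
  rw [Module.End.mul_apply, Module.End.mul_apply, insertion_funMV_apply, vertComp_apply,
    insertion_funMV_apply]
  exact map_smul (vertPart (S.proj x) r) (f x) (α.1 x n)

theorem comp_mul_vecMV_of_vert {X : VectorField F E} (hX : ∀ x, S.proj x (X x) = X x) (r : ℤ) :
    S.comp r * insertion F E (vecMV X) = insertion F E (vecMV X) * S.comp (r + 1) := by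
  have key : ∀ (α : Forms F E) (x : E) (n q : ℕ),
      insertVec (X x) ((S.vertComp (q + 1) α).1 x) n =
        vertPart (S.proj x) q (insertVec (X x) (α.1 x) n) := by
    intro α x n q
    change (vertPart (S.proj x) (q + 1) (α.1 x (n + 1))).curryLeft (X x) = _
    rw [vertPart_succ_curryLeft, hX, sub_self, map_zero, map_zero, add_zero]
    rfl
  rcases lt_or_ge r 0 with hr | hr
  · rw [S.comp_of_neg hr, zero_mul]
    rcases lt_or_ge (r + 1) 0 with hr' | hr'
    · rw [S.comp_of_neg hr', mul_zero]
    obtain rfl : r = -1 := by omega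
    refine end_ext fun α x => funext fun n => ?_
    rw [Module.End.mul_apply, insertion_vecMV_apply, show (-1 : ℤ) + 1 = (0 : ℕ) from rfl,
      comp_natCast]
    change _ = (vertPart (S.proj x) 0 (α.1 x (n + 1))).curryLeft (X x)
    rw [vertPart_zero_curryLeft, hX, sub_self, map_zero, map_zero]
    rfl
  lift r to ℕ using hr
  refine end_ext fun α x => funext fun n => ?_
  rw [Module.End.mul_apply, Module.End.mul_apply, comp_natCast, vertComp_apply,
    insertion_vecMV_apply, insertion_vecMV_apply, show (r : ℤ) + 1 = (r + 1 : ℕ) from rfl,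
    comp_natCast, key]

theorem comp_mul_vecMV_of_hor {X : VectorField F E} (hX : ∀ x, S.proj x (X x) = 0) (r : ℤ) :
    S.comp r * insertion F E (vecMV X) = insertion F E (vecMV X) * S.comp (r + 0) := by
  rw [add_zero]
  rcases lt_or_ge r 0 with hr | hr
  · rw [S.comp_of_neg hr, mul_zero, zero_mul]
  lift r to ℕ using hr
  rw [comp_natCast]
  refine end_ext fun α x => funext fun n => ?_
  rw [Module.End.mul_apply, Module.End.mul_apply, insertion_vecMV_apply, vertComp_apply,
    insertion_vecMV_apply]
  change vertPart (S.proj x) r ((α.1 x (n + 1)).curryLeft (X x)) =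
    (vertPart (S.proj x) r (α.1 x (n + 1))).curryLeft (X x)
  cases r with
  | zero => rw [vertPart_zero_curryLeft, hX, sub_zero]
  | succ r => rw [vertPart_succ_curryLeft, hX, sub_zero, map_zero, map_zero, zero_add]

/-- A vector field is the sum of fields on which the vertical projections act by a shift of the
degree. -/
theorem exists_vert_add_hor (X : VectorField F E) : ∃ V H : VectorField F E, V + H = X ∧
    (∀ r, S.comp r * insertion F E (vecMV V) = insertion F E (vecMV V) * S.comp (r + 1)) ∧
    (∀ r, S.comp r * insertion F E (vecMV H) = insertion F E (vecMV H) * S.comp (r + 0)) := by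
  refine ⟨S.vertField X, X - S.vertField X, add_sub_cancel _ _, ?_, ?_⟩
  · exact S.comp_mul_vecMV_of_vert fun x => S.proj_proj x (X x)
  · refine S.comp_mul_vecMV_of_hor fun x => ?_
    change S.proj x (X x - S.proj x (X x)) = 0
    rw [map_sub, proj_proj, sub_self]

theorem derivedBracket_vertD_funMV_funMV (f g : C^∞⟮𝓘(ℝ, F), E; ℝ⟯) :
    derivedBracket S.vertD (insertion F E (funMV f)) (insertion F E (funMV g)) = 0 := by
  have hf := S.comp_mul_funMV f
  have hg := S.comp_mul_funMV g
  have h1 := (S.isComponent_vertD.mul_left hf).sub (S.isComponent_vertD.mul_right hf)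
  rw [← gradedComm_funMV_left, ← gradedComm_funMV_left] at h1
  -- The component of degree one of `[[i_f, d], i_g] = 0`.
  have h2 := (h1.mul_right hg).sub (h1.mul_left hg)
  rw [← derivedBracket_funMV_funMV, ← derivedBracket_funMV_funMV,
    derivedBracket_extD_funMV_funMV] at h2
  refine h2.unique S.sum_comp fun r q => ?_
  simp

theorem exists_derivedBracket_vertD_funMV_vecMV (f : C^∞⟮𝓘(ℝ, F), E; ℝ⟯) (Y : VectorField F E) :
    ∃ h : C^∞⟮𝓘(ℝ, F), E; ℝ⟯,
      derivedBracket S.vertD (insertion F E (funMV f)) (insertion F E (vecMV Y)) =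
        insertion F E (funMV h) := by
  obtain ⟨V, H, rfl, hV, hH⟩ := S.exists_vert_add_hor Y
  have hf := S.comp_mul_funMV f
  have h1 := (S.isComponent_vertD.mul_left hf).sub (S.isComponent_vertD.mul_right hf)
  rw [← gradedComm_funMV_left, ← gradedComm_funMV_left] at h1
  obtain ⟨h, hh⟩ := exists_derivedBracket_extD_funMV_vecMV f V
  obtain ⟨k, hk⟩ := exists_derivedBracket_extD_funMV_vecMV f H
  -- Multiplication with a function has degree zero: it is the whole component for vertical `V`, and
  -- contributes nothing to the component of degree one, which is the one for horizontal `H`.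
  have h2 := (h1.mul_right hV).add (h1.mul_left hV)
  have h3 := (h1.mul_right hH).add (h1.mul_left hH)
  rw [← derivedBracket_funMV_vecMV (sign_vertD S), ← derivedBracket_funMV_vecMV sign_extD] at h2 h3
  rw [hh] at h2
  rw [hk] at h3
  have e2 := h2.unique S.sum_comp (IsComponent.self S.comp_mul_comp (S.comp_mul_funMV h))
  have e3 := h3.unique S.sum_comp
    (IsComponent.zero S.comp_mul_comp (S.comp_mul_funMV k) (by norm_num))
  exact ⟨h, by rw [vecMV_add, map_add, derivedBracket_add_right, e2, e3, add_zero]⟩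

/-- If insertions of `X` and `Y` lower the vertical degree by `s` and `t`, then the vertical bracket
of `X` and `Y` is the part of their Lie bracket whose insertion lowers it by `s + t - 1`: the
vertical part, the horizontal part or zero. -/
theorem exists_derivedBracket_vertD_vecMV_vecMV_of_shift {X Y : VectorField F E} {s t : ℤ}
    (hX : ∀ r, S.comp r * insertion F E (vecMV X) = insertion F E (vecMV X) * S.comp (r + s))
    (hY : ∀ r, S.comp r * insertion F E (vecMV Y) = insertion F E (vecMV Y) * S.comp (r + t)) :
    ∃ Z : VectorField F E,
      derivedBracket S.vertD (insertion F E (vecMV X)) (insertion F E (vecMV Y)) =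
        insertion F E (vecMV Z) := by
  have h1 := (S.isComponent_vertD.mul_left hX).add (S.isComponent_vertD.mul_right hX)
  rw [← gradedComm_vecMV_left (sign_vertD S), ← gradedComm_vecMV_left sign_extD] at h1
  have h2 := (h1.mul_right hY).sub (h1.mul_left hY)
  obtain ⟨Z, hZ⟩ := exists_derivedBracket_extD_vecMV_vecMV X Y
  rw [← derivedBracket_vecMV_vecMV (sign_vertD S), ← derivedBracket_vecMV_vecMV sign_extD, hZ] at h2
  obtain ⟨V, H, rfl, hV, hH⟩ := S.exists_vert_add_hor Z
  rw [vecMV_add, map_add] at h2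
  by_cases hv : 1 - s - t = -1
  · have h3 := IsComponent.self S.comp_mul_comp hV
    rw [← hv] at h3
    have h4 := h3.add (IsComponent.zero S.comp_mul_comp hH (by omega))
    rw [add_zero] at h4
    exact ⟨V, h2.unique S.sum_comp h4⟩
  by_cases hh : 1 - s - t = -0
  · have h3 := IsComponent.self S.comp_mul_comp hH
    rw [← hh] at h3
    have h4 := (IsComponent.zero S.comp_mul_comp hV (by omega)).add h3
    rw [zero_add] at h4
    exact ⟨H, h2.unique S.sum_comp h4⟩
  · have h4 := (IsComponent.zero (k := 1 - s - t) S.comp_mul_comp hV (by omega)).add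
      (IsComponent.zero S.comp_mul_comp hH (by omega))
    rw [add_zero] at h4
    refine ⟨0, (h2.unique S.sum_comp h4).trans ?_⟩
    have h0 : vecMV (0 : VectorField F E) = 0 := by
      ext x
      exact map_zero _
    rw [h0, map_zero]

theorem exists_derivedBracket_vertD_vecMV_vecMV (X Y : VectorField F E) :
    ∃ Z : VectorField F E,
      derivedBracket S.vertD (insertion F E (vecMV X)) (insertion F E (vecMV Y)) =
        insertion F E (vecMV Z) := by
  obtain ⟨V, H, rfl, hV, hH⟩ := S.exists_vert_add_hor X
  obtain ⟨V', H', rfl, hV', hH'⟩ := S.exists_vert_add_hor Y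
  obtain ⟨Z₁, h₁⟩ := S.exists_derivedBracket_vertD_vecMV_vecMV_of_shift hV hV'
  obtain ⟨Z₂, h₂⟩ := S.exists_derivedBracket_vertD_vecMV_vecMV_of_shift hV hH'
  obtain ⟨Z₃, h₃⟩ := S.exists_derivedBracket_vertD_vecMV_vecMV_of_shift hH hV'
  obtain ⟨Z₄, h₄⟩ := S.exists_derivedBracket_vertD_vecMV_vecMV_of_shift hH hH'
  refine ⟨(Z₁ + Z₃) + (Z₂ + Z₄), ?_⟩
  simp only [vecMV_add, map_add, derivedBracket_add_left, derivedBracket_add_right, h₁, h₂, h₃, h₄]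

end Splitting

end Vertical

/-! ### Derived brackets of products -/

/-! In this section `σ` stands for the grading involution `sign`, so that `S * δ - δ * σ S` is the
graded commutator of `S` with an odd element `δ`. -/

section Superalgebra

variable {R : Type*} [Ring R] {σ : R →+* R} {δ S T U : R}

/-- The derived bracket with an odd element `U` is a derivation on the elements that commute with `U`
in the graded sense. -/
theorem comm_mul_odd (hσ : ∀ S, σ (σ S) = S) (hU : σ U = -U) (hSU : S * U = U * σ S)
    (hTU : T * U = U * σ T) :
    (S * T * δ - δ * σ (S * T)) * U - U * σ (S * T * δ - δ * σ (S * T)) =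
      S * ((T * δ - δ * σ T) * U - U * σ (T * δ - δ * σ T)) +
        ((S * δ - δ * σ S) * U - U * σ (S * δ - δ * σ S)) * T := by
  have hTU' : σ T * U = U * T := by
    have h := congrArg σ hTU
    rw [map_mul, map_mul, hσ, hU, mul_neg, neg_mul, neg_inj] at h
    exact h
  have e1 : (S * T * δ - δ * σ (S * T)) = S * (T * δ - δ * σ T) + (S * δ - δ * σ S) * σ T := by
    rw [map_mul]; noncomm_ring
  rw [e1, map_add, map_mul, map_mul, hσ]
  generalize T * δ - δ * σ T = M
  generalize S * δ - δ * σ S = N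
  calc (S * M + N * σ T) * U - U * (σ S * σ M + σ N * T)
      = S * M * U + N * (σ T * U) - (U * σ S) * σ M - U * σ N * T := by noncomm_ring
    _ = _ := by rw [hTU', ← hSU]; noncomm_ring

/-- The derived bracket with an even element `U` is a graded derivation on the elements that commute
with `U`. -/
theorem comm_mul_even (hSU : S * U = U * S) (hTU : σ T * U = U * σ T) :
    (S * T * δ - δ * σ (S * T)) * U - U * (S * T * δ - δ * σ (S * T)) =
      S * ((T * δ - δ * σ T) * U - U * (T * δ - δ * σ T)) +
        ((S * δ - δ * σ S) * U - U * (S * δ - δ * σ S)) * σ T := by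
  have e1 : (S * T * δ - δ * σ (S * T)) = S * (T * δ - δ * σ T) + (S * δ - δ * σ S) * σ T := by
    rw [map_mul]; noncomm_ring
  rw [e1]
  generalize T * δ - δ * σ T = M
  generalize S * δ - δ * σ S = N
  calc (S * M + N * σ T) * U - U * (S * M + N * σ T)
      = S * M * U + N * (σ T * U) - (U * S) * M - U * N * σ T := by noncomm_ring
    _ = _ := by rw [hTU, ← hSU]; noncomm_ring

theorem comm_even_swap (hS : S * U = U * S) (hT : T * U = U * T) :
    (S * δ - δ * T) * U - U * (S * δ - δ * T) = (U * δ - δ * U) * T - S * (U * δ - δ * U) := by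
  calc (S * δ - δ * T) * U - U * (S * δ - δ * T)
      = S * δ * U - δ * (T * U) - (U * S) * δ + U * δ * T := by noncomm_ring
    _ = _ := by rw [hT, ← hS]; noncomm_ring

theorem odd_comm_mul (M U W : R) : M * (U * W) - σ (U * W) * M =
    (M * U - σ U * M) * W + σ U * (M * W - σ W * M) := by
  rw [map_mul]; noncomm_ring

theorem even_comm_mul (M U W : R) : M * (U * W) - (U * W) * M =
    (M * U - U * M) * W + U * (M * W - W * M) := by
  noncomm_ring

end Superalgebra

section Closure

variable {F : Type*} [NormedAddCommGroup F] [NormedSpace ℝ F] [FiniteDimensional ℝ F]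
  {E : Type*} [TopologicalSpace E] [ChartedSpace F E] [IsManifold 𝓘(ℝ, F) ∞ E] [T2Space E]

/-- An odd operator `δ` on forms whose derived brackets of functions and vector fields are those of
a differential operator of first order: the bracket of two functions is zero, that of a function and
a vector field is a function, and that of two vector fields is a vector field. -/
structure IsFirstOrder (δ : Module.End ℝ (Forms F E)) : Prop where
  odd : sign δ = -δ
  fun_fun : ∀ f g : C^∞⟮𝓘(ℝ, F), E; ℝ⟯,
    derivedBracket δ (insertion F E (funMV f)) (insertion F E (funMV g)) = 0
  fun_vec : ∀ (f : C^∞⟮𝓘(ℝ, F), E; ℝ⟯) (Y : VectorField F E), ∃ h : C^∞⟮𝓘(ℝ, F), E; ℝ⟯,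
    derivedBracket δ (insertion F E (funMV f)) (insertion F E (vecMV Y)) =
      insertion F E (funMV h)
  vec_vec : ∀ X Y : VectorField F E, ∃ Z : VectorField F E,
    derivedBracket δ (insertion F E (vecMV X)) (insertion F E (vecMV Y)) =
      insertion F E (vecMV Z)

theorem Splitting.isFirstOrder_vertD (S : Splitting F E) : IsFirstOrder S.vertD :=
  ⟨sign_vertD S, S.derivedBracket_vertD_funMV_funMV, S.exists_derivedBracket_vertD_funMV_vecMV,
    S.exists_derivedBracket_vertD_vecMV_vecMV⟩

variable (F E) in
/-- The algebra of operators generated by the multiplications with functions and the insertions of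
vector fields. -/
def basicInsertions : Subalgebra ℝ (Module.End ℝ (Forms F E)) :=
  Algebra.adjoin ℝ (Set.range (fun f => insertion F E (funMV f)) ∪
    Set.range (fun V => insertion F E (vecMV V)))

theorem funMV_mem (f : C^∞⟮𝓘(ℝ, F), E; ℝ⟯) : insertion F E (funMV f) ∈ basicInsertions F E :=
  Algebra.subset_adjoin (Or.inl ⟨f, rfl⟩)

theorem vecMV_mem (V : VectorField F E) : insertion F E (vecMV V) ∈ basicInsertions F E :=
  Algebra.subset_adjoin (Or.inr ⟨V, rfl⟩)

theorem exists_insertion_eq {T : Module.End ℝ (Forms F E)} (hT : T ∈ basicInsertions F E) :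
    ∃ Z, insertion F E Z = T := by
  have h : basicInsertions F E ≤ (insertion F E).range := by
    refine Algebra.adjoin_le ?_
    rintro _ (⟨f, rfl⟩ | ⟨V, rfl⟩)
    · exact ⟨_, rfl⟩
    · exact ⟨_, rfl⟩
  exact h hT

theorem basicMultivectors_le : basicMultivectors F E ≤ MultivectorField F E :=
  fun X hX _ => ⟨X, hX, Filter.Eventually.of_forall fun _ => rfl⟩

theorem basicMultivectors_induction {p : MultivectorField F E → Prop}
    (hf : ∀ f : C^∞⟮𝓘(ℝ, F), E; ℝ⟯, p (funMV f)) (hv : ∀ V : VectorField F E, p (vecMV V))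
    (hadd : ∀ U W, p U → p W → p (U + W)) (hmul : ∀ U W, p U → p W → p (U * W))
    {X : MultivectorField F E} (hX : X.1 ∈ basicMultivectors F E) : p X := by
  have h : ∀ (X : RawMultivector F E) (hX : X ∈ basicMultivectors F E),
      p ⟨X, basicMultivectors_le hX⟩ := by
    intro X hX
    induction hX using Algebra.adjoin_induction with
    | mem X hX =>
      rcases hX with ⟨f, rfl⟩ | ⟨V, rfl⟩
      · exact hf f
      · exact hv V
    | algebraMap r => exact hf (ContMDiffMap.const r)
    | add X Y hX hY hX' hY' => exact hadd _ _ hX' hY'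
    | mul X Y hX hY hX' hY' => exact hmul _ _ hX' hY'
  exact h X.1 hX

theorem insertion_mem {X : MultivectorField F E} (hX : X.1 ∈ basicMultivectors F E) :
    insertion F E X ∈ basicInsertions F E := by
  refine basicMultivectors_induction (p := fun X => insertion F E X ∈ basicInsertions F E)
    funMV_mem vecMV_mem (fun U W hU hW => ?_) (fun U W hU hW => ?_) hX
  · rw [map_add]
    exact add_mem hU hW
  · rw [map_mul]
    exact mul_mem hU hW

theorem sign_mem {T : Module.End ℝ (Forms F E)} (hT : T ∈ basicInsertions F E) :
    sign T ∈ basicInsertions F E := by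
  have h : basicInsertions F E ≤ (basicInsertions F E).comap sign := by
    refine Algebra.adjoin_le ?_
    rintro _ (⟨f, rfl⟩ | ⟨V, rfl⟩)
    · change sign (insertion F E (funMV f)) ∈ basicInsertions F E
      rw [sign_funMV]
      exact funMV_mem f
    · change sign (insertion F E (vecMV V)) ∈ basicInsertions F E
      rw [sign_vecMV]
      exact neg_mem (vecMV_mem V)
  exact h hT

theorem insertion_mul_funMV (X : MultivectorField F E) (f : C^∞⟮𝓘(ℝ, F), E; ℝ⟯) :
    insertion F E X * insertion F E (funMV f) = insertion F E (funMV f) * insertion F E X := by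
  rw [← map_mul, ← map_mul]
  congr 1
  ext x
  exact (Algebra.commutes (f x) (X.1 x)).symm

theorem vecMV_mul_vecMV (X Y : VectorField F E) :
    insertion F E (vecMV X) * insertion F E (vecMV Y) =
      -(insertion F E (vecMV Y) * insertion F E (vecMV X)) := by
  refine end_ext fun α x => ?_
  change (insertion F E (vecMV X) (insertion F E (vecMV Y) α)).1 x =
    -(insertion F E (vecMV Y) (insertion F E (vecMV X) α)).1 x
  rw [insertion_vecMV_apply, insertion_vecMV_apply, insertion_vecMV_apply, insertion_vecMV_apply]
  exact insertVec_anticomm _ _ _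

/-- The insertions are graded commutative. -/
theorem mul_vecMV {T : Module.End ℝ (Forms F E)} (hT : T ∈ basicInsertions F E)
    (Y : VectorField F E) : T * insertion F E (vecMV Y) = insertion F E (vecMV Y) * sign T := by
  induction hT using Algebra.adjoin_induction with
  | mem T hT =>
    rcases hT with ⟨f, rfl⟩ | ⟨V, rfl⟩
    · rw [sign_funMV, insertion_mul_funMV]
    · rw [sign_vecMV, vecMV_mul_vecMV, mul_neg]
  | algebraMap r => rw [AlgHom.commutes]; exact Algebra.commutes _ _
  | add S T _ _ hS hT => rw [add_mul, hS, hT, map_add, mul_add]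
  | mul S T _ _ hS hT => rw [mul_assoc, hT, ← mul_assoc, hS, map_mul, mul_assoc]

theorem mul_funMV {T : Module.End ℝ (Forms F E)} (hT : T ∈ basicInsertions F E)
    (f : C^∞⟮𝓘(ℝ, F), E; ℝ⟯) : T * insertion F E (funMV f) = insertion F E (funMV f) * T := by
  obtain ⟨Z, rfl⟩ := exists_insertion_eq hT
  exact insertion_mul_funMV Z f

variable {δ : Module.End ℝ (Forms F E)}

theorem derivedBracket_vecMV_right (hδ : sign δ = -δ) (S : Module.End ℝ (Forms F E))
    (Y : VectorField F E) : derivedBracket δ S (insertion F E (vecMV Y)) =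
      (S * δ - δ * sign S) * insertion F E (vecMV Y) -
        insertion F E (vecMV Y) * sign (S * δ - δ * sign S) := by
  rw [derivedBracket, gradedComm_vecMV_right, gradedComm_eq_of_odd_right hδ]

theorem derivedBracket_funMV_right (hδ : sign δ = -δ) (S : Module.End ℝ (Forms F E))
    (f : C^∞⟮𝓘(ℝ, F), E; ℝ⟯) : derivedBracket δ S (insertion F E (funMV f)) =
      (S * δ - δ * sign S) * insertion F E (funMV f) -
        insertion F E (funMV f) * (S * δ - δ * sign S) := by
  rw [derivedBracket, gradedComm_funMV_right, gradedComm_eq_of_odd_right hδ]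

/-- The derived bracket with a vector field is a derivation of the algebra of insertions. -/
theorem derivedBracket_mul_vecMV (hδ : sign δ = -δ) {S T : Module.End ℝ (Forms F E)}
    (hS : S ∈ basicInsertions F E) (hT : T ∈ basicInsertions F E) (Y : VectorField F E) :
    derivedBracket δ (S * T) (insertion F E (vecMV Y)) =
      S * derivedBracket δ T (insertion F E (vecMV Y)) +
        derivedBracket δ S (insertion F E (vecMV Y)) * T := by
  rw [derivedBracket_vecMV_right hδ, derivedBracket_vecMV_right hδ, derivedBracket_vecMV_right hδ]
  exact comm_mul_odd (σ := (sign : Module.End ℝ (Forms F E) →ₐ[ℝ] _).toRingHom) sign_sign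
    (sign_vecMV Y) (mul_vecMV hS Y) (mul_vecMV hT Y)

/-- The derived bracket with a function is a graded derivation of the algebra of insertions. -/
theorem derivedBracket_mul_funMV (hδ : sign δ = -δ) {S T : Module.End ℝ (Forms F E)}
    (hS : S ∈ basicInsertions F E) (hT : T ∈ basicInsertions F E) (f : C^∞⟮𝓘(ℝ, F), E; ℝ⟯) :
    derivedBracket δ (S * T) (insertion F E (funMV f)) =
      S * derivedBracket δ T (insertion F E (funMV f)) +
        derivedBracket δ S (insertion F E (funMV f)) * sign T := by
  rw [derivedBracket_funMV_right hδ, derivedBracket_funMV_right hδ, derivedBracket_funMV_right hδ]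
  exact comm_mul_even (σ := (sign : Module.End ℝ (Forms F E) →ₐ[ℝ] _).toRingHom)
    (mul_funMV hS f) (mul_funMV (sign_mem hT) f)

theorem gradedComm_mul_of_odd {M : Module.End ℝ (Forms F E)} (hM : sign M = -M)
    (U W : Module.End ℝ (Forms F E)) :
    gradedComm M (U * W) = gradedComm M U * W + sign U * gradedComm M W := by
  rw [gradedComm_eq_of_odd_left hM, gradedComm_eq_of_odd_left hM, gradedComm_eq_of_odd_left hM]
  exact odd_comm_mul (σ := (sign : Module.End ℝ (Forms F E) →ₐ[ℝ] _).toRingHom) M U W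

theorem gradedComm_mul_of_even {M : Module.End ℝ (Forms F E)} (hM : sign M = M)
    (U W : Module.End ℝ (Forms F E)) :
    gradedComm M (U * W) = gradedComm M U * W + U * gradedComm M W := by
  rw [gradedComm_eq_of_even_left hM, gradedComm_eq_of_even_left hM, gradedComm_eq_of_even_left hM]
  exact even_comm_mul M U W

theorem sign_gradedComm_of_odd_right (hδ : sign δ = -δ) (S : Module.End ℝ (Forms F E)) :
    sign (gradedComm S δ) = -gradedComm (sign S) δ := by
  rw [gradedComm_eq_of_odd_right hδ, gradedComm_eq_of_odd_right hδ, map_sub, map_mul, map_mul, hδ,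
    mul_neg, neg_mul, neg_sub, sub_neg_eq_add, sub_eq_neg_add]

theorem gradedComm_algebraMap (M : Module.End ℝ (Forms F E)) (r : ℝ) :
    gradedComm M (algebraMap ℝ _ r) = 0 := by
  rw [gradedComm_eq_of_even_right (AlgHom.commutes _ r), Algebra.commutes, sub_self]

theorem algebraMap_gradedComm (M : Module.End ℝ (Forms F E)) (r : ℝ) :
    gradedComm (algebraMap ℝ _ r) M = 0 := by
  rw [gradedComm_eq_of_even_left (AlgHom.commutes _ r), Algebra.commutes, sub_self]

theorem zero_gradedComm (M : Module.End ℝ (Forms F E)) : gradedComm 0 M = 0 := by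
  have h := algebraMap_gradedComm M 0
  rwa [map_zero] at h

theorem derivedBracket_algebraMap (M : Module.End ℝ (Forms F E)) (r : ℝ) :
    derivedBracket δ (algebraMap ℝ _ r) M = 0 := by
  rw [derivedBracket, algebraMap_gradedComm, zero_gradedComm]

/-- The bracket of a multivector field and a function is determined by that of the function and the
multivector field. -/
theorem derivedBracket_insertion_funMV (hδ : sign δ = -δ) {S : Module.End ℝ (Forms F E)}
    {f : C^∞⟮𝓘(ℝ, F), E; ℝ⟯} (hS : S * insertion F E (funMV f) = insertion F E (funMV f) * S)
    (hS' : sign S * insertion F E (funMV f) = insertion F E (funMV f) * sign S) :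
    derivedBracket δ S (insertion F E (funMV f)) =
      derivedBracket δ (insertion F E (funMV f)) (sign S) := by
  rw [derivedBracket_funMV_right hδ, derivedBracket,
    gradedComm_eq_of_odd_left (sign_gradedComm_funMV hδ f), gradedComm_funMV_left, sign_sign]
  exact comm_even_swap hS hS'

theorem IsFirstOrder.mem_of_vecMV (hδ : IsFirstOrder δ) {S : Module.End ℝ (Forms F E)}
    (hS : S ∈ basicInsertions F E) (Y : VectorField F E) :
    derivedBracket δ S (insertion F E (vecMV Y)) ∈ basicInsertions F E := by
  induction hS using Algebra.adjoin_induction with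
  | mem S hS =>
    rcases hS with ⟨f, rfl⟩ | ⟨V, rfl⟩
    · obtain ⟨h, hh⟩ := hδ.fun_vec f Y
      exact hh ▸ funMV_mem h
    · obtain ⟨Z, hZ⟩ := hδ.vec_vec V Y
      exact hZ ▸ vecMV_mem Z
  | algebraMap r => rw [derivedBracket_algebraMap]; exact zero_mem _
  | add S T _ _ hS hT => rw [derivedBracket_add_left]; exact add_mem hS hT
  | mul S T hS hT hS' hT' =>
    rw [derivedBracket_mul_vecMV hδ.odd hS hT]
    exact add_mem (mul_mem hS hT') (mul_mem hS' hT)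

theorem IsFirstOrder.mem_of_funMV (hδ : IsFirstOrder δ) {S : Module.End ℝ (Forms F E)}
    (hS : S ∈ basicInsertions F E) (g : C^∞⟮𝓘(ℝ, F), E; ℝ⟯) :
    derivedBracket δ S (insertion F E (funMV g)) ∈ basicInsertions F E := by
  induction hS using Algebra.adjoin_induction with
  | mem S hS =>
    rcases hS with ⟨f, rfl⟩ | ⟨V, rfl⟩
    · rw [hδ.fun_fun]
      exact zero_mem _
    · rw [derivedBracket_insertion_funMV hδ.odd (insertion_mul_funMV _ _)
        (mul_funMV (sign_mem (vecMV_mem V)) g), sign_vecMV]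
      obtain ⟨h, hh⟩ := hδ.fun_vec g (-V)
      have e : vecMV (-V) = -vecMV V := by
        ext x
        exact map_neg _ _
      rw [e, map_neg] at hh
      exact hh ▸ funMV_mem h
  | algebraMap r => rw [derivedBracket_algebraMap]; exact zero_mem _
  | add S T _ _ hS hT => rw [derivedBracket_add_left]; exact add_mem hS hT
  | mul S T hS hT hS' hT' =>
    rw [derivedBracket_mul_funMV hδ.odd hS hT]
    exact add_mem (mul_mem hS hT') (mul_mem hS' (sign_mem hT))

/-- The algebra of insertions contains the even and the odd part of each of its elements. -/
theorem exists_even_add_odd {S : Module.End ℝ (Forms F E)} (hS : S ∈ basicInsertions F E) :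
    ∃ S₀ ∈ basicInsertions F E, ∃ S₁ ∈ basicInsertions F E,
      sign S₀ = S₀ ∧ sign S₁ = -S₁ ∧ S = S₀ + S₁ := by
  refine ⟨(2⁻¹ : ℝ) • (S + sign S), Subalgebra.smul_mem _ (add_mem hS (sign_mem hS)) _,
    (2⁻¹ : ℝ) • (S - sign S), Subalgebra.smul_mem _ (sub_mem hS (sign_mem hS)) _, ?_, ?_, ?_⟩
  · rw [map_smul, map_add, sign_sign, add_comm]
  · rw [map_smul, map_sub, sign_sign, ← smul_neg, neg_sub]
  · rw [← smul_add, add_add_sub_cancel, ← two_smul ℝ S, smul_smul]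
    norm_num

/-- The derived bracket of a first order operator preserves the algebra generated by the functions
and the vector fields, since it is a graded derivation in each argument. -/
theorem IsFirstOrder.derivedBracket_mem (hδ : IsFirstOrder δ) {T : Module.End ℝ (Forms F E)}
    (hT : T ∈ basicInsertions F E) : ∀ S ∈ basicInsertions F E,
      derivedBracket δ S T ∈ basicInsertions F E := by
  induction hT using Algebra.adjoin_induction with
  | mem T hT =>
    intro S hS
    rcases hT with ⟨g, rfl⟩ | ⟨Y, rfl⟩
    · exact hδ.mem_of_funMV hS g
    · exact hδ.mem_of_vecMV hS Y
  | algebraMap r =>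
    intro S hS
    rw [derivedBracket, gradedComm_algebraMap]
    exact zero_mem _
  | add T T' _ _ hT hT' =>
    intro S hS
    rw [derivedBracket_add_right]
    exact add_mem (hT S hS) (hT' S hS)
  | mul U W hU hW hU' hW' =>
    intro S hS
    obtain ⟨S₀, h₀, S₁, h₁, e₀, e₁, rfl⟩ := exists_even_add_odd hS
    rw [derivedBracket_add_left]
    refine add_mem ?_ ?_
    · have hM : sign (gradedComm S₀ δ) = -gradedComm S₀ δ := by
        rw [sign_gradedComm_of_odd_right hδ.odd, e₀]
      rw [derivedBracket, gradedComm_mul_of_odd hM]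
      exact add_mem (mul_mem (hU' S₀ h₀) hW) (mul_mem (sign_mem hU) (hW' S₀ h₀))
    · have hM : sign (gradedComm S₁ δ) = gradedComm S₁ δ := by
        rw [sign_gradedComm_of_odd_right hδ.odd, e₁]
        have h := gradedComm_add_left (-S₁) S₁ δ
        rw [neg_add_cancel, zero_gradedComm] at h
        exact (eq_neg_of_add_eq_zero_right h.symm).symm
      rw [derivedBracket, gradedComm_mul_of_even hM]
      exact add_mem (mul_mem (hU' S₁ h₁) hW) (mul_mem hU (hW' S₁ h₁))

end Closure

/-! ### Locality -/

section Locality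

variable {F : Type*} [NormedAddCommGroup F] [NormedSpace ℝ F] [FiniteDimensional ℝ F]
  {E : Type*} [TopologicalSpace E] [ChartedSpace F E] [IsManifold 𝓘(ℝ, F) ∞ E] [T2Space E]

/-- The operators `S` and `T` are local and agree near `x`: they map forms with the same germ at
`x` to forms with the same germ at `x`. -/
def EqNear (x : E) (S T : Module.End ℝ (Forms F E)) : Prop :=
  ∀ α β : Forms F E, (∀ᶠ y in 𝓝 x, α.1 y = β.1 y) → ∀ᶠ y in 𝓝 x, (S α).1 y = (T β).1 y

namespace EqNear

variable {x : E} {S S' T T' : Module.End ℝ (Forms F E)}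

theorem apply (h : EqNear x S T) (α : Forms F E) : (S α).1 x = (T α).1 x :=
  (h α α (Filter.Eventually.of_forall fun _ => rfl)).self_of_nhds

theorem add (h : EqNear x S T) (h' : EqNear x S' T') : EqNear x (S + S') (T + T') := by
  intro α β hαβ
  filter_upwards [h α β hαβ, h' α β hαβ] with y h1 h2
  exact congrArg₂ (· + ·) h1 h2

theorem sub (h : EqNear x S T) (h' : EqNear x S' T') : EqNear x (S - S') (T - T') := by
  intro α β hαβ
  filter_upwards [h α β hαβ, h' α β hαβ] with y h1 h2
  exact congrArg₂ (· - ·) h1 h2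

theorem smul (c : ℝ) (h : EqNear x S T) : EqNear x (c • S) (c • T) := by
  intro α β hαβ
  filter_upwards [h α β hαβ] with y h1
  exact congrArg (c • ·) h1

theorem mul (h : EqNear x S T) (h' : EqNear x S' T') : EqNear x (S * S') (T * T') :=
  fun α β hαβ => h _ _ (h' α β hαβ)

theorem sum {ι : Type*} (s : Finset ι) {f g : ι → Module.End ℝ (Forms F E)}
    (h : ∀ i, EqNear x (f i) (g i)) : EqNear x (∑ i ∈ s, f i) (∑ i ∈ s, g i) := by
  classical
  induction s using Finset.induction_on with
  | empty => exact fun α β _ => Filter.Eventually.of_forall fun _ => rfl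
  | insert i s hi ih =>
    rw [Finset.sum_insert hi, Finset.sum_insert hi]
    exact (h i).add ih

theorem parity (x : E) : EqNear x (parity : Module.End ℝ (Forms F E)) parity := by
  intro α β hαβ
  filter_upwards [hαβ] with y h1
  funext n
  rw [parity_apply, parity_apply, h1]

theorem gradedComm (h : EqNear x S T) (h' : EqNear x S' T') :
    EqNear x (gradedComm S S') (gradedComm T T') := by
  have ho : ∀ {U U' : Module.End ℝ (Forms F E)}, EqNear x U U' →
      EqNear x (oddPart U) (oddPart U') := fun hU =>
    (hU.sub (((parity x).mul hU).mul (parity x))).smul _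
  exact ((h.mul h').sub (h'.mul h)).add (((ho h').mul (ho h)).smul _)

theorem derivedBracket {δ : Module.End ℝ (Forms F E)} (hδ : EqNear x δ δ) (h : EqNear x S T)
    (h' : EqNear x S' T') : EqNear x (derivedBracket δ S S') (derivedBracket δ T T') :=
  (h.gradedComm hδ).gradedComm h'

theorem insertion {X Y : MultivectorField F E} (h : ∀ᶠ y in 𝓝 x, X.1 y = Y.1 y) :
    EqNear x (insertion F E X) (insertion F E Y) := by
  intro α β hαβ
  filter_upwards [h, hαβ] with y h1 h2
  rw [insertion_apply, insertion_apply, h1, h2]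

theorem extD (x : E) : EqNear x (extD : Module.End ℝ (Forms F E)) extD := by
  intro α β hαβ
  filter_upwards [eventually_eventually_nhds.2 hαβ] with y hy
  funext n
  cases n with
  | zero => rfl
  | succ n =>
    have hc : ContinuousAt (extChartAt 𝓘(ℝ, F) y).symm (extChartAt 𝓘(ℝ, F) y y) :=
      continuousAt_extChartAt_symm y
    rw [← (extChartAt 𝓘(ℝ, F) y).left_inv (mem_extChartAt_source y)] at hy
    have h : chartForm α.1 y n =ᶠ[𝓝 (extChartAt 𝓘(ℝ, F) y y)] chartForm β.1 y n := by
      filter_upwards [hc.eventually hy] with z hz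
      rw [chartForm, chartForm, hz]
    have h2 := h.extDeriv_eq
    ext v
    exact congrArg (fun L : F [⋀^Fin (n + 1)]→L[ℝ] ℝ => L fun i =>
      mfderiv 𝓘(ℝ, F) 𝓘(ℝ, F) (extChartAt 𝓘(ℝ, F) y) y (v i)) h2

theorem vertD (S : Splitting F E) (x : E) : EqNear x S.vertD S.vertD := by
  have hv : ∀ q, EqNear x (S.vertComp q) (S.vertComp q) := by
    intro q α β hαβ
    filter_upwards [hαβ] with y h1
    funext n
    rw [Splitting.vertComp_apply, Splitting.vertComp_apply, h1]
  exact EqNear.sum _ fun q => ((hv (q + 1)).mul (extD x)).mul (hv q)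

end EqNear

/-- The value of a multivector field at a point is determined by its insertion operator. -/
theorem eq_of_insertAt_eq {x : E} {a b : ExteriorAlgebra ℝ (TangentSpace 𝓘(ℝ, F) x)}
    (h : ∀ α : Forms F E, insertAt a (α.1 x) = insertAt b (α.1 x)) : a = b := by
  rw [← sub_eq_zero]
  refine eq_zero_of_insertAt_eq_zero (LinearMap.ext fun β => ?_)
  obtain ⟨α, rfl⟩ := exists_form_eq x β
  rw [map_sub, LinearMap.sub_apply, h, sub_self]
  rfl

theorem insertion_injective : Function.Injective (insertion F E) := by
  intro X Y h
  ext x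
  refine eq_of_insertAt_eq fun α => ?_
  rw [← insertion_apply, ← insertion_apply, h]

theorem exists_eventually_eq_basic (X : MultivectorField F E) (x₀ : E) :
    ∃ X' : MultivectorField F E, X'.1 ∈ basicMultivectors F E ∧ ∀ᶠ x in 𝓝 x₀, X.1 x = X'.1 x := by
  obtain ⟨Y, hY, h⟩ := X.2 x₀
  exact ⟨⟨Y, basicMultivectors_le hY⟩, hY, h⟩

/-- The derived bracket of two multivector fields is the insertion of a multivector field: locally
by the algebraic closure properties, and the local multivector fields agree where they are defined
since the insertion operator determines them. -/
theorem IsFirstOrder.exists_insertion_eq_derivedBracket {δ : Module.End ℝ (Forms F E)}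
    (hδ : IsFirstOrder δ) (hl : ∀ x, EqNear x δ δ) (X Y : MultivectorField F E) :
    ∃ Z, insertion F E Z = derivedBracket δ (insertion F E X) (insertion F E Y) := by
  set T := derivedBracket δ (insertion F E X) (insertion F E Y) with hT
  have hloc : ∀ x₀ : E, ∃ Z : MultivectorField F E, ∀ᶠ x in 𝓝 x₀, ∀ α : Forms F E,
      (T α).1 x = insertAt (Z.1 x) (α.1 x) := by
    intro x₀
    obtain ⟨X', hX', hX⟩ := exists_eventually_eq_basic X x₀
    obtain ⟨Y', hY', hY⟩ := exists_eventually_eq_basic Y x₀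
    obtain ⟨Z, hZ⟩ := exists_insertion_eq
      (hδ.derivedBracket_mem (insertion_mem hY') _ (insertion_mem hX'))
    refine ⟨Z, ?_⟩
    filter_upwards [eventually_eventually_nhds.2 hX,
      eventually_eventually_nhds.2 hY] with x h1 h2 α
    rw [hT, (EqNear.derivedBracket (hl x) (EqNear.insertion h1) (EqNear.insertion h2)).apply α,
      ← hZ, insertion_apply]
  choose Z hZ using hloc
  have heq : ∀ x₀, ∀ᶠ x in 𝓝 x₀, (Z x).1 x = (Z x₀).1 x := by
    intro x₀
    filter_upwards [hZ x₀] with x hx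
    refine eq_of_insertAt_eq fun α => ?_
    rw [← hx, (hZ x).self_of_nhds]
  refine ⟨⟨fun x => (Z x).1 x, fun x₀ => ?_⟩, end_ext fun α x => ?_⟩
  · obtain ⟨Z', hZ', h⟩ := exists_eventually_eq_basic (Z x₀) x₀
    refine ⟨Z'.1, hZ', ?_⟩
    filter_upwards [heq x₀, h] with x h1 h2
    rw [h1, h2]
  · rw [insertion_apply, (hZ x).self_of_nhds]

end Locality

/-! ### Brackets with functions -/

section Functions

/-- Conjugation with the grading involution of forms corresponds to the grading involution of the
exterior algebra. -/
theorem insertAt_parity {V : Type*} [AddCommGroup V] [Module ℝ V] (a : ExteriorAlgebra ℝ V)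
    (β : AltForms V) (n : ℕ) : (-1 : ℝ) ^ n • insertAt a (fun m => (-1 : ℝ) ^ m • β m) n =
      insertAt (CliffordAlgebra.involute a) β n := by
  have h2 : ∀ n : ℕ, (-1 : ℝ) ^ n * (-1) ^ n = 1 := fun n => by rw [← mul_pow]; simp
  induction a using ExteriorAlgebra.induction generalizing β n with
  | algebraMap r =>
    have e : CliffordAlgebra.involute (algebraMap ℝ (ExteriorAlgebra ℝ V) r) =
        algebraMap ℝ (ExteriorAlgebra ℝ V) r := AlgHom.commutes _ r
    rw [e, AlgHom.commutes]
    ext v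
    change (-1 : ℝ) ^ n * (r * ((-1 : ℝ) ^ n * β n v)) = r * β n v
    linear_combination r * β n v * h2 n
  | ι v =>
    have e : CliffordAlgebra.involute (ExteriorAlgebra.ι ℝ v) = -ExteriorAlgebra.ι ℝ v :=
      CliffordAlgebra.involute_ι v
    rw [e, map_neg, insertAt_ι]
    ext w
    change (-1 : ℝ) ^ n * ((-1 : ℝ) ^ (n + 1) * β (n + 1) (Matrix.vecCons v w)) =
      -β (n + 1) (Matrix.vecCons v w)
    rw [pow_succ]
    linear_combination -β (n + 1) (Matrix.vecCons v w) * h2 n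
  | mul a b ha hb =>
    rw [map_mul, map_mul, map_mul, Module.End.mul_apply, Module.End.mul_apply, ← ha]
    refine congrArg (fun γ : AltForms V => (-1 : ℝ) ^ n • insertAt a γ n) (funext fun m => ?_)
    rw [← hb, smul_smul, h2, one_smul]
  | add a b ha hb =>
    rw [map_add, map_add, map_add, LinearMap.add_apply, LinearMap.add_apply, Pi.add_apply,
      Pi.add_apply, smul_add, ha, hb]

theorem involute_of_mem_exteriorPower {V : Type*} [AddCommGroup V] [Module ℝ V] {k : ℕ}
    {a : ExteriorAlgebra ℝ V} (ha : a ∈ ⋀[ℝ]^k V) :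
    CliffordAlgebra.involute a = (-1 : ℝ) ^ k • a := by
  induction ha using Submodule.pow_induction_on_left' with
  | algebraMap r => simp
  | add x y i _ _ hx hy => rw [map_add, hx, hy, smul_add]
  | mem_mul m hm i x _ hx =>
    obtain ⟨v, rfl⟩ := hm
    have e : CliffordAlgebra.involute (ExteriorAlgebra.ι ℝ v) = -ExteriorAlgebra.ι ℝ v :=
      CliffordAlgebra.involute_ι v
    rw [map_mul, hx, e, pow_succ', mul_smul, neg_one_smul, mul_smul_comm, neg_mul, smul_neg]

/-- Contraction with a covector is an antiderivation of the exterior algebra. -/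
theorem contractLeft_mul {V : Type*} [AddCommGroup V] [Module ℝ V] (θ : Module.Dual ℝ V)
    (a b : ExteriorAlgebra ℝ V) : CliffordAlgebra.contractLeft θ (a * b) =
      CliffordAlgebra.contractLeft θ a * b +
        CliffordAlgebra.involute a * CliffordAlgebra.contractLeft θ b := by
  induction a using CliffordAlgebra.left_induction with
  | algebraMap r =>
    rw [CliffordAlgebra.contractLeft_algebraMap_mul, CliffordAlgebra.contractLeft_algebraMap,
      zero_mul, zero_add, AlgHom.commutes]
  | add x y hx hy => rw [add_mul, map_add, hx, hy, map_add, map_add, add_mul, add_mul]; abel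
  | ι_mul x v hx =>
    rw [mul_assoc, CliffordAlgebra.contractLeft_ι_mul, hx, CliffordAlgebra.contractLeft_ι_mul,
      map_mul, CliffordAlgebra.involute_ι, sub_mul, mul_add, smul_mul_assoc, neg_mul, neg_mul,
      mul_assoc, mul_assoc]
    abel

variable {F : Type*} [NormedAddCommGroup F] [NormedSpace ℝ F] [FiniteDimensional ℝ F]
  {E : Type*} [TopologicalSpace E] [ChartedSpace F E] [IsManifold 𝓘(ℝ, F) ∞ E] [T2Space E]

theorem sign_insertion_apply (X : MultivectorField F E) (α : Forms F E) (x : E) :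
    (sign (insertion F E X) α).1 x = insertAt (CliffordAlgebra.involute (X.1 x)) (α.1 x) := by
  funext n
  rw [sign_apply_apply, insertion_apply, ← insertAt_parity]
  rfl

theorem sign_insertion_of_hasDegree {X : MultivectorField F E} {k : ℕ} (hX : HasDegree X k) :
    sign (insertion F E X) = (-1 : ℝ) ^ k • insertion F E X := by
  refine end_ext fun α x => ?_
  rw [sign_insertion_apply, involute_of_mem_exteriorPower (hX x), map_smul]
  rfl

theorem extD_oneForm : extD (oneForm : Forms F E) = 0 := by
  ext x n v
  cases n with
  | zero => rfl
  | succ n =>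
    have hc : chartForm (oneForm : Forms F E).1 x n =
        fun _ => chartForm (oneForm : Forms F E).1 x n 0 := by
      funext y
      ext u
      cases n with
      | zero => rfl
      | succ n => rfl
    change extDeriv (chartForm (oneForm : Forms F E).1 x n) _ _ = 0
    rw [hc, extDeriv, fderiv_const_apply]
    refine (ContinuousAlternatingMap.alternatizeUncurryFin_apply _ _).trans
      (Finset.sum_eq_zero fun i _ => ?_)
    exact smul_zero _

theorem Splitting.vertD_oneForm (S : Splitting F E) : S.vertD oneForm = 0 := by
  have h0 : ∀ q, extD (S.vertComp q (oneForm : Forms F E)) = 0 := by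
    intro q
    cases q with
    | zero =>
      have e : S.vertComp 0 oneForm = oneForm := by
        refine Subtype.ext (funext fun x => funext fun n => ?_)
        rw [vertComp_apply]
        cases n with
        | zero => exact vertPart_zero_zero _ _
        | succ n => exact map_zero _
      rw [e, extD_oneForm]
    | succ q =>
      have e : S.vertComp (q + 1) (oneForm : Forms F E) = 0 := by
        refine Subtype.ext (funext fun x => funext fun n => ?_)
        rw [vertComp_apply]
        cases n with
        | zero => exact vertPart_eq_zero _ (Nat.succ_pos q) _
        | succ n => exact map_zero _
      rw [e, map_zero]
  rw [Splitting.vertD, LinearMap.sum_apply]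
  refine Finset.sum_eq_zero fun q _ => ?_
  rw [Module.End.mul_apply, Module.End.mul_apply, h0, map_zero]

variable {δ : Module.End ℝ (Forms F E)}

/-- The bracket of a function and a vector field, found by applying both sides of its defining
equation to the constant function one. -/
theorem IsFirstOrder.derivedBracket_funMV_vecMV_apply (hδ : IsFirstOrder δ)
    (h1 : δ oneForm = 0) (f : C^∞⟮𝓘(ℝ, F), E; ℝ⟯) (Y : VectorField F E) (α : Forms F E) (x : E) :
    (derivedBracket δ (insertion F E (funMV f)) (insertion F E (vecMV Y)) α).1 x =
      -((δ (ofFun f)).1 x 1 ![Y x]) • α.1 x := by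
  obtain ⟨h, hh⟩ := hδ.fun_vec f Y
  rw [hh, insertion_funMV_apply]
  congr 1
  have e1 : insertion F E (vecMV Y) oneForm = 0 := by
    refine Subtype.ext (funext fun x => ?_)
    rw [insertion_vecMV_apply]
    rfl
  have e2 : insertion F E (funMV f) oneForm = ofFun f := by
    refine Subtype.ext (funext fun x => funext fun n => ?_)
    rw [insertion_funMV_apply]
    cases n with
    | zero =>
      ext v
      exact mul_one _
    | succ n =>
      ext v
      exact mul_zero (f x)
  have e3 : gradedComm (insertion F E (funMV f)) δ oneForm = -δ (ofFun f) := by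
    rw [gradedComm_funMV_left]
    change insertion F E (funMV f) (δ oneForm) - δ (insertion F E (funMV f) oneForm) = _
    rw [h1, e2, map_zero, zero_sub]
  have h3 := congrArg (fun T : Module.End ℝ (Forms F E) => (T oneForm).1 x 0 ![]) hh
  rw [derivedBracket_funMV_vecMV hδ.odd] at h3
  have e4 : (gradedComm (insertion F E (funMV f)) δ * insertion F E (vecMV Y) +
      insertion F E (vecMV Y) * gradedComm (insertion F E (funMV f)) δ) oneForm =
      -insertion F E (vecMV Y) (δ (ofFun f)) := by
    change gradedComm (insertion F E (funMV f)) δ (insertion F E (vecMV Y) oneForm) +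
      insertion F E (vecMV Y) (gradedComm (insertion F E (funMV f)) δ oneForm) = _
    rw [e1, e3, map_zero, zero_add, map_neg]
  have e5 : (insertion F E (funMV h) oneForm).1 x 0 ![] = h x := by
    rw [insertion_funMV_apply]
    exact mul_one _
  have e6 : (insertion F E (vecMV Y) (δ (ofFun f))).1 x 0 ![] = (δ (ofFun f)).1 x 1 ![Y x] := by
    rw [insertion_vecMV_apply]
    rfl
  rw [← e5, ← h3, e4, ← e6]
  rfl

theorem conjInsert_funMV (θ : Forms F E) (f : C^∞⟮𝓘(ℝ, F), E; ℝ⟯) (x : E) :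
    conjInsert θ (funMV f) x = 0 :=
  CliffordAlgebra.contractLeft_algebraMap (Q := (0 : QuadraticForm ℝ (TangentSpace 𝓘(ℝ, F) x)))
    _ (f x)

theorem conjInsert_vecMV (θ : Forms F E) (V : VectorField F E) (x : E) :
    conjInsert θ (vecMV V) x = algebraMap ℝ _ (θ.1 x 1 ![V x]) := by
  refine (CliffordAlgebra.contractLeft_ι (Q := (0 : QuadraticForm ℝ (TangentSpace 𝓘(ℝ, F) x)))
    _ (V x)).trans (congrArg _ ?_)
  change θ.1 x 1 _ = _
  congr 1
  ext i
  fin_cases i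
  rfl

theorem conjInsert_add (θ : Forms F E) (U W : MultivectorField F E) (x : E) :
    conjInsert θ (U + W) x = conjInsert θ U x + conjInsert θ W x := map_add _ _ _

theorem conjInsert_mul (θ : Forms F E) (U W : MultivectorField F E) (x : E) :
    conjInsert θ (U * W) x =
      conjInsert θ U x * W.1 x + CliffordAlgebra.involute (U.1 x) * conjInsert θ W x :=
  contractLeft_mul _ _ _

theorem derivedBracket_funMV_insertion_apply_of_basic (hδ : IsFirstOrder δ) (h1 : δ oneForm = 0)
    (f : C^∞⟮𝓘(ℝ, F), E; ℝ⟯) (X : MultivectorField F E) (hX : X.1 ∈ basicMultivectors F E) :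
    ∀ (α : Forms F E) (x : E),
      (derivedBracket δ (insertion F E (funMV f)) (insertion F E X) α).1 x =
        insertAt (-conjInsert (δ (ofFun f)) X x) (α.1 x) := by
  refine basicMultivectors_induction (p := fun X => ∀ (α : Forms F E) (x : E),
      (derivedBracket δ (insertion F E (funMV f)) (insertion F E X) α).1 x =
        insertAt (-conjInsert (δ (ofFun f)) X x) (α.1 x)) (fun g α x => ?_) (fun V α x => ?_)
    (fun U W hU hW α x => ?_) (fun U W hU hW α x => ?_) hX
  · rw [hδ.fun_fun, conjInsert_funMV, neg_zero, map_zero]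
    rfl
  · rw [hδ.derivedBracket_funMV_vecMV_apply h1, conjInsert_vecMV, ← map_neg (algebraMap ℝ _),
      AlgHom.commutes]
    rfl
  · rw [map_add, derivedBracket_add_right, conjInsert_add, neg_add, map_add]
    exact congrArg₂ (· + ·) (hU α x) (hW α x)
  -- `[i_f, δ]` is odd, so both sides are antiderivations.
  · rw [map_mul, derivedBracket, gradedComm_mul_of_odd (sign_gradedComm_funMV hδ.odd f),
      conjInsert_mul, neg_add, map_add, ← neg_mul, ← mul_neg, map_mul, map_mul]
    refine congrArg₂ (· + ·) (hU _ x) ((sign_insertion_apply _ _ x).trans ?_)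
    exact congrArg (insertAt (CliffordAlgebra.involute (U.1 x))) (hW α x)

/-- The bracket of a function and a multivector field. -/
theorem derivedBracket_funMV_insertion_apply (hδ : IsFirstOrder δ) (hl : ∀ x, EqNear x δ δ)
    (h1 : δ oneForm = 0) (f : C^∞⟮𝓘(ℝ, F), E; ℝ⟯) (X : MultivectorField F E) (α : Forms F E)
    (x : E) : (derivedBracket δ (insertion F E (funMV f)) (insertion F E X) α).1 x =
        insertAt (-conjInsert (δ (ofFun f)) X x) (α.1 x) := by
  obtain ⟨X', hX', hX⟩ := exists_eventually_eq_basic X x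
  rw [(EqNear.derivedBracket (hl x) (EqNear.insertion (Filter.Eventually.of_forall fun _ => rfl))
    (EqNear.insertion hX)).apply α, derivedBracket_funMV_insertion_apply_of_basic hδ h1 f X' hX',
    conjInsert, conjInsert, hX.self_of_nhds]

theorem sign_insertion_mul_funMV (X : MultivectorField F E) (f : C^∞⟮𝓘(ℝ, F), E; ℝ⟯) :
    sign (insertion F E X) * insertion F E (funMV f) =
      insertion F E (funMV f) * sign (insertion F E X) := by
  have h := congrArg sign (insertion_mul_funMV X f)
  rwa [map_mul, map_mul, sign_funMV] at h

end Functions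

/-! ### Brackets of wedge products of vector fields -/

section Products

/-- A derivation `D` twisted by a sign `e`, applied to a product.  The last hypothesis says that a
factor can be moved past a value of `D` at the cost of the sign `-e`, so that the values of `D` can
be brought to the front of the product, where each factor passed contributes `-1`. -/
theorem twistedDerivation_prod_ofFn {R : Type*} [Ring R] [Algebra ℝ R] {A : Subalgebra ℝ R}
    {V : Set R} (hVA : V ⊆ A) {e : ℝ} {D : R → R}
    (hD : ∀ v ∈ V, ∀ w ∈ A, D (v * w) = D v * w + e • (v * D w))
    (hc : ∀ v ∈ V, ∀ w ∈ V, e • (v * D w) = -(D w * v)) {n : ℕ} (x : Fin (n + 1) → R)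
    (hx : ∀ i, x i ∈ V) : D (List.ofFn x).prod =
      ∑ i : Fin (n + 1), (-1 : ℝ) ^ (i : ℕ) • (D (x i) * (List.ofFn (i.removeNth x)).prod) := by
  have hmem : ∀ {k : ℕ} (y : Fin k → R), (∀ i, y i ∈ V) → (List.ofFn y).prod ∈ A := by
    intro k y hy
    refine list_prod_mem fun r hr => ?_
    obtain ⟨i, rfl⟩ := (List.mem_ofFn' y r).1 hr
    exact hVA (hy i)
  induction n with
  | zero => simp
  | succ n ih =>
    have hr : ∀ i : Fin (n + 1), (List.ofFn (i.succ.removeNth x)).prod =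
        x 0 * (List.ofFn (i.removeNth (Fin.tail x))).prod := by
      intro i
      rw [List.ofFn_succ, List.prod_cons]
      congr 3
      funext j
      simp [Fin.removeNth, Fin.tail]
    have ht : (List.ofFn x).prod = x 0 * (List.ofFn (Fin.tail x)).prod := by
      rw [List.ofFn_succ, List.prod_cons]
      rfl
    rw [ht, hD _ (hx 0) _ (hmem (Fin.tail x) fun i => hx _), ih (Fin.tail x) fun i => hx _,
      Fin.sum_univ_succ (n := n + 1)]
    congr 1
    · simp [Fin.tail_def]
    · rw [Finset.mul_sum, Finset.smul_sum]
      refine Finset.sum_congr rfl fun i _ => ?_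
      rw [hr, mul_smul_comm, smul_comm, ← mul_assoc, ← smul_mul_assoc,
        show Fin.tail x i = x i.succ from rfl, hc _ (hx 0) _ (hx i.succ),
        Fin.val_succ, pow_succ, mul_neg_one, neg_smul, neg_mul, smul_neg, mul_assoc]

variable {F : Type*} [NormedAddCommGroup F] [NormedSpace ℝ F] [FiniteDimensional ℝ F]
  {E : Type*} [TopologicalSpace E] [ChartedSpace F E] [IsManifold 𝓘(ℝ, F) ∞ E] [T2Space E]

theorem insertion_wedge {n : ℕ} (X : Fin n → VectorField F E) :
    insertion F E (wedge X) = (List.ofFn fun i => insertion F E (vecMV (X i))).prod := by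
  rw [wedge, map_list_prod, List.map_ofFn]
  rfl

theorem insertion_wedge_mem {n : ℕ} (X : Fin n → VectorField F E) :
    insertion F E (wedge X) ∈ basicInsertions F E := by
  rw [insertion_wedge]
  refine list_prod_mem fun r hr => ?_
  obtain ⟨i, rfl⟩ := (List.mem_ofFn' _ r).1 hr
  exact vecMV_mem (X i)

theorem sign_insertion_wedge {n : ℕ} (X : Fin n → VectorField F E) :
    sign (insertion F E (wedge X)) = (-1 : ℝ) ^ n • insertion F E (wedge X) := by
  rw [insertion_wedge]
  induction n with
  | zero => simp
  | succ n ih =>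
    rw [List.ofFn_succ, List.prod_cons, map_mul, sign_vecMV, ih fun i => X i.succ, mul_smul_comm,
      neg_mul, smul_neg, pow_succ, mul_neg_one, neg_smul]

variable {δ : Module.End ℝ (Forms F E)}

/-- The derived bracket with one vector field is a derivation, and its values on vector fields
anticommute with vector fields. -/
theorem derivedBracket_wedge_vecMV (hδ : IsFirstOrder δ) {m : ℕ} (X : Fin (m + 1) → VectorField F E)
    (Y : VectorField F E) : derivedBracket δ (insertion F E (wedge X)) (insertion F E (vecMV Y)) =
      ∑ i : Fin (m + 1), (-1 : ℝ) ^ (i : ℕ) •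
        (derivedBracket δ (insertion F E (vecMV (X i))) (insertion F E (vecMV Y)) *
          insertion F E (wedge (i.removeNth X))) := by
  have h := twistedDerivation_prod_ofFn (A := basicInsertions F E) (e := 1)
    (V := Set.range fun V : VectorField F E => insertion F E (vecMV V))
    (D := fun T => derivedBracket δ T (insertion F E (vecMV Y))) ?_ ?_ ?_
    (fun i => insertion F E (vecMV (X i))) fun i => ⟨X i, rfl⟩
  · rw [insertion_wedge]
    refine h.trans (Finset.sum_congr rfl fun i _ => ?_)
    rw [insertion_wedge]
    rfl
  · rintro _ ⟨V, rfl⟩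
    exact vecMV_mem V
  · rintro _ ⟨V, rfl⟩ w hw
    rw [one_smul, add_comm]
    exact derivedBracket_mul_vecMV hδ.odd (vecMV_mem V) hw Y
  · rintro _ ⟨V, rfl⟩ _ ⟨W, rfl⟩
    obtain ⟨Z, hZ⟩ := hδ.vec_vec W Y
    rw [one_smul, hZ]
    exact vecMV_mul_vecMV V Z

theorem sign_gradedComm_wedge (hδ : sign δ = -δ) {m : ℕ} (X : Fin (m + 1) → VectorField F E) :
    sign (gradedComm (insertion F E (wedge X)) δ) =
      (-1 : ℝ) ^ m • gradedComm (insertion F E (wedge X)) δ := by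
  rw [gradedComm_eq_of_odd_right hδ, map_sub, map_mul, map_mul, hδ, sign_sign,
    sign_insertion_wedge, pow_succ, mul_neg_one, neg_smul]
  generalize insertion F E (wedge X) = T
  rcases neg_one_pow_eq_or ℝ m with h | h
  · rw [h, one_smul, one_smul, mul_neg, mul_neg, neg_mul, neg_mul, neg_neg]
  · rw [h, neg_one_smul, neg_one_smul, neg_neg, mul_neg, neg_mul, neg_sub, sub_neg_eq_add,
      neg_add_eq_sub]

/-- The bracket of a product of `m + 1` vector fields and a vector field has degree `m + 1`, and is
moved past a vector field accordingly. -/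
theorem mul_derivedBracket_wedge (hδ : IsFirstOrder δ) {m : ℕ} (X : Fin (m + 1) → VectorField F E)
    (V W : VectorField F E) : (-1 : ℝ) ^ m • (insertion F E (vecMV V) *
        derivedBracket δ (insertion F E (wedge X)) (insertion F E (vecMV W))) =
      -(derivedBracket δ (insertion F E (wedge X)) (insertion F E (vecMV W)) *
        insertion F E (vecMV V)) := by
  have hs : sign (derivedBracket δ (insertion F E (wedge X)) (insertion F E (vecMV W))) =
      -((-1 : ℝ) ^ m • derivedBracket δ (insertion F E (wedge X)) (insertion F E (vecMV W))) := by
    rw [derivedBracket, gradedComm_vecMV_right, map_sub, map_mul, map_mul, sign_sign, sign_vecMV,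
      sign_gradedComm_wedge hδ.odd]
    generalize gradedComm (insertion F E (wedge X)) δ = M
    rcases neg_one_pow_eq_or ℝ m with h | h
    · rw [h, one_smul, one_smul, mul_neg, neg_mul, sub_neg_eq_add, neg_sub, neg_add_eq_sub]
    · rw [h, neg_one_smul, neg_one_smul, neg_neg, neg_mul_neg, neg_mul, mul_neg]
  rw [mul_vecMV (hδ.derivedBracket_mem (vecMV_mem W) _ (insertion_wedge_mem X)) V, hs, mul_neg,
    neg_neg, mul_smul_comm]

/-- The operator `[i_X, δ]` has the parity of `m`, and the graded commutator with it is a derivation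
twisted by `(-1)ᵐ`. -/
theorem derivedBracket_wedge_wedge (hδ : IsFirstOrder δ) {m n : ℕ}
    (X : Fin (m + 1) → VectorField F E) (Y : Fin (n + 1) → VectorField F E) :
    derivedBracket δ (insertion F E (wedge X)) (insertion F E (wedge Y)) =
      ∑ i : Fin (m + 1), ∑ j : Fin (n + 1), (-1 : ℝ) ^ ((i : ℕ) + (j : ℕ)) •
        (derivedBracket δ (insertion F E (vecMV (X i))) (insertion F E (vecMV (Y j))) *
          insertion F E (wedge (i.removeNth X)) * insertion F E (wedge (j.removeNth Y))) := by
  have h := twistedDerivation_prod_ofFn (A := basicInsertions F E) (e := (-1) ^ m)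
    (V := Set.range fun V : VectorField F E => insertion F E (vecMV V))
    (D := fun T => derivedBracket δ (insertion F E (wedge X)) T) ?_ ?_ ?_
    (fun j => insertion F E (vecMV (Y j))) fun j => ⟨Y j, rfl⟩
  · rw [insertion_wedge Y, Finset.sum_comm]
    refine h.trans (Finset.sum_congr rfl fun j _ => ?_)
    change _ • (derivedBracket δ (insertion F E (wedge X)) _ * _) = _
    rw [derivedBracket_wedge_vecMV hδ, Finset.sum_mul, Finset.smul_sum, insertion_wedge]
    refine Finset.sum_congr rfl fun i _ => ?_
    rw [smul_mul_assoc, smul_smul, ← pow_add, add_comm (j : ℕ)]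
    rfl
  · rintro _ ⟨V, rfl⟩
    exact vecMV_mem V
  · rintro _ ⟨V, rfl⟩ w hw
    have hM := sign_gradedComm_wedge hδ.odd X
    rcases neg_one_pow_eq_or ℝ m with h | h
    · rw [h, one_smul] at hM ⊢
      exact gradedComm_mul_of_even hM _ w
    · rw [h, neg_one_smul] at hM ⊢
      rw [← neg_mul, ← sign_vecMV]
      exact gradedComm_mul_of_odd hM _ w
  · rintro _ ⟨V, rfl⟩ _ ⟨W, rfl⟩
    exact mul_derivedBracket_wedge hδ X V W

/-- The derived bracket of a multivector field of degree `k` and a function. -/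
theorem derivedBracket_insertion_funMV_of_hasDegree (hδ : sign δ = -δ) {X : MultivectorField F E}
    {k : ℕ} (hX : HasDegree X k) (f : C^∞⟮𝓘(ℝ, F), E; ℝ⟯) :
    derivedBracket δ (insertion F E X) (insertion F E (funMV f)) =
      (-1 : ℝ) ^ k • derivedBracket δ (insertion F E (funMV f)) (insertion F E X) := by
  rw [derivedBracket_insertion_funMV hδ (insertion_mul_funMV X f) (sign_insertion_mul_funMV X f),
    sign_insertion_of_hasDegree hX, derivedBracket, derivedBracket,
    gradedComm_eq_of_odd_left (sign_gradedComm_funMV hδ f),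
    gradedComm_eq_of_odd_left (sign_gradedComm_funMV hδ f), map_smul, smul_sub, mul_smul_comm,
    smul_mul_assoc]

end Products

end
end VerticalSchouten

open VerticalSchouten

theorem mainTheorem1
    {F : Type*} [NormedAddCommGroup F] [NormedSpace ℝ F] [FiniteDimensional ℝ F]
    {G : Type*} [NormedAddCommGroup G] [NormedSpace ℝ G] [FiniteDimensional ℝ G]
    {E : Type*} [TopologicalSpace E] [ChartedSpace F E] [IsManifold 𝓘(ℝ, F) ∞ E] [T2Space E]
    {B : Type*} [TopologicalSpace B] [ChartedSpace G B] [IsManifold 𝓘(ℝ, G) ∞ B]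
    (p : E → B) (hp : ContMDiff 𝓘(ℝ, F) 𝓘(ℝ, G) ∞ p)
    (hsub : ∀ x, Function.Surjective (mfderiv 𝓘(ℝ, F) 𝓘(ℝ, G) p x))
    (g : PseudoRiemannianMetric F E)
    (hg : ∀ x, ∀ v ∈ vertSpace (F := F) (G := G) p x, v ≠ 0 → 0 < g.val x v v) :
    Function.Injective (insertion F E) ∧
    ∃ br : MultivectorField F E → MultivectorField F E → MultivectorField F E,
      (∀ X Y, insertion F E (br X Y) =
        derivedBracket (metricSplitting p hp hsub g hg).vertD (insertion F E X)
          (insertion F E Y)) ∧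
      (∀ (f : C^∞⟮𝓘(ℝ, F), E; ℝ⟯) (X : MultivectorField F E),
        (br (funMV f) X).1 =
          -conjInsert ((metricSplitting p hp hsub g hg).vertD (ofFun f)) X) ∧
      (∀ (k : ℕ) (X : MultivectorField F E) (f : C^∞⟮𝓘(ℝ, F), E; ℝ⟯), HasDegree X k →
        (br X (funMV f)).1 = (-1 : ℝ) ^ (k + 1) •
          conjInsert ((metricSplitting p hp hsub g hg).vertD (ofFun f)) X) ∧
      (∀ (m n : ℕ) (X : Fin (m + 1) → VectorField F E) (Y : Fin (n + 1) → VectorField F E),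
        br (wedge X) (wedge Y) = ∑ i : Fin (m + 1), ∑ j : Fin (n + 1),
          (-1 : ℝ) ^ ((i : ℕ) + (j : ℕ)) • (br (vecMV (X i)) (vecMV (Y j)) *
            wedge (i.removeNth X) * wedge (j.removeNth Y))) := by
  set S := metricSplitting p hp hsub g hg
  have hδ := S.isFirstOrder_vertD
  have hl := EqNear.vertD S
  choose br hbr using fun X Y => hδ.exists_insertion_eq_derivedBracket hl X Y
  have hf : ∀ (f : C^∞⟮𝓘(ℝ, F), E; ℝ⟯) (X : MultivectorField F E),
      (br (funMV f) X).1 = -conjInsert (S.vertD (ofFun f)) X := by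
    intro f X
    funext x
    refine eq_of_insertAt_eq fun α => ?_
    rw [← insertion_apply, hbr, derivedBracket_funMV_insertion_apply hδ hl S.vertD_oneForm]
    rfl
  refine ⟨insertion_injective, br, hbr, hf, fun k X f hX => ?_, fun m n X Y => ?_⟩
  · have h : br X (funMV f) = (-1 : ℝ) ^ k • br (funMV f) X := by
      refine insertion_injective ?_
      rw [map_smul, hbr, hbr, derivedBracket_insertion_funMV_of_hasDegree hδ.odd hX]
    rw [h, pow_succ, mul_neg_one, neg_smul, ← smul_neg, ← hf]
    rfl
  · refine insertion_injective ?_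
    rw [hbr, derivedBracket_wedge_wedge hδ]
    simp only [map_sum, map_smul, map_mul, hbr]
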